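/- **Setting.** CAO is a language of concurrent objects. A program consists of classes and a main block that creates finitely many objects and makes one asynchronous call. Classes have references to other objects (fixed at creation and never reassigned), fields, and methods. Statements are $\mathtt{v=e}$, $\mathtt{this.f=e}$, $\mathtt{v=e.get}_i$, $\mathtt{await}\ g_i$, $\mathtt{v=f!m(\bar e)}$ (on the object stored in the field $\mathtt f$), $\mathtt{skip}$, $\mathtt{return\ e}$, $\mathtt{while}$, $\mathtt{if}$ and sequential composition. Every method has exactly one $\mathtt{return}$, as its last statement. The locally abstract semantics of a method is a set of traces $sc\triangleright hs$, where $sc$ is a set of symbolic conditions and $hs$ alternates states and events (or a marker at suspensions). In the globally concrete semantics objects execute processes (sets of such traces) by agreement: all traces whose conditions become true under a substitution of the newly introduced symbolic values continue with the same concrete state–event–state triple. The global rules check that called futures are fresh and that read values (and the method of the read future) are those with which the future was resolved. For a program $P$, method $m$, object name $X$ and future $f$ (each concrete or symbolic), statement $s$ and state $\sigma$, a *selected trace* of $s$ from $\sigma$ is obtained from a trace of $m$ that is executed to its end in a terminating run of $P$ from its initial system: at some point the remaining program of $m$ starts with $s$ and the concretized state is $\sigma$; the part of the trace that is generated by $s$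 is taken and its symbolic values are replaced by those that the run uses. Formulas of Behavioral Program Logic are closed under first-order operators, updates $\{U\}$ and modalities $[s\Vdash^{\alpha}\tau]$, where $\alpha$ translates $\tau$ to a monadic second-order formula over traces. $[s\Vdash^\alpha\tau]$ holds in $\sigma$ (under interpretation $I$ and assignment $\beta$) iff every selected trace of $s$ from $\sigma$ satisfies $\alpha(\tau)$. A sequent $\Gamma\Rightarrow\Delta$ is valid iff $\bigwedge\Gamma\to\bigvee\Delta$ holds in all states under all assignments. A rule is sound iff validity of its premises implies validity of its conclusion, and a rewrite rule $\tau\leftrightsquigarrow\tau'$ is sound iff $\alpha(\tau)\equiv\alpha(\tau')$. **Method types** are $L::= X!m(\phi)\mid{\downarrow}(\phi)\mid\mathsf{skip}\mid L.L\mid L^*\mid\oplus\{L_i\}_{i\in I}\mid\&(\bar m,\phi)\{L,L\}$, over roles $X_0,\dots,X_n$ that are bound to reference fields $f_{X_0},\dots,f_{X_n}$ of the class. Positions of a trace are $\mathbf I=\{1,\dots,|\theta|\}$, with the first state at $1$. An event is *visible* if it is not $\mathsf{noEv}$; $\mathrm{quiet}(l)$ means that $l$ is a state or $\mathsf{noEv}$;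 $\varphi|_R$ restricts position quantifiers to $R$. Put $\alpha_{met}(L)=\exists X_0,\dots,X_n\in\mathsf O.\ \bigwedge_i ([1]\vdash X_i\doteq\mathtt{this}.f_{X_i})\wedge\alpha'(L)$, where - $\alpha'(X!m(\phi))$: every visible $i$ is an $\mathsf{invEv}$ of $m$ on $X$ with some arguments $\bar e$, and $[i-1]\vdash\phi(\bar e)$; - $\alpha'({\downarrow}(\phi))$: every visible $i$ is a $\mathsf{futEv}$ with some value $e$, and $[i-1]\vdash\phi[\mathtt{result}\backslash e]$; - $\alpha'(\mathsf{skip})=\forall l.\,\mathrm{quiet}(l)$; $\ \alpha'(\oplus\{L_i\}_{i\in I})=\bigvee_{i\in I}\alpha'(L_i)$; - $\alpha'(L_1.L_2)=\exists i.\ \alpha'(L_1)|_{n\le i}\wedge\alpha'(L_2)|_{n\ge i}$; - $\alpha'(L^*)$: there are a set $J\subseteq\mathbf I$ and $a\le b$ in $J$ such that every position $k$ satisfies $a\le k\le b$ or ($k<a$ and $k$ is a state or $\mathsf{noEv}$), and $\alpha'(L)|_{i_1\le n\le i_2}$ holds for all consecutive elements $i_1<i_2$ of $J$; - $\alpha'(\&(\bar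 m,\phi)\{L_1,L_2\})$: there are $i<j<k$ such that every position $l$ satisfies $l=j$, or $l\ge k$, or $l\le i$ and $\mathrm{quiet}(l)$; position $j$ is a $\mathsf{futREv}$ of some value $e$ from a future of a method in $\bar m$; and, with $\psi=([k]\vdash\phi[\mathtt{result}\backslash e])$, $\psi\to\alpha'(L_1)|_{n\ge k}$ and $\neg\psi\to\alpha'(L_2)|_{n\ge k}$. Auxiliary modalities: $\alpha_{pst}(\phi)$ says that $\phi$ holds in the last state (if $\mathtt{result}$ occurs in $\phi$, it is replaced by the value of a $\mathsf{futEv}$ that is the last event, and this value has the return type); $\alpha_{p2}(\bar m)$ says that the first event (position $2$) is a $\mathsf{futREv}$ for a method in $\bar m$. An obligation scheme assigns to every method $m$ a local protocol $?m(\phi_m).L_m$ (the proof obligation is $\phi_m\Rightarrow[s_m\Vdash^{\alpha_{met}}L_m]$, $s_m$ the body of $m$). It is *consistent* if, whenever $m$ is called in the method type of another method, the call condition (on the arguments) implies $\phi_m$ (on the parameters), and $\phi_{\mathtt{run}}=\mathrm{true}$. **Theorem.** For every CAO program, every interpretation and every consistent obligation scheme, for every method (with the role assignment of its protocol) the following rules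 and rewrite rules are sound. Write $[s\sim L]$ for $[s\Vdash^{\alpha_{met}}L]$. - met-V: from $\Gamma\Rightarrow\{U\}\{v:=e\}[s\sim L],\Delta$ infer $\Gamma\Rightarrow\{U\}[v=e;s\sim L],\Delta$. - met-F: from $\Gamma\Rightarrow\{U\}\{\mathrm{heap}:=\mathrm{store}(\mathrm{heap},f,e)\}[s\sim L],\Delta$ infer $\Gamma\Rightarrow\{U\}[\mathtt{this}.f=e;s\sim L],\Delta$. - met-get ($x$ fresh): from $\Gamma\Rightarrow\{U\}\{v:=x\}(\phi(x)\to[s\sim L_1]),\Delta$; $\ \Gamma\Rightarrow\{U\}\{v:=x\}(\neg\phi(x)\to[s\sim L_2]),\Delta$; and $\Rightarrow[v=e.\mathtt{get}_i;s\Vdash^{\alpha_{p2}}\bar m]$ infer $\Gamma\Rightarrow\{U\}[v=e.\mathtt{get}_i;s\sim\&(\bar m,\phi)\{L_1,L_2\}],\Delta$. - met-while: from $\Gamma\Rightarrow\{U\}J,\Delta$; $\ J,e\Rightarrow[s\Vdash^{\alpha_{pst}}J]$; $\ J,e\Rightarrow[s\sim L]$; and $J,\neg e\Rightarrow[s'\sim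 L']$ infer $\Gamma\Rightarrow\{U\}[\mathtt{while}(e)\{s\};s'\sim L^*.L'],\Delta$. - met-if ($I_1,I_2\neq\emptyset$, $I_1\cup I_2\subseteq I$): from $\Gamma\Rightarrow\{U\}(e\to[s;s''\sim\oplus\{L_i\}_{i\in I_1}]),\Delta$ and $\Gamma\Rightarrow\{U\}(\neg e\to[s';s''\sim\oplus\{L_i\}_{i\in I_2}]),\Delta$ infer $\Gamma\Rightarrow\{U\}[\mathtt{if}(e)\{s\}\mathtt{else}\{s'\};s''\sim\oplus\{L_i\}_{i\in I}],\Delta$. - met-call ($x$ fresh, $O$ the field of the role $O$): from $\Gamma\Rightarrow\{U\}\phi(\bar e),\Delta$ and $\Gamma\Rightarrow\{U\}\{v:=x\}[s\sim L],\Delta$ infer $\Gamma\Rightarrow\{U\}[v=O!m(\bar e);s\sim O!m(\phi).L],\Delta$. - met-return: from $\Gamma\Rightarrow\{U\}\{\mathtt{result}:=e\}\phi,\Delta$ infer $\Gamma\Rightarrow\{U\}[\mathtt{return}\ e\sim{\downarrow}(\phi)],\Delta$. - met-skip: infer $\Gamma\Rightarrow\{U\}[\mathtt{skip}\sim\mathsf{skip}],\Delta$.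 - Rewrite rules: $L\leftrightsquigarrow\oplus\{L\}$, $\ \mathsf{skip}.L\leftrightsquigarrow L$, $\ L.\mathsf{skip}\leftrightsquigarrow L$. -/

import Mathlib

/-! # CAO, its locally abstract / globally concrete semantics, Behavioral Program Logic, method types -/

noncomputable section

namespace CAO

open Classical

/-! ## Syntax of CAO -/

abbrev ClassName := ℕ
abbrev Field := ℕ

/-- Method names, qualified by their class. -/
structure MName where
  cls : ClassName
  name : ℕ
deriving DecidableEq

/-- The name of the method `run`. -/
def runName : ℕ := 0

/-- Variables of local states: program variables, and the specification variable `result`. -/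
inductive Var where
  | name (n : ℕ)
  | result

/-- Data types. -/
inductive DType where
  | rat | unit | int | bool
  | list (D : DType)
  | fut (D : DType)

inductive UnOp where
  | len | hd | tl | not | neg

/-- `cons`, the operators of the grammar, and the comparisons. -/
inductive BinOp where
  | cons | and | or | add | sub | mul | div | lt | le | eq

/-- Expressions; `field f` is `this.f`, `never` is the future that is never resolved. -/
inductive Expr where
  | var (v : ℕ)
  | field (f : Field)
  | lit (n : ℕ)
  | never | nil | tru | fls
  | un (op : UnOp) (e : Expr)
  | bin (op : BinOp) (e e' : Expr)

/-- Locations: program variables and fields. -/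
inductive Loc where
  | var (v : ℕ)
  | field (f : Field)

/-- Guards of `await`: a Boolean expression `e`, or a future `e?`. -/
inductive Guard where
  | cond (e : Expr)
  | fut (e : Expr)

/-- Statements. The optional data type marks a declaration, the numeral of `get` and `await` is the
program-point identifier; `call d v f m es` is `v = f!m(es)` on the object stored in the field `f`. -/
inductive Stmt where
  | asg (d : Option DType) (l : Loc) (e : Expr)
  | get (d : Option DType) (v : ℕ) (e : Expr) (i : ℕ)
  | await (g : Guard) (i : ℕ)
  | call (d : Option DType) (v : ℕ) (f : Field) (m : MName) (es : List Expr)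
  | skip
  | ret (e : Expr)
  | whl (e : Expr) (s : Stmt)
  | ite (e : Expr) (s s' : Stmt)
  | seq (s s' : Stmt)

/-- A statement as the list of its sequentially composed parts (`;` is associative). -/
def Stmt.flat : Stmt → List Stmt
  | .seq s s' => s.flat ++ s'.flat
  | s => [s]

/-- The declarations occurring in a statement. -/
def Stmt.decls : Stmt → List (ℕ × DType)
  | .asg (some D) (.var v) _ => [(v, D)]
  | .get (some D) v _ _ => [(v, D)]
  | .call (some D) v _ _ _ => [(v, D)]
  | .whl _ s => s.decls
  | .ite _ s s' => s.decls ++ s'.decls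
  | .seq s s' => s.decls ++ s'.decls
  | _ => []

/-- The statement contains no `return`. -/
def Stmt.NoRet : Stmt → Prop
  | .ret _ => False
  | .whl _ s => s.NoRet
  | .ite _ s s' => s.NoRet ∧ s'.NoRet
  | .seq s s' => s.NoRet ∧ s'.NoRet
  | _ => True

/-- The statement assigns to the field `f`. -/
def Stmt.AssignsField (f : Field) : Stmt → Prop
  | .asg _ (.field g) _ => g = f
  | .whl _ s => s.AssignsField f
  | .ite _ s s' => s.AssignsField f ∨ s'.AssignsField f
  | .seq s s' => s.AssignsField f ∨ s'.AssignsField f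
  | _ => False

structure Method where
  name : ℕ
  ret : DType
  params : List (DType × ℕ)
  body : Stmt

/-- Classes: `refs` are the references to other objects, which cannot be reassigned. -/
structure ClassDecl where
  name : ClassName
  refs : List (ClassName × Field)
  fields : List (DType × Field × Expr)
  meths : List Method

/-- Object creation `cls var = cls(args)` in the main block. -/
structure Creation where
  cls : ClassName
  var : ℕ
  args : List ℕ

/-- A program: classes, and a main block that creates objects and makes one call `target!meth(args)`. -/
structure Program where
  classes : List ClassDecl
  objs : List Creation
  target : ℕ
  meth : MName
  args : List Expr

def Program.cls? (P : Program) (C : ClassName) : Option ClassDecl :=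
  P.classes.find? (fun c => c.name == C)

def Program.meth? (P : Program) (m : MName) : Option Method :=
  (P.cls? m.cls).bind (fun c => c.meths.find? (fun d => d.name == m.name))

/-- `f` is one of the references of the class `C`. -/
def Program.IsRef (P : Program) (C : ClassName) (f : Field) : Prop :=
  ∃ c, P.cls? C = some c ∧ ∃ r ∈ c.refs, r.2 = f

/-- The index of the object that the main block binds to `v`. -/
def Program.objOf (P : Program) (v : ℕ) : Option ℕ := P.objs.findIdx? (fun c => c.var == v)

/-- The constraints on programs: every method has exactly one `return`, its very last statement;
references are not reassigned; the main block is type correct. -/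
structure Program.WF (P : Program) : Prop where
  ret_last : ∀ m d, P.meth? m = some d →
    ∃ l e, d.body.flat = l ++ [Stmt.ret e] ∧ ∀ s ∈ l, Stmt.NoRet s
  refs_const : ∀ m d f, P.meth? m = some d → P.IsRef m.cls f → ¬ d.body.AssignsField f
  main_typed : ∀ cr ∈ P.objs, ∃ c, P.cls? cr.cls = some c ∧
    List.Forall₂ (fun a (r : ClassName × Field) =>
      ∃ j cr', P.objOf a = some j ∧ P.objs[j]? = some cr' ∧ cr'.cls = r.1) cr.args c.refs

/-! ## Semantic values and symbolic expressions -/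

/-- Semantic values: `obj n` is the object of the `n`-th creation, `no` is never resolved. -/
inductive Val where
  | unit
  | bool (b : Bool)
  | num (q : ℚ)
  | obj (n : ℕ)
  | fut (n : ℕ)
  | no
  | list (l : List Val)

def DType.default : DType → Val
  | .rat => .num 0
  | .unit => .unit
  | .int => .num 0
  | .bool => .bool false
  | .list _ => .list []
  | .fut _ => .no

/-- The values of a data type. -/
def DType.Mem : DType → Val → Prop
  | .rat, v => ∃ q, v = .num q
  | .unit, v => v = .unit
  | .int, v => ∃ z : ℤ, v = .num z
  | .bool, v => ∃ b, v = .bool b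
  | .list D, v => ∃ l, v = .list l ∧ ∀ x ∈ l, D.Mem x
  | .fut _, v => v = .no ∨ ∃ n, v = .fut n

def UnOp.eval : UnOp → Val → Option Val
  | .len, .list l => some (.num l.length)
  | .hd, .list (a :: _) => some a
  | .tl, .list (_ :: l) => some (.list l)
  | .not, .bool b => some (.bool (!b))
  | .neg, .num q => some (.num (-q))
  | _, _ => none

def BinOp.eval : BinOp → Val → Val → Option Val
  | .cons, a, .list l => some (.list (a :: l))
  | .and, .bool a, .bool b => some (.bool (a && b))
  | .or, .bool a, .bool b => some (.bool (a || b))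
  | .add, .num a, .num b => some (.num (a + b))
  | .sub, .num a, .num b => some (.num (a - b))
  | .mul, .num a, .num b => some (.num (a * b))
  | .div, .num a, .num b => if b = 0 then none else some (.num (a / b))
  | .lt, .num a, .num b => some (.bool (decide (a < b)))
  | .le, .num a, .num b => some (.bool (decide (a ≤ b)))
  | .eq, a, b => some (.bool (decide (a = b)))
  | _, _, _ => none

/-- Symbolic expressions over symbolic values `sym n` and symbolic fields `fld f i`. -/
inductive SE where
  | val (v : Val)
  | sym (n : ℕ)
  | fld (f : Field) (i : ℕ)
  | un (op : UnOp) (e : SE)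
  | bin (op : BinOp) (e e' : SE)

/-- Application of an operator, evaluated at once on semantic values. -/
def SE.mkUn (op : UnOp) : SE → Option SE
  | .val v => (op.eval v).map .val
  | e => some (.un op e)

def SE.mkBin (op : BinOp) : SE → SE → Option SE
  | .val v, .val w => (op.eval v w).map .val
  | e, e' => some (.bin op e e')

/-- Object states: a local state and a heap. -/
@[ext] structure State (α : Type) where
  loc : Var → α
  heap : Field → α

def State.setVar {α : Type} (st : State α) (v : Var) (a : α) : State α :=
  ⟨Function.update st.loc v a, st.heap⟩

def State.setField {α : Type} (st : State α) (f : Field) (a : α) : State α :=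
  ⟨st.loc, Function.update st.heap f a⟩

/-- Evaluation of expressions; undefined at division by zero and the head of an empty list. -/
def Expr.eval (st : State SE) : Expr → Option SE
  | .var v => some (st.loc (.name v))
  | .field f => some (st.heap f)
  | .lit n => some (.val (.num n))
  | .never => some (.val .no)
  | .nil => some (.val (.list []))
  | .tru => some (.val (.bool true))
  | .fls => some (.val (.bool false))
  | .un op e => (e.eval st).bind (SE.mkUn op)
  | .bin op e e' => (e.eval st).bind fun a => (e'.eval st).bind fun b => SE.mkBin op a b

/-! ## Events, histories, traces -/

/-- Events over values `α`, method names `μ`, guards `ε` and program-point identifiers `ι`. -/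
inductive Event (α μ ε ι : Type) where
  | invEv (caller callee fut : α) (m : μ) (args : List α)
  | invREv (obj fut : α) (m : μ) (args : List α)
  | futEv (obj fut : α) (m : μ) (res : α)
  | futREv (obj fut : α) (m : μ) (res : α) (i : ι)
  | condEv (obj fut : α) (e : ε) (i : ι)
  | condREv (obj fut : α) (e : ε) (i : ι)
  | suspEv (obj fut : α) (e : α) (i : ι)
  | suspREv (obj fut : α) (e : α) (i : ι)
  | noEv

def Event.mapM {α μ ε ι α' μ' ε' ι' : Type} (a : α → Option α') (b : μ → Option μ')
    (c : ε → Option ε') (d : ι → Option ι') : Event α μ ε ι → Option (Event α' μ' ε' ι')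
  | .invEv x y f m es => do return .invEv (← a x) (← a y) (← a f) (← b m) (← es.mapM a)
  | .invREv x f m es => do return .invREv (← a x) (← a f) (← b m) (← es.mapM a)
  | .futEv x f m e => do return .futEv (← a x) (← a f) (← b m) (← a e)
  | .futREv x f m e i => do return .futREv (← a x) (← a f) (← b m) (← a e) (← d i)
  | .condEv x f e i => do return .condEv (← a x) (← a f) (← c e) (← d i)
  | .condREv x f e i => do return .condREv (← a x) (← a f) (← c e) (← d i)
  | .suspEv x f e i => do return .suspEv (← a x) (← a f) (← a e) (← d i)
  | .suspREv x f e i => do return .suspREv (← a x) (← a f) (← a e) (← d i)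
  | .noEv => some .noEv

/-- The elements at even positions of a history: events and the marker `⋄` (`gap`). -/
inductive Lab (E : Type) where
  | ev (e : E)
  | gap

/-- Histories: a state, followed by pairs of a label and a state. -/
structure Hist (α E : Type) where
  first : State α
  rest : List (Lab E × State α)

/-- The last state of a history. -/
def Hist.last {α E : Type} (h : Hist α E) : State α :=
  (h.rest.getLast?.map Prod.snd).getD h.first

/-- The elements of a history. -/
inductive Elem (α E : Type) where
  | st (s : State α)
  | lab (l : Lab E)

def Hist.elems {α E : Type} (h : Hist α E) : List (Elem α E) :=
  .st h.first :: h.rest.flatMap (fun p => [.lab p.1, .st p.2])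

/-- The element at a position, counted from `1`. -/
def Hist.at {α E : Type} (h : Hist α E) (i : ℤ) : Option (Elem α E) :=
  if 1 ≤ i then h.elems[(i - 1).toNat]? else none

/-- Method names in symbolic events: a name, or the symbolic method of a read. -/
abbrev SMeth := MName ⊕ ℕ

abbrev SEvent := Event SE SMeth Expr ℕ
abbrev CEvent := Event Val MName Expr ℕ
abbrev SHist := Hist SE SEvent
/-- Concrete histories, without symbolic values. -/
abbrev CHist := Hist Val CEvent

/-- Local traces `sc ▷ hs`. -/
structure STrace where
  sc : Set SE
  hist : SHist

/-! ## Locally abstract semantics -/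

/-- Object name, resolved future, method name and references, for which a statement is evaluated. -/
structure LCtx where
  obj : SE
  fut : SE
  meth : MName
  isRef : Field → Prop

/-- The remaining statements, the current state, and the next fresh number. -/
structure LCfg where
  todo : List Stmt
  st : State SE
  next : ℕ

/-- The heap after a suspension: fresh symbolic fields, except for the references. -/
def LCtx.freshHeap (c : LCtx) (st : State SE) (j : ℕ) : State SE :=
  ⟨st.loc, fun f => if c.isRef f then st.heap f else .fld f j⟩

/-- One unfolding of the equations of the locally abstract semantics: the traces of the left
configuration are the traces of the right one, with the given conditions added to the selection
condition and the given elements chopped in front of the history. -/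
inductive LStep (c : LCtx) :
    LCfg → Set SE → List (Lab SEvent × State SE) → LCfg → Prop where
  | skip (k st n) : LStep c ⟨.skip :: k, st, n⟩ ∅ [] ⟨k, st, n⟩
  | asgVar (d v e k st n a) : Expr.eval st e = some a →
      LStep c ⟨.asg d (.var v) e :: k, st, n⟩ ∅ [(.ev .noEv, st.setVar (.name v) a)]
        ⟨k, st.setVar (.name v) a, n⟩
  | asgField (d f e k st n a) : Expr.eval st e = some a →
      LStep c ⟨.asg d (.field f) e :: k, st, n⟩ ∅ [(.ev .noEv, st.setField f a)]
        ⟨k, st.setField f a, n⟩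
  | ret (e k st n a) : Expr.eval st e = some a →
      LStep c ⟨.ret e :: k, st, n⟩ ∅ [(.ev (.futEv c.obj c.fut (.inl c.meth) a), st)] ⟨k, st, n⟩
  | iteT (e s s' k st n a) : Expr.eval st e = some a →
      LStep c ⟨.ite e s s' :: k, st, n⟩ {a} [] ⟨s.flat ++ k, st, n⟩
  | iteF (e s s' k st n a) : Expr.eval st (.un .not e) = some a →
      LStep c ⟨.ite e s s' :: k, st, n⟩ {a} [] ⟨s'.flat ++ k, st, n⟩
  | whlT (e s k st n a) : Expr.eval st e = some a →
      LStep c ⟨.whl e s :: k, st, n⟩ {a} [] ⟨s.flat ++ .whl e s :: k, st, n⟩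
  | whlF (e s k st n a) : Expr.eval st (.un .not e) = some a →
      LStep c ⟨.whl e s :: k, st, n⟩ {a} [] ⟨k, st, n⟩
  | get (d v e i k st n a) : Expr.eval st e = some a →
      LStep c ⟨.get d v e i :: k, st, n⟩ ∅
        [(.ev (.futREv c.obj a (.inr n) (.sym n) i), st.setVar (.name v) (.sym n))]
        ⟨k, st.setVar (.name v) (.sym n), n + 1⟩
  | call (d v f m es k st n as) : es.mapM (Expr.eval st) = some as →
      LStep c ⟨.call d v f m es :: k, st, n⟩ ∅
        [(.ev (.invEv c.obj (st.heap f) (.sym n) (.inl m) as), st.setVar (.name v) (.sym n))]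
        ⟨k, st.setVar (.name v) (.sym n), n + 1⟩
  | awaitFut (e i k st n a) : Expr.eval st e = some a →
      LStep c ⟨.await (.fut e) i :: k, st, n⟩ ∅
        [(.ev (.suspEv c.obj c.fut a i), st), (.gap, c.freshHeap st n),
          (.ev (.suspREv c.obj c.fut a i), c.freshHeap st n)]
        ⟨k, c.freshHeap st n, n + 1⟩
  | awaitCond (e i k st n) :
      LStep c ⟨.await (.cond e) i :: k, st, n⟩ ∅
        [(.ev (.condEv c.obj c.fut e i), st), (.gap, c.freshHeap st n),
          (.ev (.condREv c.obj c.fut e i), c.freshHeap st n)]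
        ⟨k, c.freshHeap st n, n + 1⟩

/-- Finite unfoldings. -/
inductive LRun (c : LCtx) :
    LCfg → Set SE → List (Lab SEvent × State SE) → LCfg → Prop where
  | refl (g) : LRun c g ∅ [] g
  | step (g sc p g' sc' p' g'') : LStep c g sc p g' → LRun c g' sc' p' g'' →
      LRun c g (sc ∪ sc') (p ++ p') g''

/-- The traces of a list of statements, from a state and a fresh number. -/
def localSem (c : LCtx) (k : List Stmt) (st : State SE) (n : ℕ) : Set STrace :=
  {θ | ∃ st' n', LRun c ⟨k, st, n⟩ θ.sc θ.hist.rest ⟨[], st', n'⟩ ∧ θ.hist.first = st}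

/-- Prepends the invocation reaction event to the traces of a method body. -/
def methTrace (c : LCtx) (args : List SE) (θ : STrace) : STrace :=
  ⟨θ.sc, ⟨θ.hist.first,
    (.ev (.invREv c.obj c.fut (.inl c.meth) args), θ.hist.first) :: θ.hist.rest⟩⟩

/-! ## Concretizers -/

/-- Partial functions from symbolic values, symbolic methods and symbolic fields to semantic values. -/
structure Concretizer where
  sym : ℕ → Option Val
  meth : ℕ → Option MName
  fld : Field → ℕ → Option Val

/-- `χ ⊆ χ'`. -/
def Concretizer.Le (χ χ' : Concretizer) : Prop :=
  (∀ n v, χ.sym n = some v → χ'.sym n = some v) ∧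
  (∀ n m, χ.meth n = some m → χ'.meth n = some m) ∧
  (∀ f i v, χ.fld f i = some v → χ'.fld f i = some v)

/-- Substitution, with evaluation of the resulting semantic values. -/
def SE.app (χ : Concretizer) : SE → Option SE
  | .val v => some (.val v)
  | .sym n => some (((χ.sym n).map .val).getD (.sym n))
  | .fld f i => some (((χ.fld f i).map .val).getD (.fld f i))
  | .un op e => (e.app χ).bind (SE.mkUn op)
  | .bin op e e' => (e.app χ).bind fun a => (e'.app χ).bind fun b => SE.mkBin op a b

def Concretizer.appMeth (χ : Concretizer) : SMeth → SMeth
  | .inl m => .inl m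
  | .inr n => ((χ.meth n).map .inl).getD (.inr n)

def Concretizer.AppState (χ : Concretizer) (st st' : State SE) : Prop :=
  (∀ v, (st.loc v).app χ = some (st'.loc v)) ∧ ∀ f, (st.heap f).app χ = some (st'.heap f)

def Concretizer.AppLab (χ : Concretizer) : Lab SEvent → Lab SEvent → Prop
  | .ev e, .ev e' => e.mapM (SE.app χ) (fun m => some (χ.appMeth m)) some some = some e'
  | .gap, .gap => True
  | _, _ => False

/-- `h'` is the result of applying `χ` to `h`. -/
def Concretizer.AppHist (χ : Concretizer) (h h' : SHist) : Prop :=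
  χ.AppState h.first h'.first ∧
  List.Forall₂ (fun a b => χ.AppLab a.1 b.1 ∧ χ.AppState a.2 b.2) h.rest h'.rest

/-- Concrete states, labels and histories as symbolic ones. -/
def State.emb (st : State Val) : State SE := ⟨fun v => .val (st.loc v), fun f => .val (st.heap f)⟩

def Lab.emb : Lab CEvent → Lab SEvent
  | .ev e => ((e.mapM (fun v => some (SE.val v)) (fun m => some (Sum.inl m)) some some).map
      Lab.ev).getD .gap
  | .gap => .gap

def Hist.emb (h : CHist) : SHist := ⟨h.first.emb, h.rest.map fun p => (p.1.emb, p.2.emb)⟩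

/-- All conditions of the selection condition become `True` under `χ`. -/
def Concretizer.Selectable (χ : Concretizer) (sc : Set SE) : Prop :=
  ∀ e ∈ sc, e.app χ = some (.val (.bool true))

/-! ## Agreement -/

/-- The symbolic value that an event introduces. -/
def Event.intro : SEvent → Option ℕ
  | .invEv _ _ (.sym n) _ _ => some n
  | .futREv _ _ (.inr n) _ _ => some n
  | _ => none

/-- The concretizer of one step of a trace that starts in `st` with the event `e`, in the heap `ρ`: the
symbolic fields of the current heap are replaced according to `ρ`, the symbolic value that `e`
introduces is replaced by `v` (and the symbolic method by `m`). -/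
def stepConc (ρ : Field → Val) (v : Val) (m : MName) (st : State SE) (e : SEvent) : Concretizer where
  sym n := if e.intro = some n then some v else none
  meth n := if e.intro = some n then some m else none
  fld f i := if st.heap f = .fld f i then some (ρ f) else none

/-- The concrete three-element history on which traces agree. -/
structure Cand where
  pre : State Val
  ev : CEvent
  post : State Val

/-- The suffix of a trace after a step to `st`; a marker directly after the step is dropped. -/
def suffix (st : State SE) : List (Lab SEvent × State SE) → SHist
  | (.gap, st') :: r => ⟨st', r⟩
  | r => ⟨st, r⟩

/-- The candidate of `θ` in the heap `ρ` is selected when the introduced symbolic value is replaced by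
`v` (and `m`): it becomes the concrete `F`, every condition that becomes a semantic value is `True`;
`θ'` is the continuation, and `χ` the concretizer of the step. -/
def Selects (ρ : Field → Val) (v : Val) (m : MName) (θ : STrace) (F : Cand) (θ' : STrace)
    (χ : Concretizer) : Prop :=
  ∃ st e st' r, θ.hist = ⟨st, (.ev e, st') :: r⟩ ∧ χ = stepConc ρ v m st e ∧
    χ.AppState st F.pre.emb ∧ χ.AppLab (.ev e) (Lab.emb (.ev F.ev)) ∧ χ.AppState st' F.post.emb ∧
    (∀ a ∈ θ.sc, ∃ b, a.app χ = some b ∧ ∀ w, b = .val w → w = .bool true) ∧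
    θ'.sc = {b | ∃ a ∈ θ.sc, a.app χ = some b} ∧
    χ.AppHist (suffix st' r) θ'.hist

/-- The set of traces `Θ` `ρ`-agrees on `F` with continuation `Θ'`. Executed traces are dropped. -/
def Agrees (ρ : Field → Val) (v : Val) (m : MName) (Θ : Set STrace) (F : Cand)
    (Θ' : Set STrace) : Prop :=
  (∃ θ ∈ Θ, ∃ θ' χ, Selects ρ v m θ F θ' χ) ∧
  (∀ θ ∈ Θ, ∀ F' θ' χ, Selects ρ v m θ F' θ' χ → F' = F) ∧
  Θ' = {θ' | θ'.hist.rest ≠ [] ∧ ∃ θ ∈ Θ, ∃ χ, Selects ρ v m θ F θ' χ}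

/-! ## Globally concrete semantics -/

/-- Objects: the pool of inactive traces sets, indexed by the futures that they resolve; the object
trace; the active set of traces with its future. -/
structure ObjSt where
  cls : ClassName
  pool : ℕ → Option (Set STrace)
  hist : CHist
  active : Option (ℕ × Set STrace)

/-- Extended chop of an object trace and a candidate: a marker is inserted if the local states differ. -/
def megachop (h : CHist) (F : Cand) : CHist :=
  if h.last = F.pre then ⟨h.first, h.rest ++ [(.ev F.ev, F.post)]⟩
  else ⟨h.first, h.rest ++ [(.gap, F.pre), (.ev F.ev, F.post)]⟩

def CEvent.IsSusp : CEvent → Prop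
  | .condEv _ _ _ _ => True
  | .suspEv _ _ _ _ => True
  | _ => False

/-- The active component for a continuation; the empty continuation is a terminated one. -/
def mkActive (f : ℕ) (Θ : Set STrace) : Option (ℕ × Set STrace) :=
  if Θ = ∅ then none else some (f, Θ)

/-- Steps of an object, in which the traces resolving the future `f` agree on `F` under `v`, `m`. -/
inductive OStep : ObjSt → ℕ → Val → MName → Cand → ObjSt → Prop where
  | schedule (o : ObjSt) (f v m F Θ Θ') : o.active = none → o.pool f = some Θ →
      Agrees o.hist.last.heap v m Θ F Θ' → ¬ CEvent.IsSusp F.ev →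
      o.hist.last.heap = F.pre.heap →
      OStep o f v m F
        ⟨o.cls, Function.update o.pool f none, megachop o.hist F, mkActive f Θ'⟩
  | step (o : ObjSt) (f v m F Θ Θ') : o.active = some (f, Θ) →
      Agrees o.hist.last.heap v m Θ F Θ' → ¬ CEvent.IsSusp F.ev →
      o.hist.last = F.pre →
      OStep o f v m F
        ⟨o.cls, o.pool, ⟨o.hist.first, o.hist.rest ++ [(.ev F.ev, F.post)]⟩, mkActive f Θ'⟩
  | deschedule (o : ObjSt) (f v m F Θ Θ') : o.active = some (f, Θ) →
      Agrees o.hist.last.heap v m Θ F Θ' → CEvent.IsSusp F.ev →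
      o.hist.last = F.pre →
      OStep o f v m F
        ⟨o.cls, Function.update o.pool f (some Θ'),
          ⟨o.hist.first, o.hist.rest ++ [(.ev F.ev, F.post)]⟩, none⟩

/-- The value of the field `f` of object `X`, if it is a reference. -/
def Program.refVal (P : Program) (X : ℕ) (f : Field) : Option Val := do
  let cr ← P.objs[X]?
  let c ← P.cls? cr.cls
  let k ← c.refs.findIdx? (fun r => r.2 == f)
  let a ← cr.args[k]?
  let j ← P.objOf a
  return .obj j

/-- The local state at the start of a method: parameters as given, local variables at the default value
of their type. -/
def Method.initLoc (d : Method) (args : List Val) : Var → Val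
  | .result => .unit
  | .name n =>
    match (d.params.findIdx? (fun p => p.2 == n)).bind (fun k => args[k]?) with
    | some v => v
    | none => ((d.body.decls.find? (fun p => p.1 == n)).map (fun p => p.2.default)).getD .unit

/-- The state in which a method is added: the fields that are no references are symbolic. -/
def Program.startState (P : Program) (X : ℕ) (d : Method) (args : List Val) : State SE :=
  ⟨fun v => .val (d.initLoc args v), fun f => ((P.refVal X f).map .val).getD (.fld f 0)⟩

def Program.ctx (P : Program) (X f : ℕ) (m : MName) : LCtx :=
  ⟨.val (.obj X), .val (.fut f), m, P.IsRef m.cls⟩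

/-- The semantics of method `m` for object `X`, resolved future `f` and the given parameters. -/
def Program.methSem (P : Program) (X f : ℕ) (m : MName) (args : List Val) : Set STrace :=
  {θ | ∃ d, P.meth? m = some d ∧
    ∃ θ' ∈ localSem (P.ctx X f m) d.body.flat (P.startState X d args) 1,
      θ = methTrace (P.ctx X f m) (args.map .val) θ'}

/-- A called method is added to the pool of the callee. -/
def OAdd (P : Program) (Y g : ℕ) (m : MName) (args : List Val) (o o' : ObjSt) : Prop :=
  o.cls = m.cls ∧ (∃ d, P.meth? m = some d ∧ d.params.length = args.length) ∧
  o' = ⟨o.cls, Function.update o.pool g (some (P.methSem Y g m args)), o.hist, o.active⟩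

/-- Systems: the events so far, and the objects. -/
structure Sys where
  evs : List CEvent
  objs : ℕ → Option ObjSt

/-- The future that is called or resolved in an event. -/
def CEvent.fut? : CEvent → Option Val
  | .invEv _ _ f _ _ => some f
  | .invREv _ f _ _ => some f
  | .futEv _ f _ _ => some f
  | _ => none

/-- The future `g` does not occur in the system. -/
def Sys.Fresh (S : Sys) (g : ℕ) : Prop :=
  (∀ e ∈ S.evs, CEvent.fut? e ≠ some (.fut g)) ∧
  ∀ X o, S.objs X = some o → o.pool g = none ∧ ∀ Θ, o.active ≠ some (g, Θ)

/-- Steps of a system, in which the traces of object `X` for future `f` agree on `F` under `v`, `m`. -/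
inductive SStep (P : Program) : Sys → ℕ → ℕ → Val → MName → Cand → Sys → Prop where
  | internal (S : Sys) (X f v m F o o') : S.objs X = some o → OStep o f v m F o' →
      (∀ x y g n as, F.ev ≠ .invEv x y g n as) → (∀ x g n w i, F.ev ≠ .futREv x g n w i) →
      SStep P S X f v m F ⟨S.evs ++ [F.ev], Function.update S.objs X (some o')⟩
  | get (S : Sys) (X f v m F o o' x g n w i y) : S.objs X = some o → OStep o f v m F o' →
      F.ev = .futREv x g n w i → Event.futEv y g n w ∈ S.evs →
      SStep P S X f v m F ⟨S.evs ++ [F.ev], Function.update S.objs X (some o')⟩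
  | invoc (S : Sys) (X f v m F o o' x Y g n as p p') : S.objs X = some o → OStep o f v m F o' →
      F.ev = .invEv x (.obj Y) (.fut g) n as → S.Fresh g →
      Function.update S.objs X (some o') Y = some p → OAdd P Y g n as p p' →
      SStep P S X f v m F
        ⟨S.evs ++ [F.ev], Function.update (Function.update S.objs X (some o')) Y (some p')⟩

/-- Initial heaps: references as created, other fields at the default value of their type. -/
def Program.initHeap (P : Program) (X : ℕ) (c : ClassDecl) (f : Field) : Val :=
  ((P.refVal X f).orElse fun _ =>
    (c.fields.find? (fun p => p.2.1 == f)).map (fun p => p.1.default)).getD .unit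

/-- `S` is the initial system: every object is idle, except that the initially called method is in the
pool of its object (with future `0`). -/
def Program.IsInit (P : Program) (S : Sys) : Prop :=
  ∃ (T : ℕ) (d : Method) (as : List Val), P.objOf P.target = some T ∧ P.meth? P.meth = some d ∧
    d.params.length = as.length ∧ (P.objs[T]?).map Creation.cls = some P.meth.cls ∧
    P.args.mapM (Expr.eval ⟨fun v => match v with
        | .name n => .val (((P.objOf n).map .obj).getD .unit)
        | .result => .val .unit, fun _ => .val .unit⟩) = some (as.map .val) ∧
    S.evs = [] ∧
    S.objs = fun X => (P.objs[X]?).bind fun cr => (P.cls? cr.cls).map fun c =>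
      { cls := cr.cls
        pool := fun f => if X = T ∧ f = 0 then some (P.methSem X 0 P.meth as) else none
        hist := ⟨⟨if X = T then d.initLoc as else fun _ => .unit, P.initHeap X c⟩, []⟩
        active := none }

/-- Finite runs. -/
inductive Reach (P : Program) : Sys → Sys → Prop where
  | refl (S) : Reach P S S
  | step (S X f v m F S' S'') : SStep P S X f v m F S' → Reach P S' S'' → Reach P S S''

/-- No object has inactive or active traces. -/
def Sys.Terminated (S : Sys) : Prop :=
  ∀ X o, S.objs X = some o → (∀ f, o.pool f = none) ∧ o.active = none

/-! ## Selected traces -/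

/-- There is a run from `S` to a terminated system, in which object `X` executes the trace `θ` of the
future `f` to its end, and all substitutions that are used for it are part of `χ`. -/
inductive Follows (P : Program) (X f : ℕ) (χ : Concretizer) : Sys → STrace → Prop where
  | done (S S' θ) : Reach P S S' → S'.Terminated → θ.hist.rest = [] → Follows P X f χ S θ
  | other (S X' f' v m F S' θ) : SStep P S X' f' v m F S' → (X', f') ≠ (X, f) →
      Follows P X f χ S' θ → Follows P X f χ S θ
  | own (S v m F S' o θ θ' χ') : SStep P S X f v m F S' → S.objs X = some o →
      Selects o.hist.last.heap v m θ F θ' χ' → χ'.Le χ →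
      Follows P X f χ S' θ' → Follows P X f χ S θ

/-- `χ` is a used concretizer of the trace `θ` of method `m` called with `args` on object `X` for future
`f`, in some terminating run of `P`. -/
def Used (P : Program) (X f : ℕ) (m : MName) (args : List Val) (θ : STrace)
    (χ : Concretizer) : Prop :=
  ∃ S₀ S o, P.IsInit S₀ ∧ Reach P S₀ S ∧ S.objs X = some o ∧
    o.pool f = some (P.methSem X f m args) ∧ θ ∈ P.methSem X f m args ∧
    Follows P X f χ S θ ∧ χ.Selectable θ.sc

/-- The selected traces of the statement `s` of method `m` of `P` from the state `st`: some selected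
trace of `m` reaches a point at which the remaining statements are `s; k` and the concretized state is
`st`; the part of the trace that is generated by `s` is concretized with the used concretizer. `none`
stands for a symbolic object name or future. -/
def selected (P : Program) (X f : Option ℕ) (m : MName) (s : Stmt) (st : State Val) : Set CHist :=
  {h | ∃ (X₀ f₀ : ℕ) (d : Method) (args : List Val) (k : List Stmt)
      (sc₁ sc₂ sc₃ : Set SE) (p₁ p₂ p₃ : List (Lab SEvent × State SE))
      (st₁ st₂ st₃ : State SE) (n₁ n₂ n₃ : ℕ) (χ : Concretizer),
    (X = none ∨ X = some X₀) ∧ (f = none ∨ f = some f₀) ∧ P.meth? m = some d ∧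
    LRun (P.ctx X₀ f₀ m) ⟨d.body.flat, P.startState X₀ d args, 1⟩ sc₁ p₁ ⟨s.flat ++ k, st₁, n₁⟩ ∧
    LRun (P.ctx X₀ f₀ m) ⟨s.flat, st₁, n₁⟩ sc₂ p₂ ⟨[], st₂, n₂⟩ ∧
    LRun (P.ctx X₀ f₀ m) ⟨k, st₂, n₂⟩ sc₃ p₃ ⟨[], st₃, n₃⟩ ∧
    Used P X₀ f₀ m args (methTrace (P.ctx X₀ f₀ m) (args.map .val)
      ⟨sc₁ ∪ sc₂ ∪ sc₃, ⟨P.startState X₀ d args, p₁ ++ p₂ ++ p₃⟩⟩) χ ∧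
    χ.AppHist ⟨st₁, p₂⟩ h.emb ∧ h.first = st}

/-! ## First-order state logic -/

/-- Kinds of logical entities. -/
inductive Kind where
  | val | heap | fld | pos | meth | expr | nat

abbrev Dom : Kind → Type
  | .val => Val
  | .heap => Field → Val
  | .fld => Field
  | .pos => ℤ
  | .meth => MName
  | .expr => Expr
  | .nat => ℕ

/-- Logical variables: `par j` stands for the `j`-th parameter in call conditions. -/
inductive UVar where
  | user (n : ℕ)
  | par (j : ℕ)

/-- Logical variables of the trace logic: also roles, and variables for the translations. -/
inductive MVar where
  | u (x : UVar)
  | role (r : ℕ)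
  | aux (d j : ℕ)
  | bound

/-- Variable assignments. -/
abbrev Asg (V : Type) := (k : Kind) → V → Dom k

def Asg.set {V : Type} (β : Asg V) (k : Kind) (x : V) (a : Dom k) : Asg V :=
  fun k' y => if h : k = k' then (if y = x then h ▸ a else β k' y) else β k' y

/-- The interpretation: natural on the operators of expressions (arbitrary where these are undefined),
arbitrary on `anon` and on further function and predicate symbols. -/
structure Interp where
  un : UnOp → Val → Val
  un_spec : ∀ op v w, op.eval v = some w → un op v = w
  bin : BinOp → Val → Val → Val
  bin_spec : ∀ op v v' w, op.eval v v' = some w → bin op v v' = w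
  idx : Val → Val → Val
  idx_spec : ∀ (l : List Val) (i : ℕ) v, l[i]? = some v → idx (.list l) (.num (i + 1 : ℕ)) = v
  anon : (Field → Val) → (Field → Val)
  fn : ℕ → List Val → Val
  pr : ℕ → List Val → Prop

/-- Terms of the state logic. -/
inductive FTm (V : Type) : Kind → Type where
  | lvar {k : Kind} (x : V) : FTm V k
  | pvar (v : Var) : FTm V .val
  | heap : FTm V .heap
  | field (f : Field) : FTm V .fld
  | const (v : Val) : FTm V .val
  | un (op : UnOp) (t : FTm V .val) : FTm V .val
  | bin (op : BinOp) (t t' : FTm V .val) : FTm V .val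
  | idx (t t' : FTm V .val) : FTm V .val
  | select (h : FTm V .heap) (f : FTm V .fld) : FTm V .val
  | store (h : FTm V .heap) (f : FTm V .fld) (t : FTm V .val) : FTm V .heap
  | anon (h : FTm V .heap) : FTm V .heap
  | app (g : ℕ) {n : ℕ} (ts : Fin n → FTm V .val) : FTm V .val

/-- Sorts of semantic values. -/
inductive VSort where
  | data (D : DType)
  | cls (C : ClassName)
  | obj | fut | any | nat

def VSort.Mem (P : Program) : VSort → Val → Prop
  | .data D, v => D.Mem v
  | .cls C, v => ∃ n cr, v = .obj n ∧ P.objs[n]? = some cr ∧ cr.cls = C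
  | .obj, v => ∃ n, v = .obj n ∧ n < P.objs.length
  | .fut, v => v = .no ∨ ∃ n, v = .fut n
  | .any, _ => True
  | .nat, v => ∃ n : ℕ, v = .num n

/-- Formulas of the state logic. -/
inductive FForm (V : Type) where
  | pred (p : ℕ) {n : ℕ} (ts : Fin n → FTm V .val)
  | eq {k : Kind} (t t' : FTm V k)
  | or (φ ψ : FForm V)
  | not (φ : FForm V)
  | ex (S : VSort) (x : V) (φ : FForm V)
  | exHeap (x : V) (φ : FForm V)

def FForm.tru {V : Type} : FForm V := .eq (.const .unit) (.const .unit)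

def FTm.eval {V : Type} (I : Interp) (st : State Val) (β : Asg V) : {k : Kind} → FTm V k → Dom k
  | k, .lvar x => β k x
  | _, .pvar v => st.loc v
  | _, .heap => st.heap
  | _, .field f => f
  | _, .const v => v
  | _, .un op t => I.un op (t.eval I st β)
  | _, .bin op t t' => I.bin op (t.eval I st β) (t'.eval I st β)
  | _, .idx t t' => I.idx (t.eval I st β) (t'.eval I st β)
  | _, .select h f => (h.eval I st β : Field → Val) (f.eval I st β : Field)
  | _, .store h f t => Function.update (h.eval I st β : Field → Val) (f.eval I st β : Field)
      (t.eval I st β)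
  | _, .anon h => I.anon (h.eval I st β)
  | _, .app g ts => I.fn g (List.ofFn fun i => (ts i).eval I st β)

def FForm.Sat {V : Type} (P : Program) (I : Interp) (st : State Val) : Asg V → FForm V → Prop
  | β, .pred p ts => I.pr p (List.ofFn fun i => (ts i).eval I st β)
  | β, .eq t t' => t.eval I st β = t'.eval I st β
  | β, .or φ ψ => φ.Sat P I st β ∨ ψ.Sat P I st β
  | β, .not φ => ¬ φ.Sat P I st β
  | β, .ex S x φ => ∃ a : Val, S.Mem P a ∧ φ.Sat P I st (β.set .val x a)
  | β, .exHeap x φ => ∃ a : Field → Val, φ.Sat P I st (β.set .heap x a)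

/-- Substitution: of logical variables of values by `sv`, of program variables by `sp`; other logical
variables are renamed by `r`. -/
def FTm.subst {V W : Type} (r : V → W) (sv : V → FTm W .val) (sp : Var → FTm W .val) :
    {k : Kind} → FTm V k → FTm W k
  | .val, .lvar x => sv x
  | _, .lvar x => .lvar (r x)
  | _, .pvar v => sp v
  | _, .heap => .heap
  | _, .field f => .field f
  | _, .const v => .const v
  | _, .un op t => .un op (t.subst r sv sp)
  | _, .bin op t t' => .bin op (t.subst r sv sp) (t'.subst r sv sp)
  | _, .idx t t' => .idx (t.subst r sv sp) (t'.subst r sv sp)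
  | _, .select h f => .select (h.subst r sv sp) (f.subst r sv sp)
  | _, .store h f t => .store (h.subst r sv sp) (f.subst r sv sp) (t.subst r sv sp)
  | _, .anon h => .anon (h.subst r sv sp)
  | _, .app g ts => .app g fun i => (ts i).subst r sv sp

def FForm.subst {V W : Type} (r : V → W) (sp : Var → FTm W .val) :
    (V → FTm W .val) → FForm V → FForm W
  | sv, .pred p ts => .pred p fun i => (ts i).subst r sv sp
  | sv, .eq t t' => .eq (t.subst r sv sp) (t'.subst r sv sp)
  | sv, .or φ ψ => .or (φ.subst r sp sv) (ψ.subst r sp sv)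
  | sv, .not φ => .not (φ.subst r sp sv)
  | sv, .ex S x φ => .ex S (r x) (φ.subst r sp (Function.update sv x (.lvar (r x))))
  | sv, .exHeap x φ => .exHeap (r x) (φ.subst r sp sv)

/-- A formula of the state logic inside the trace logic. -/
def FForm.lift (φ : FForm UVar) : FForm MVar := φ.subst .u .pvar (fun x => .lvar (.u x))

/-- `φ[result \ x]` inside the trace logic. -/
def FForm.liftResult (φ : FForm UVar) (x : MVar) : FForm MVar :=
  φ.subst .u (fun v => match v with
    | .result => .lvar x
    | v => .pvar v) (fun x => .lvar (.u x))

/-- `φ[result \ x]`. -/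
def FForm.substResult (φ : FForm UVar) (x : UVar) : FForm UVar :=
  φ.subst id (fun v => match v with
    | .result => .lvar x
    | v => .pvar v) .lvar

/-- Expressions as terms; `this.f` is `select(heap, f)`. -/
def Expr.toTm {V : Type} : Expr → FTm V .val
  | .var v => .pvar (.name v)
  | .field f => .select .heap (.field f)
  | .lit n => .const (.num n)
  | .never => .const .no
  | .nil => .const (.list [])
  | .tru => .const (.bool true)
  | .fls => .const (.bool false)
  | .un op e => .un op e.toTm
  | .bin op e e' => .bin op e.toTm e'.toTm

/-- A Boolean expression as a formula. -/
def Expr.toForm {V : Type} (e : Expr) : FForm V := .eq e.toTm (.const (.bool true))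

/-- `φ(es)`: the `j`-th parameter variable is replaced by the `j`-th expression. -/
def FForm.substPars (φ : FForm UVar) (es : List Expr) : FForm UVar :=
  φ.subst id .pvar fun x => match x with
    | .par j => ((es[j]?).map Expr.toTm).getD (.lvar (.par j))
    | x => .lvar x

/-- The logical variable `x` occurs (free or bound). -/
def FTm.Occ {V : Type} (x : V) : {k : Kind} → FTm V k → Prop
  | _, .lvar y => y = x
  | _, .pvar _ => False
  | _, .heap => False
  | _, .field _ => False
  | _, .const _ => False
  | _, .un _ t => t.Occ x
  | _, .bin _ t t' => t.Occ x ∨ t'.Occ x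
  | _, .idx t t' => t.Occ x ∨ t'.Occ x
  | _, .select h f => h.Occ x ∨ f.Occ x
  | _, .store h f t => h.Occ x ∨ f.Occ x ∨ t.Occ x
  | _, .anon h => h.Occ x
  | _, .app _ ts => ∃ i, (ts i).Occ x

def FForm.Occ {V : Type} (x : V) : FForm V → Prop
  | .pred _ ts => ∃ i, (ts i).Occ x
  | .eq t t' => t.Occ x ∨ t'.Occ x
  | .or φ ψ => φ.Occ x ∨ ψ.Occ x
  | .not φ => φ.Occ x
  | .ex _ y φ => y = x ∨ φ.Occ x
  | .exHeap y φ => y = x ∨ φ.Occ x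

/-- The program variable `result` occurs. -/
def FTm.HasResult {V : Type} : {k : Kind} → FTm V k → Prop
  | _, .pvar v => v = .result
  | _, .un _ t => t.HasResult
  | _, .bin _ t t' => t.HasResult ∨ t'.HasResult
  | _, .idx t t' => t.HasResult ∨ t'.HasResult
  | _, .select h f => h.HasResult ∨ f.HasResult
  | _, .store h f t => h.HasResult ∨ f.HasResult ∨ t.HasResult
  | _, .anon h => h.HasResult
  | _, .app _ ts => ∃ i, (ts i).HasResult
  | _, _ => False

def FForm.HasResult {V : Type} : FForm V → Prop
  | .pred _ ts => ∃ i, (ts i).HasResult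
  | .eq t t' => t.HasResult ∨ t'.HasResult
  | .or φ ψ => φ.HasResult ∨ ψ.HasResult
  | .not φ => φ.HasResult
  | .ex _ _ φ => φ.HasResult
  | .exHeap _ φ => φ.HasResult

/-! ## Monadic second-order trace logic -/

/-- Sorts of the trace logic; `pos` is the sort of the positions of the trace. -/
inductive MSort : Kind → Type where
  | val (S : VSort) : MSort .val
  | pos : MSort .pos
  | meth : MSort .meth
  | expr : MSort .expr
  | nat : MSort .nat

def MSort.Mem (P : Program) (len : ℕ) : {k : Kind} → MSort k → Dom k → Prop
  | _, .val S, v => S.Mem P v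
  | _, .pos, (i : ℤ) => 1 ≤ i ∧ i ≤ len
  | _, .meth, _ => True
  | _, .expr, _ => True
  | _, .nat, _ => True

/-- First-order terms; `shift t z` is `t + z`. -/
inductive MTm : Kind → Type where
  | var {k : Kind} (x : MVar) : MTm k
  | num (z : ℤ) : MTm .pos
  | shift (t : MTm .pos) (z : ℤ) : MTm .pos
  | meth (m : MName) : MTm .meth
  | const (v : Val) : MTm .val
  | app (g : ℕ) {n : ℕ} (ts : Fin n → MTm .val) : MTm .val

/-- Second-order terms. -/
inductive MSet (k : Kind) where
  | var (X : MVar)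
  | singleton (t : MTm k)

/-- Event terms. -/
abbrev MEvt := Event (MTm .val) (MTm .meth) (MTm .expr) (MTm .nat)

/-- Formulas of the trace logic: `isLab t evt` is `[t] ≐ evt` and `isState t φ` is `[t] ⊢ φ`. -/
inductive MForm where
  | pred (p : ℕ) {n : ℕ} (ts : Fin n → MTm .val)
  | eq {k : Kind} (t t' : MTm k)
  | le (t t' : MTm .pos)
  | isEvent (t : MTm .pos)
  | or (φ ψ : MForm)
  | not (φ : MForm)
  | sub {k : Kind} (t t' : MSet k)
  | ex {k : Kind} (S : MSort k) (x : MVar) (φ : MForm)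
  | exSet {k : Kind} (S : MSort k) (X : MVar) (φ : MForm)
  | isLab (t : MTm .pos) (l : Lab MEvt)
  | isState (t : MTm .pos) (φ : FForm MVar)

/-- Assignments of first-order and of set variables. -/
structure MAsg where
  fo : Asg MVar
  so : (k : Kind) → MVar → Set (Dom k)

def MAsg.set (β : MAsg) (k : Kind) (x : MVar) (a : Dom k) : MAsg := ⟨β.fo.set k x a, β.so⟩

def MAsg.setSet (β : MAsg) (k : Kind) (X : MVar) (A : Set (Dom k)) : MAsg :=
  ⟨β.fo, fun k' y => if h : k = k' then (if y = X then h ▸ A else β.so k' y) else β.so k' y⟩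

def MTm.eval (I : Interp) (β : Asg MVar) : {k : Kind} → MTm k → Dom k
  | k, .var x => β k x
  | _, .num z => z
  | _, .shift t z => (t.eval I β : ℤ) + z
  | _, .meth m => m
  | _, .const v => v
  | _, .app g ts => I.fn g (List.ofFn fun i => (ts i).eval I β)

def MSet.eval (I : Interp) (β : MAsg) {k : Kind} : MSet k → Set (Dom k)
  | .var X => β.so k X
  | .singleton t => {t.eval I β.fo}

def MEvt.eval (I : Interp) (β : Asg MVar) (e : MEvt) : Option CEvent :=
  e.mapM (fun t => some (t.eval I β)) (fun t => some (t.eval I β)) (fun t => some (t.eval I β))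
    (fun t => some (t.eval I β))

/-- Satisfaction of a formula of the trace logic in a concrete trace. -/
def MForm.Sat (P : Program) (I : Interp) (θ : CHist) : MAsg → MForm → Prop
  | β, .pred p ts => I.pr p (List.ofFn fun i => (ts i).eval I β.fo)
  | β, .eq t t' => t.eval I β.fo = t'.eval I β.fo
  | β, .le t t' => (t.eval I β.fo : ℤ) ≤ t'.eval I β.fo
  | β, .isEvent t => ∃ l, θ.at (t.eval I β.fo) = some (.lab l)
  | β, .or φ ψ => φ.Sat P I θ β ∨ ψ.Sat P I θ β
  | β, .not φ => ¬ φ.Sat P I θ β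
  | β, .sub t t' => t.eval I β ⊆ t'.eval I β
  | β, .ex (k := k) S x φ =>
      ∃ a : Dom k, S.Mem P θ.elems.length a ∧ φ.Sat P I θ (β.set k x a)
  | β, .exSet (k := k) S X φ =>
      ∃ A : Set (Dom k), (∀ a ∈ A, S.Mem P θ.elems.length a) ∧ φ.Sat P I θ (β.setSet k X A)
  | β, .isLab t (.ev e) => ∃ c, MEvt.eval I β.fo e = some c ∧
      θ.at (t.eval I β.fo) = some (.lab (.ev c))
  | β, .isLab t .gap => θ.at (t.eval I β.fo) = some (.lab .gap)
  | β, .isState t φ => ∃ st, θ.at (t.eval I β.fo) = some (.st st) ∧ φ.Sat P I st β.fo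

namespace MForm

def and (φ ψ : MForm) : MForm := .not (.or (.not φ) (.not ψ))
def imp (φ ψ : MForm) : MForm := .or (.not φ) ψ
def all {k : Kind} (S : MSort k) (x : MVar) (φ : MForm) : MForm := .not (.ex S x (.not φ))
def fls : MForm := .le (.num 1) (.num 0)
def tru : MForm := .le (.num 0) (.num 1)
def lt (t t' : MTm .pos) : MForm := .not (.le t' t)
def mem {k : Kind} (t : MTm k) (X : MVar) : MForm := .sub (.singleton t) (.var X)
def disj (l : List MForm) : MForm := l.foldr .or .fls
def conj (l : List MForm) : MForm := l.foldr .and .tru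
/-- Existential quantification over a list of variables of semantic values. -/
def exVals (S : VSort) (xs : List MVar) (φ : MForm) : MForm :=
  xs.foldr (fun x ψ => .ex (.val S) x ψ) φ

/-- Relativization `φ[y ∈ 𝐈 \ R(y)]` of the positions. -/
def rel (R : MVar → MForm) : MForm → MForm
  | .or φ ψ => .or (φ.rel R) (ψ.rel R)
  | .not φ => .not (φ.rel R)
  | .ex .pos x φ => .ex .pos x (.and (R x) (φ.rel R))
  | .ex S x φ => .ex S x (φ.rel R)
  | .exSet .pos X φ => .exSet .pos X
      (.and (.all .pos .bound (.imp (.mem (k := .pos) (.var .bound) X) (R .bound))) (φ.rel R))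
  | .exSet S X φ => .exSet S X (φ.rel R)
  | φ => φ

end MForm

/-- A variable occurs in a term, an event term, a formula of the trace logic. -/
def MTm.Occ (x : MVar) : {k : Kind} → MTm k → Prop
  | _, .var y => y = x
  | _, .shift t _ => t.Occ x
  | _, .app _ ts => ∃ i, (ts i).Occ x
  | _, _ => False

def MSet.Occ (x : MVar) {k : Kind} : MSet k → Prop
  | .var X => X = x
  | .singleton t => t.Occ x

def MEvt.Occ (x : MVar) : MEvt → Prop
  | .invEv a b c m es => a.Occ x ∨ b.Occ x ∨ c.Occ x ∨ m.Occ x ∨ ∃ e ∈ es, MTm.Occ x e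
  | .invREv a c m es => a.Occ x ∨ c.Occ x ∨ m.Occ x ∨ ∃ e ∈ es, MTm.Occ x e
  | .futEv a c m e => a.Occ x ∨ c.Occ x ∨ m.Occ x ∨ e.Occ x
  | .futREv a c m e i => a.Occ x ∨ c.Occ x ∨ m.Occ x ∨ e.Occ x ∨ i.Occ x
  | .condEv a c e i => a.Occ x ∨ c.Occ x ∨ e.Occ x ∨ i.Occ x
  | .condREv a c e i => a.Occ x ∨ c.Occ x ∨ e.Occ x ∨ i.Occ x
  | .suspEv a c e i => a.Occ x ∨ c.Occ x ∨ e.Occ x ∨ i.Occ x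
  | .suspREv a c e i => a.Occ x ∨ c.Occ x ∨ e.Occ x ∨ i.Occ x
  | .noEv => False

def MForm.Occ (x : MVar) : MForm → Prop
  | .pred _ ts => ∃ i, (ts i).Occ x
  | .eq t t' => t.Occ x ∨ t'.Occ x
  | .le t t' => t.Occ x ∨ t'.Occ x
  | .isEvent t => t.Occ x
  | .or φ ψ => φ.Occ x ∨ ψ.Occ x
  | .not φ => φ.Occ x
  | .sub t t' => t.Occ x ∨ t'.Occ x
  | .ex _ y φ => y = x ∨ φ.Occ x
  | .exSet _ y φ => y = x ∨ φ.Occ x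
  | .isLab t (.ev e) => t.Occ x ∨ MEvt.Occ x e
  | .isLab t .gap => t.Occ x
  | .isState t φ => t.Occ x ∨ φ.Occ x

/-! ## Behavioral specifications -/

/-- A behavioral specification: types, and their translation to the trace logic. -/
structure BSpec where
  Ty : Type
  α : Ty → MForm

/-- Postconditions; `D` is the data type of `result`. -/
def pstSpec (D : DType) : BSpec where
  Ty := FForm UVar
  α φ :=
    let l : MTm .pos := .var (.aux 0 0)
    let isLast : MForm := .all .pos (.aux 0 1) (.le (.var (.aux 0 1)) l)
    .ex .pos (.aux 0 0) (.and isLast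
      (if φ.HasResult then
        .ex (.val (.data D)) (.aux 0 2) (.exVals .any [.aux 0 3, .aux 0 4] (.ex .meth (.aux 0 5)
          (.and (.isLab (.shift l (-1))
              (.ev (.futEv (.var (.aux 0 3)) (.var (.aux 0 4)) (.var (.aux 0 5)) (.var (.aux 0 2)))))
            (.isState l (φ.liftResult (.aux 0 2))))))
      else .isState l φ.lift))

/-- Points-to: the first event reads a future that was resolved by one of the given methods. -/
def p2Spec : BSpec where
  Ty := List MName
  α M :=
    .ex (.val .obj) (.aux 0 0) (.ex (.val .fut) (.aux 0 1) (.ex .meth (.aux 0 2)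
      (.ex (.val .any) (.aux 0 3) (.ex .nat (.aux 0 4)
        (.and (.isLab (.num 2) (.ev (.futREv (.var (.aux 0 0)) (.var (.aux 0 1)) (.var (.aux 0 2))
            (.var (.aux 0 3)) (.var (.aux 0 4)))))
          (.disj (M.map fun m => .eq (k := .meth) (.var (.aux 0 2)) (.meth m))))))))

/-- Method types over the roles `Fin R`. In `call X m n φ`, the condition `φ` speaks about the `n`
arguments through the variables `par 0, …, par (n-1)`; `term φ` is `↓(φ)`; `passive ms φ L₁ L₂` is
`&(ms, φ){L₁, L₂}`; `active J L` is `⊕{L j}` for `j` in `J`. -/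
inductive MType (R : ℕ) where
  | call (X : Fin R) (m : MName) (n : ℕ) (φ : FForm UVar)
  | term (φ : FForm UVar)
  | skip
  | seq (L L' : MType R)
  | star (L : MType R)
  | active (J : List ℕ) (L : ℕ → MType R)
  | passive (ms : List MName) (φ : FForm UVar) (L₁ L₂ : MType R)

/-- `[i] ≐ noEv ∨ [i] ⊢ true`. -/
def MForm.quiet (i : MTm .pos) : MForm := .or (.isLab i (.ev .noEv)) (.isState i .tru)

/-- The translation of method types for given roles; `d` is a number such that the variables `aux d' j`
with `d' ≥ d` are fresh. -/
def MType.trans {R : ℕ} : ℕ → MType R → MForm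
  | d, .call X m n φ =>
    let i : MTm .pos := .var (.aux d 0)
    .all .pos (.aux d 0) (.imp (.and (.isEvent i) (.not (.isLab i (.ev .noEv))))
      (.exVals .any [.aux d 1, .aux d 2] (.exVals .any ((List.range n).map fun j => .u (.par j))
        (.and (.isLab i (.ev (.invEv (.var (.aux d 1)) (.var (.role X)) (.var (.aux d 2)) (.meth m)
            ((List.range n).map fun j => .var (.u (.par j))))))
          (.isState (.shift i (-1)) φ.lift)))))
  | d, .term φ =>
    let i : MTm .pos := .var (.aux d 0)
    .all .pos (.aux d 0) (.imp (.and (.isEvent i) (.not (.isLab i (.ev .noEv))))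
      (.exVals .any [.aux d 1, .aux d 2, .aux d 3] (.ex .meth (.aux d 4)
        (.and (.isLab i (.ev (.futEv (.var (.aux d 1)) (.var (.aux d 2)) (.var (.aux d 4))
            (.var (.aux d 3)))))
          (.isState (.shift i (-1)) (φ.liftResult (.aux d 3)))))))
  | d, .skip => .all .pos (.aux d 0) (.quiet (.var (.aux d 0)))
  | d, .seq L L' =>
    let i : MTm .pos := .var (.aux d 0)
    .ex .pos (.aux d 0) (.and ((L.trans (d + 1)).rel fun n => .le (.var n) i)
      ((L'.trans (d + 1)).rel fun n => .le i (.var n)))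
  | d, .star L =>
    let a : MTm .pos := .var (.aux d 1)
    let b : MTm .pos := .var (.aux d 2)
    let k : MTm .pos := .var (.aux d 3)
    let i₁ : MTm .pos := .var (.aux d 4)
    let i₂ : MTm .pos := .var (.aux d 5)
    let l : MTm .pos := .var (.aux d 6)
    .exSet .pos (.aux d 0) (.ex .pos (.aux d 1) (.ex .pos (.aux d 2) (.conj [
      .mem a (.aux d 0), .mem b (.aux d 0), .le a b,
      .all .pos (.aux d 3) (.or
        (.and (.lt k a) (.imp (.isEvent k) (.isLab k (.ev .noEv))))
        (.and (.le a k) (.le k b))),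
      .all .pos (.aux d 4) (.all .pos (.aux d 5) (.imp
        (.conj [.mem i₁ (.aux d 0), .mem i₂ (.aux d 0), .lt i₁ i₂,
          .all .pos (.aux d 6) (.imp (.mem l (.aux d 0)) (.or (.le l i₁) (.le i₂ l)))])
        ((L.trans (d + 1)).rel fun n => .and (.le i₁ (.var n)) (.le (.var n) i₂))))])))
  | d, .active J L => .disj (J.map fun j => (L j).trans d)
  | d, .passive ms φ L₁ L₂ =>
    let i : MTm .pos := .var (.aux d 0)
    let j : MTm .pos := .var (.aux d 1)
    let k : MTm .pos := .var (.aux d 2)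
    let l : MTm .pos := .var (.aux d 3)
    let test : MForm := .isState k (φ.liftResult (.aux d 6))
    .ex .pos (.aux d 0) (.ex .pos (.aux d 1) (.ex .pos (.aux d 2)
      (.exVals .any [.aux d 4, .aux d 5, .aux d 6] (.ex .meth (.aux d 7) (.ex .nat (.aux d 8) (.conj [
        .lt i j, .lt j k,
        .all .pos (.aux d 3) (.or (.eq l j) (.or (.le k l) (.and (.le l i) (.quiet l)))),
        .isLab j (.ev (.futREv (.var (.aux d 4)) (.var (.aux d 5)) (.var (.aux d 7)) (.var (.aux d 6))
          (.var (.aux d 8)))),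
        .disj (ms.map fun m => .eq (k := .meth) (.var (.aux d 7)) (.meth m)),
        .imp test ((L₁.trans (d + 1)).rel fun n => .le k (.var n)),
        .imp (.not test) ((L₂.trans (d + 1)).rel fun n => .le k (.var n))]))))))

/-- Method types; the role `r` is bound to the object that is stored in the field `role r`. -/
def metSpec {R : ℕ} (role : Fin R → Field) : BSpec where
  Ty := MType R
  α L := .exVals .obj ((List.finRange R).map fun r : Fin R => .role r.val)
    (.and (.conj ((List.finRange R).map fun r : Fin R => .isState (.num 1)
        (.eq (k := .val) (.lvar (.role r.val)) (.select .heap (.field (role r))))))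
      (L.trans 0))

/-! ## Behavioral Program Logic -/

mutual
/-- Terms with updates. -/
inductive BTm : Kind → Type where
  | lvar {k : Kind} (x : UVar) : BTm k
  | pvar (v : Var) : BTm .val
  | heap : BTm .heap
  | field (f : Field) : BTm .fld
  | const (v : Val) : BTm .val
  | un (op : UnOp) (t : BTm .val) : BTm .val
  | bin (op : BinOp) (t t' : BTm .val) : BTm .val
  | idx (t t' : BTm .val) : BTm .val
  | select (h : BTm .heap) (f : BTm .fld) : BTm .val
  | store (h : BTm .heap) (f : BTm .fld) (t : BTm .val) : BTm .heap
  | anon (h : BTm .heap) : BTm .heap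
  | app (g : ℕ) {n : ℕ} (ts : Fin n → BTm .val) : BTm .val
  | upd {k : Kind} (U : Upd) (t : BTm k) : BTm k
/-- Updates. -/
inductive Upd : Type where
  | eps
  | par (U U' : Upd)
  | app (U U' : Upd)
  | asg (v : Var) (t : BTm .val)
  | asgHeap (t : BTm .heap)
end

mutual
def BTm.eval (I : Interp) (β : Asg UVar) : {k : Kind} → BTm k → State Val → Dom k
  | k, .lvar x, _ => β k x
  | _, .pvar v, st => st.loc v
  | _, .heap, st => st.heap
  | _, .field f, _ => f
  | _, .const v, _ => v
  | _, .un op t, st => I.un op (t.eval I β st)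
  | _, .bin op t t', st => I.bin op (t.eval I β st) (t'.eval I β st)
  | _, .idx t t', st => I.idx (t.eval I β st) (t'.eval I β st)
  | _, .select h f, st => (h.eval I β st : Field → Val) (f.eval I β st : Field)
  | _, .store h f t, st => Function.update (h.eval I β st : Field → Val) (f.eval I β st : Field)
      (t.eval I β st)
  | _, .anon h, st => I.anon (h.eval I β st)
  | _, .app g ts, st => I.fn g (List.ofFn fun i => (ts i).eval I β st)
  | _, .upd U t, st => t.eval I β (U.eval I β st st)
/-- The state transformer of an update that is evaluated in the state `st`. -/
def Upd.eval (I : Interp) (β : Asg UVar) : Upd → State Val → State Val → State Val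
  | .eps, _, x => x
  | .par U U', st, x => U'.eval I β st (U.eval I β st x)
  | .app U U', st, x => U'.eval I β (U.eval I β st st) x
  | .asg v t, st, x => x.setVar v (t.eval I β st)
  | .asgHeap t, st, x => ⟨x.loc, t.eval I β st⟩
end

mutual
def BTm.Occ (x : UVar) : {k : Kind} → BTm k → Prop
  | _, .lvar y => y = x
  | _, .pvar _ => False
  | _, .heap => False
  | _, .field _ => False
  | _, .const _ => False
  | _, .un _ t => t.Occ x
  | _, .bin _ t t' => t.Occ x ∨ t'.Occ x
  | _, .idx t t' => t.Occ x ∨ t'.Occ x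
  | _, .select h f => h.Occ x ∨ f.Occ x
  | _, .store h f t => h.Occ x ∨ f.Occ x ∨ t.Occ x
  | _, .anon h => h.Occ x
  | _, .app _ ts => ∃ i, (ts i).Occ x
  | _, .upd U t => U.Occ x ∨ t.Occ x
def Upd.Occ (x : UVar) : Upd → Prop
  | .eps => False
  | .par U U' => U.Occ x ∨ U'.Occ x
  | .app U U' => U.Occ x ∨ U'.Occ x
  | .asg _ t => t.Occ x
  | .asgHeap t => t.Occ x
end

/-- Formulas; `mod s T τ` is the behavioral modality `[s ⊩ τ]` for the behavioral specification `T`. -/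
inductive BForm : Type 1 where
  | pred (p : ℕ) {n : ℕ} (ts : Fin n → BTm .val)
  | eq {k : Kind} (t t' : BTm k)
  | or (φ ψ : BForm)
  | not (φ : BForm)
  | ex (S : VSort) (x : UVar) (φ : BForm)
  | exHeap (x : UVar) (φ : BForm)
  | mod (s : Stmt) (T : BSpec) (τ : T.Ty)
  | upd (U : Upd) (φ : BForm)

def BForm.imp (φ ψ : BForm) : BForm := .or (.not φ) ψ

def BForm.Occ (x : UVar) : BForm → Prop
  | .pred _ ts => ∃ i, (ts i).Occ x
  | .eq t t' => t.Occ x ∨ t'.Occ x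
  | .or φ ψ => φ.Occ x ∨ ψ.Occ x
  | .not φ => φ.Occ x
  | .ex _ y φ => y = x ∨ φ.Occ x
  | .exHeap y φ => y = x ∨ φ.Occ x
  | .mod _ T τ => (T.α τ).Occ (.u x)
  | .upd U φ => U.Occ x ∨ φ.Occ x

/-- The terms and formulas of the state logic, as terms and formulas of the program logic. -/
def FTm.toB : {k : Kind} → FTm UVar k → BTm k
  | _, .lvar x => .lvar x
  | _, .pvar v => .pvar v
  | _, .heap => .heap
  | _, .field f => .field f
  | _, .const v => .const v
  | _, .un op t => .un op t.toB
  | _, .bin op t t' => .bin op t.toB t'.toB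
  | _, .idx t t' => .idx t.toB t'.toB
  | _, .select h f => .select h.toB f.toB
  | _, .store h f t => .store h.toB f.toB t.toB
  | _, .anon h => .anon h.toB
  | _, .app g ts => .app g fun i => (ts i).toB

def FForm.toB : FForm UVar → BForm
  | .pred p ts => .pred p fun i => (ts i).toB
  | .eq t t' => .eq t.toB t'.toB
  | .or φ ψ => .or φ.toB ψ.toB
  | .not φ => .not φ.toB
  | .ex S x φ => .ex S x φ.toB
  | .exHeap x φ => .exHeap x φ.toB

/-- The fixed parameters of the evaluation: program, interpretation, object name and resolved future
(`none` if symbolic), method name. -/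
structure Env where
  prog : Program
  int : Interp
  obj : Option ℕ
  fut : Option ℕ
  meth : MName

/-- The data type of `result`. -/
def Env.retType (E : Env) : DType := ((E.prog.meth? E.meth).map Method.ret).getD .unit

/-- An assignment for the state logic as one for the trace logic (closed in the other variables). -/
def Asg.toM (β : Asg UVar) : MAsg where
  fo k x := match x with
    | .u y => β k y
    | _ => match k with
      | .val => Val.unit
      | .heap => fun _ => Val.unit
      | .fld => (0 : ℕ)
      | .pos => (0 : ℤ)
      | .meth => ⟨0, 0⟩
      | .expr => Expr.never
      | .nat => (0 : ℕ)
  so _ _ := ∅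

def BForm.Sat (E : Env) : State Val → Asg UVar → BForm → Prop
  | st, β, .pred p ts => E.int.pr p (List.ofFn fun i => (ts i).eval E.int β st)
  | st, β, .eq t t' => t.eval E.int β st = t'.eval E.int β st
  | st, β, .or φ ψ => φ.Sat E st β ∨ ψ.Sat E st β
  | st, β, .not φ => ¬ φ.Sat E st β
  | st, β, .ex S x φ => ∃ a : Val, S.Mem E.prog a ∧ φ.Sat E st (β.set .val x a)
  | st, β, .exHeap x φ => ∃ a : Field → Val, φ.Sat E st (β.set .heap x a)
  | st, β, .mod s T τ => ∀ θ ∈ selected E.prog E.obj E.fut E.meth s st,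
      (T.α τ).Sat E.prog E.int θ β.toM
  | st, β, .upd U φ => φ.Sat E (U.eval E.int β st st) β

/-- Sequents `Γ ⇒ Δ`. -/
structure Sequent : Type 1 where
  ant : Set BForm
  suc : Set BForm

/-- Every state and every assignment make `⋀ Γ → ⋁ Δ` true. -/
def Sequent.Valid (E : Env) (q : Sequent) : Prop :=
  ∀ st β, (∀ φ ∈ q.ant, φ.Sat E st β) → ∃ φ ∈ q.suc, φ.Sat E st β

/-! ## The calculus for method types -/

/-- Local protocols `?m(pre).ty`, with the assignment of roles to fields. -/
structure Protocol where
  R : ℕ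
  role : Fin R → Field
  pre : FForm UVar
  ty : MType R

/-- `[s ⊩ L]` for the method type `L`. -/
abbrev met {R : ℕ} (role : Fin R → Field) (s : Stmt) (L : MType R) : BForm := .mod s (metSpec role) L

/-- The update `v := e`. -/
abbrev Upd.asgE (v : Var) (e : Expr) : Upd := .asg v (FTm.toB e.toTm)

/-- The sequent calculus rules: premises and conclusion. -/
inductive MetRule (E : Env) {R : ℕ} (role : Fin R → Field) : List Sequent → Sequent → Prop where
  | metV (Γ Δ : Set BForm) (U : Upd) (d : Option DType) (v : ℕ) (e : Expr) (s : Stmt) (L : MType R) :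
      MetRule E role
        [⟨Γ, insert (.upd U (.upd (.asgE (.name v) e) (met role s L))) Δ⟩]
        ⟨Γ, insert (.upd U (met role (.seq (.asg d (.var v) e) s) L)) Δ⟩
  | metF (Γ Δ : Set BForm) (U : Upd) (d : Option DType) (f : Field) (e : Expr) (s : Stmt)
      (L : MType R) :
      MetRule E role
        [⟨Γ, insert (.upd U (.upd (.asgHeap (.store .heap (.field f) (FTm.toB e.toTm)))
          (met role s L))) Δ⟩]
        ⟨Γ, insert (.upd U (met role (.seq (.asg d (.field f) e) s) L)) Δ⟩
  | metGet (Γ Δ : Set BForm) (U : Upd) (d : Option DType) (v : ℕ) (e : Expr) (i : ℕ) (s : Stmt)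
      (ms : List MName) (φ : FForm UVar) (L₁ L₂ : MType R) (x : UVar) :
      (∀ ψ ∈ Γ, ¬ ψ.Occ x) → (∀ ψ ∈ Δ, ¬ ψ.Occ x) → ¬ U.Occ x → ¬ φ.Occ x →
      ¬ ((metSpec role).α L₁).Occ (.u x) → ¬ ((metSpec role).α L₂).Occ (.u x) →
      MetRule E role
        [⟨Γ, insert (.upd U (.upd (.asg (.name v) (.lvar x))
            (.imp (φ.substResult x).toB (met role s L₁)))) Δ⟩,
          ⟨Γ, insert (.upd U (.upd (.asg (.name v) (.lvar x))
            (.imp (.not (φ.substResult x).toB) (met role s L₂)))) Δ⟩,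
          ⟨∅, {.mod (.seq (.get d v e i) s) p2Spec ms}⟩]
        ⟨Γ, insert (.upd U (met role (.seq (.get d v e i) s) (.passive ms φ L₁ L₂))) Δ⟩
  | metWhile (Γ Δ : Set BForm) (U : Upd) (e : Expr) (s s' : Stmt) (J : FForm UVar)
      (L L' : MType R) :
      MetRule E role
        [⟨Γ, insert (.upd U J.toB) Δ⟩,
          ⟨{J.toB, e.toForm.toB}, {.mod s (pstSpec E.retType) J}⟩,
          ⟨{J.toB, e.toForm.toB}, {met role s L}⟩,
          ⟨{J.toB, .not e.toForm.toB}, {met role s' L'}⟩]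
        ⟨Γ, insert (.upd U (met role (.seq (.whl e s) s') (.seq (.star L) L'))) Δ⟩
  | metIf (Γ Δ : Set BForm) (U : Upd) (e : Expr) (s s' s'' : Stmt) (J J₁ J₂ : List ℕ)
      (L : ℕ → MType R) :
      J₁ ≠ [] → J₂ ≠ [] → J₁ ∪ J₂ ⊆ J →
      MetRule E role
        [⟨Γ, insert (.upd U (.imp e.toForm.toB (met role (.seq s s'') (.active J₁ L)))) Δ⟩,
          ⟨Γ, insert (.upd U (.imp (.not e.toForm.toB)
            (met role (.seq s' s'') (.active J₂ L)))) Δ⟩]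
        ⟨Γ, insert (.upd U (met role (.seq (.ite e s s') s'') (.active J L))) Δ⟩
  | metCall (Γ Δ : Set BForm) (U : Upd) (d : Option DType) (v : ℕ) (O : Fin R) (m : MName)
      (es : List Expr) (s : Stmt) (φ : FForm UVar) (L : MType R) (x : UVar) :
      (∀ ψ ∈ Γ, ¬ ψ.Occ x) → (∀ ψ ∈ Δ, ¬ ψ.Occ x) → ¬ U.Occ x → ¬ φ.Occ x →
      ¬ ((metSpec role).α L).Occ (.u x) →
      MetRule E role
        [⟨Γ, insert (.upd U (φ.substPars es).toB) Δ⟩,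
          ⟨Γ, insert (.upd U (.upd (.asg (.name v) (.lvar x)) (met role s L))) Δ⟩]
        ⟨Γ, insert (.upd U (met role (.seq (.call d v (role O) m es) s)
          (.seq (.call O m es.length φ) L))) Δ⟩
  | metReturn (Γ Δ : Set BForm) (U : Upd) (e : Expr) (φ : FForm UVar) :
      MetRule E role
        [⟨Γ, insert (.upd U (.upd (.asgE .result e) φ.toB)) Δ⟩]
        ⟨Γ, insert (.upd U (met role (.ret e) (.term φ))) Δ⟩
  | metSkip (Γ Δ : Set BForm) (U : Upd) :
      MetRule E role [] ⟨Γ, insert (.upd U (met role .skip .skip)) Δ⟩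

/-- The rewrite rules for types (each read in both directions). -/
inductive MetRewrite {R : ℕ} : MType R → MType R → Prop where
  | active (L : MType R) (j : ℕ) (L' : ℕ → MType R) : L' j = L → MetRewrite L (.active [j] L')
  | skipSeq (L : MType R) : MetRewrite (.seq .skip L) L
  | seqSkip (L : MType R) : MetRewrite (.seq L .skip) L

/-- Equivalence of formulas of the trace logic. -/
def MForm.Equiv (P : Program) (I : Interp) (φ ψ : MForm) : Prop :=
  ∀ θ β, φ.Sat P I θ β ↔ ψ.Sat P I θ β

/-- The rules and the rewrite rules for the method types of the method of `E` are sound. -/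
def MetSound (E : Env) {R : ℕ} (role : Fin R → Field) : Prop :=
  (∀ prems concl, MetRule E role prems concl → (∀ q ∈ prems, q.Valid E) → concl.Valid E) ∧
  ∀ L L' : MType R, MetRewrite L L' →
    ((metSpec role).α L).Equiv E.prog E.int ((metSpec role).α L')

/-- The call action `X!m(φ)` occurs in a type. -/
def MType.Calls {R : ℕ} (m : MName) (φ : FForm UVar) : MType R → Prop
  | .call _ m' _ φ' => m' = m ∧ φ' = φ
  | .seq L L' => L.Calls m φ ∨ L'.Calls m φ
  | .star L => L.Calls m φ
  | .active J L => ∃ j ∈ J, (L j).Calls m φ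
  | .passive _ _ L₁ L₂ => L₁.Calls m φ ∨ L₂.Calls m φ
  | _ => False

/-- Obligation schemes for method types: a local protocol for every method. -/
abbrev Scheme := MName → Protocol

/-- The proof obligation `pre ⇒ [body ⊩ ty]` of a method. -/
def Scheme.obligation (ι : Scheme) (m : MName) (d : Method) : Sequent :=
  ⟨{(ι m).pre.toB}, {met (ι m).role d.body (ι m).ty}⟩

/-- The roles of every method are bound to references of its class. -/
def Scheme.RolesFit (P : Program) (ι : Scheme) : Prop :=
  ∀ m d, P.meth? m = some d → ∀ r, P.IsRef m.cls ((ι m).role r)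

/-- Consistency: if `m` is called in the type of another method, then the call condition on the
arguments implies the precondition of `m` on its parameters; preconditions of `run` are trivial. -/
def Scheme.Consistent (P : Program) (I : Interp) (ι : Scheme) : Prop :=
  (∀ m d m' d' φ, P.meth? m = some d → P.meth? m' = some d' → m' ≠ m → (ι m').ty.Calls m φ →
    ∀ (β : Asg UVar) (st st' : State Val), φ.Sat P I st β →
      (∀ (j : ℕ) (p : DType × ℕ), d.params[j]? = some p → st'.loc (.name p.2) = β .val (.par j)) →
      (ι m).pre.Sat P I st' β) ∧
  ∀ m d, P.meth? m = some d → m.name = runName → (ι m).pre = .tru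

end CAO

end

/-!
The rules are proved on the level of traces. Three facts carry the proof.

*Meaning of types.* The translation of a method type relativizes position quantifiers, so that a
subtype is evaluated in an interval of positions. `MType.Holds` is this meaning, defined directly
on intervals, and `MType.satW_trans` and `sat_metSpec` identify it with the satisfaction of the
translation. Since the translation uses fresh variables at every nesting depth, relativization
never captures a variable (`MForm.satW_rel`). The meaning in an interval depends only on the
elements of the interval (`MType.Holds.shift`), and it is not affected by invisible positions that
are added in front, or at the end if the last position is invisible (`MType.Holds.extend_left`,
`MType.Holds.extend_right`). As states are invisible, this already gives the rewrite rules
(`MetRewrite.equiv`).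

*Selected traces.* A selected trace of `s` is a concretized part of one execution, here a segment
(`Exec.Seg`). The first statement of a segment can be split off (`Exec.Seg.step`), what remains is
a segment again, and its first state is determined by the semantics of expressions
(`Expr.eval_app`). The types bind their roles in the first state of the trace they are evaluated
in, so the roles of a composed statement and of its continuation have to agree: references are
never reassigned (`LRun.ref_const`), and at runtime they hold objects of the program. The latter
follows from an invariant of reachable systems, `ObjInv`: objects execute methods of their own
class.

*Rules.* An assignment, a call, a read or a return puts its event at position `2`, and the type of
the continuation holds from position `3` on. For the loop rule, a segment of the loop decomposes
into finitely many segments of the body and one of the continuation (`LRun.loop`). The invariant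
holds at the start of each of them: the body contains no `return`, so that its postcondition is a
condition on the last state (`sat_pstSpec`). The borders of the iterations form the set of
positions that the type `L*` demands.
-/

namespace CAO

open Classical

/-! ### Assignments and variables that do not occur -/

@[simp] theorem Asg.set_self {V : Type} (β : Asg V) (k : Kind) (x : V) (a : Dom k) :
    β.set k x a k x = a := by simp [Asg.set]

theorem Asg.set_ne {V : Type} (β : Asg V) (k : Kind) (x : V) (a : Dom k) (k' : Kind) (y : V)
    (h : y ≠ x) : β.set k x a k' y = β k' y := by
  by_cases hk : k = k' <;> simp [Asg.set, h]

theorem Asg.set_same_kind {V : Type} (β : Asg V) (k : Kind) (x : V) (a : Dom k) (y : V) :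
    β.set k x a k y = if y = x then a else β k y := by simp [Asg.set]

theorem Asg.set_ne_kind {V : Type} (β : Asg V) (k : Kind) (x : V) (a : Dom k) (k' : Kind) (y : V)
    (h : k ≠ k') : β.set k x a k' y = β k' y := by simp [Asg.set, h]

/-- Two assignments agree on all variables except possibly `x`. -/
def Asg.EqOff {V : Type} (x : V) (β β' : Asg V) : Prop := ∀ k y, y ≠ x → β k y = β' k y

theorem Asg.EqOff.set {V : Type} {x : V} {β β' : Asg V} (h : Asg.EqOff x β β') (k : Kind) (y : V)
    (a : Dom k) : Asg.EqOff x (β.set k y a) (β'.set k y a) := by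
  intro k' z hz
  by_cases hk : k = k'
  · subst hk
    simp [Asg.set_same_kind, h k z hz]
  · simp [Asg.set_ne_kind _ _ _ _ _ _ hk, h k' z hz]

theorem Asg.eqOff_set {V : Type} (x : V) (β : Asg V) (k : Kind) (a : Dom k) :
    Asg.EqOff x (β.set k x a) β := fun _ _ hy => Asg.set_ne _ _ _ _ _ _ hy

theorem FTm.eval_congr {V : Type} {x : V} (I : Interp) (st : State Val) {β β' : Asg V}
    (h : Asg.EqOff x β β') : ∀ {k : Kind} (t : FTm V k), ¬ t.Occ x →
      t.eval I st β = t.eval I st β'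
  | _, .lvar y, hx => h _ y hx
  | _, .pvar _, _ => rfl
  | _, .heap, _ => rfl
  | _, .field _, _ => rfl
  | _, .const _, _ => rfl
  | _, .un _ t, hx => by
    simp only [FTm.Occ] at hx
    simp only [FTm.eval, eval_congr I st h t hx]
  | _, .bin _ t t', hx => by
    simp only [FTm.Occ, not_or] at hx
    simp only [FTm.eval, eval_congr I st h t hx.1, eval_congr I st h t' hx.2]
  | _, .idx t t', hx => by
    simp only [FTm.Occ, not_or] at hx
    simp only [FTm.eval, eval_congr I st h t hx.1, eval_congr I st h t' hx.2]
  | _, .select t t', hx => by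
    simp only [FTm.Occ, not_or] at hx
    simp only [FTm.eval, eval_congr I st h t hx.1, eval_congr I st h t' hx.2]
  | _, .store t t' t'', hx => by
    simp only [FTm.Occ, not_or] at hx
    simp only [FTm.eval, eval_congr I st h t hx.1, eval_congr I st h t' hx.2.1,
      eval_congr I st h t'' hx.2.2]
  | _, .anon t, hx => by
    simp only [FTm.Occ] at hx
    simp only [FTm.eval, eval_congr I st h t hx]
  | _, .app g ts, hx => by
    simp only [FTm.Occ, not_exists] at hx
    simp only [FTm.eval, fun i => eval_congr I st h (ts i) (hx i)]

theorem FForm.sat_congr {V : Type} {x : V} (P : Program) (I : Interp) (st : State Val) :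
    ∀ (φ : FForm V) {β β' : Asg V}, Asg.EqOff x β β' → ¬ φ.Occ x →
      (φ.Sat P I st β ↔ φ.Sat P I st β')
  | .pred p ts, β, β', h, hx => by
    simp only [FForm.Occ, not_exists] at hx
    simp only [FForm.Sat, fun i => FTm.eval_congr I st h (ts i) (hx i)]
  | .eq t t', β, β', h, hx => by
    simp only [FForm.Occ, not_or] at hx
    simp only [FForm.Sat, FTm.eval_congr I st h t hx.1, FTm.eval_congr I st h t' hx.2]
  | .or φ ψ, β, β', h, hx => by
    simp only [FForm.Occ, not_or] at hx
    simp only [FForm.Sat, sat_congr P I st φ h hx.1, sat_congr P I st ψ h hx.2]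
  | .not φ, β, β', h, hx => by
    simp only [FForm.Occ] at hx
    simp only [FForm.Sat, sat_congr P I st φ h hx]
  | .ex S y φ, β, β', h, hx => by
    simp only [FForm.Occ, not_or] at hx
    simp only [FForm.Sat, fun a => sat_congr P I st φ (h.set .val y a) hx.2]
  | .exHeap y φ, β, β', h, hx => by
    simp only [FForm.Occ, not_or] at hx
    simp only [FForm.Sat, fun a => sat_congr P I st φ (h.set .heap y a) hx.2]

theorem MTm.eval_congr {x : MVar} (I : Interp) {β β' : Asg MVar} (h : Asg.EqOff x β β') :
    ∀ {k : Kind} (t : MTm k), ¬ t.Occ x → t.eval I β = t.eval I β'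
  | _, .var y, hx => h _ y hx
  | _, .num _, _ => rfl
  | _, .shift t _, hx => by
    simp only [MTm.Occ] at hx
    simp only [MTm.eval, eval_congr I h t hx]
  | _, .meth _, _ => rfl
  | _, .const _, _ => rfl
  | _, .app g ts, hx => by
    simp only [MTm.Occ, not_exists] at hx
    simp only [MTm.eval, fun i => eval_congr I h (ts i) (hx i)]

theorem mapM_congr_option {α γ : Type} {f g : α → Option γ} :
    ∀ {l : List α}, (∀ a ∈ l, f a = g a) → l.mapM f = l.mapM g
  | [], _ => rfl
  | a :: l, h => by
    simp only [List.mapM_cons, h a (by simp),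
      mapM_congr_option (l := l) fun b hb => h b (by simp [hb])]

theorem MEvt.eval_congr {x : MVar} (I : Interp) {β β' : Asg MVar} (h : Asg.EqOff x β β')
    (e : MEvt) (hx : ¬ MEvt.Occ x e) : MEvt.eval I β e = MEvt.eval I β' e := by
  cases e <;> simp only [MEvt.Occ, not_or, not_exists, not_and] at hx <;>
    simp only [MEvt.eval, Event.mapM]
  case invEv a b c m es =>
    simp only [MTm.eval_congr I h _ hx.1, MTm.eval_congr I h _ hx.2.1,
      MTm.eval_congr I h _ hx.2.2.1, MTm.eval_congr I h _ hx.2.2.2.1]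
    rw [mapM_congr_option fun t ht =>
      congrArg some (MTm.eval_congr I h t (hx.2.2.2.2 t ht))]
  case invREv a c m es =>
    simp only [MTm.eval_congr I h _ hx.1, MTm.eval_congr I h _ hx.2.1,
      MTm.eval_congr I h _ hx.2.2.1]
    rw [mapM_congr_option fun t ht =>
      congrArg some (MTm.eval_congr I h t (hx.2.2.2 t ht))]
  case futREv =>
    simp only [MTm.eval_congr I h _ hx.1, MTm.eval_congr I h _ hx.2.1,
      MTm.eval_congr I h _ hx.2.2.1, MTm.eval_congr I h _ hx.2.2.2.1,
      MTm.eval_congr I h _ hx.2.2.2.2]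
  all_goals
    simp only [MTm.eval_congr I h _ hx.1, MTm.eval_congr I h _ hx.2.1,
      MTm.eval_congr I h _ hx.2.2.1, MTm.eval_congr I h _ hx.2.2.2]

theorem MForm.sat_congr {x : MVar} (P : Program) (I : Interp) (θ : CHist) :
    ∀ (φ : MForm) {β β' : MAsg}, Asg.EqOff x β.fo β'.fo → β.so = β'.so → ¬ φ.Occ x →
      (φ.Sat P I θ β ↔ φ.Sat P I θ β')
  | .pred p ts, β, β', h, _, hx => by
    simp only [MForm.Occ, not_exists] at hx
    simp only [MForm.Sat, fun i => MTm.eval_congr I h (ts i) (hx i)]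
  | .eq t t', β, β', h, _, hx => by
    simp only [MForm.Occ, not_or] at hx
    simp only [MForm.Sat, MTm.eval_congr I h t hx.1, MTm.eval_congr I h t' hx.2]
  | .le t t', β, β', h, _, hx => by
    simp only [MForm.Occ, not_or] at hx
    simp only [MForm.Sat, MTm.eval_congr I h t hx.1, MTm.eval_congr I h t' hx.2]
  | .isEvent t, β, β', h, _, hx => by
    simp only [MForm.Occ] at hx
    simp only [MForm.Sat, MTm.eval_congr I h t hx]
  | .or φ ψ, β, β', h, hs, hx => by
    simp only [MForm.Occ, not_or] at hx
    simp only [MForm.Sat, sat_congr P I θ φ h hs hx.1, sat_congr P I θ ψ h hs hx.2]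
  | .not φ, β, β', h, hs, hx => by
    simp only [MForm.Occ] at hx
    simp only [MForm.Sat, sat_congr P I θ φ h hs hx]
  | .sub t t', β, β', h, hs, hx => by
    simp only [MForm.Occ, not_or] at hx
    have key : ∀ {k} (t : MSet k), ¬ t.Occ x → t.eval I β = t.eval I β' := by
      intro k t ht
      cases t with
      | var X => simp only [MSet.eval, hs]
      | singleton t => simp only [MSet.eval, MTm.eval_congr I h t ht]
    simp only [MForm.Sat, key t hx.1, key t' hx.2]
  | .ex (k := k) S y φ, β, β', h, hs, hx => by
    simp only [MForm.Occ, not_or] at hx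
    simp only [MForm.Sat]
    exact exists_congr fun a => and_congr_right fun _ =>
      sat_congr P I θ φ (β := β.set k y a) (β' := β'.set k y a) (h.set k y a) hs hx.2
  | .exSet (k := k) S y φ, β, β', h, hs, hx => by
    simp only [MForm.Occ, not_or] at hx
    simp only [MForm.Sat]
    exact exists_congr fun a => and_congr_right fun _ =>
      sat_congr P I θ φ (β := β.setSet k y a) (β' := β'.setSet k y a) h
        (by simp only [MAsg.setSet, hs]) hx.2
  | .isLab t (.ev e), β, β', h, _, hx => by
    simp only [MForm.Occ, not_or] at hx
    simp only [MForm.Sat, MTm.eval_congr I h t hx.1, MEvt.eval_congr I h e hx.2]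
  | .isLab t .gap, β, β', h, _, hx => by
    simp only [MForm.Occ] at hx
    simp only [MForm.Sat, MTm.eval_congr I h t hx]
  | .isState t φ, β, β', h, _, hx => by
    simp only [MForm.Occ, not_or] at hx
    simp only [MForm.Sat, MTm.eval_congr I h t hx.1, fun st => FForm.sat_congr P I st φ h hx.2]

mutual
theorem BTm.eval_congr {x : UVar} (I : Interp) {β β' : Asg UVar} (h : Asg.EqOff x β β') :
    ∀ {k : Kind} (t : BTm k) (st : State Val), ¬ t.Occ x → t.eval I β st = t.eval I β' st
  | _, .lvar y, _, hx => h _ y (by simpa only [BTm.Occ] using hx)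
  | _, .pvar _, _, _ => rfl
  | _, .heap, _, _ => rfl
  | _, .field _, _, _ => rfl
  | _, .const _, _, _ => rfl
  | _, .un _ t, st, hx => by
    simp only [BTm.Occ] at hx
    simp only [BTm.eval, BTm.eval_congr I h t st hx]
  | _, .bin _ t t', st, hx => by
    simp only [BTm.Occ, not_or] at hx
    simp only [BTm.eval, BTm.eval_congr I h t st hx.1, BTm.eval_congr I h t' st hx.2]
  | _, .idx t t', st, hx => by
    simp only [BTm.Occ, not_or] at hx
    simp only [BTm.eval, BTm.eval_congr I h t st hx.1, BTm.eval_congr I h t' st hx.2]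
  | _, .select t t', st, hx => by
    simp only [BTm.Occ, not_or] at hx
    simp only [BTm.eval, BTm.eval_congr I h t st hx.1, BTm.eval_congr I h t' st hx.2]
  | _, .store t t' t'', st, hx => by
    simp only [BTm.Occ, not_or] at hx
    simp only [BTm.eval, BTm.eval_congr I h t st hx.1, BTm.eval_congr I h t' st hx.2.1,
      BTm.eval_congr I h t'' st hx.2.2]
  | _, .anon t, st, hx => by
    simp only [BTm.Occ] at hx
    simp only [BTm.eval, BTm.eval_congr I h t st hx]
  | _, .app g ts, st, hx => by
    simp only [BTm.Occ, not_exists] at hx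
    simp only [BTm.eval, fun i => BTm.eval_congr I h (ts i) st (hx i)]
  | _, .upd U t, st, hx => by
    simp only [BTm.Occ, not_or] at hx
    simp only [BTm.eval, Upd.eval_congr I h U st st hx.1, fun st => BTm.eval_congr I h t st hx.2]
theorem Upd.eval_congr {x : UVar} (I : Interp) {β β' : Asg UVar} (h : Asg.EqOff x β β') :
    ∀ (U : Upd) (st y : State Val), ¬ U.Occ x → U.eval I β st y = U.eval I β' st y
  | .eps, _, _, _ => rfl
  | .par U U', st, y, hx => by
    simp only [Upd.Occ, not_or] at hx
    simp only [Upd.eval, Upd.eval_congr I h U st y hx.1, Upd.eval_congr I h U' st _ hx.2]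
  | .app U U', st, y, hx => by
    simp only [Upd.Occ, not_or] at hx
    simp only [Upd.eval, Upd.eval_congr I h U st st hx.1, Upd.eval_congr I h U' _ y hx.2]
  | .asg v t, st, y, hx => by
    simp only [Upd.Occ] at hx
    simp only [Upd.eval, BTm.eval_congr I h t st hx]
  | .asgHeap t, st, y, hx => by
    simp only [Upd.Occ] at hx
    simp only [Upd.eval, BTm.eval_congr I h t st hx]
end

theorem Asg.EqOff.toM {x : UVar} {β β' : Asg UVar} (h : Asg.EqOff x β β') :
    Asg.EqOff (.u x) β.toM.fo β'.toM.fo := by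
  intro k y hy
  cases y with
  | u y => exact h k y (by simpa using hy)
  | _ => rfl

theorem BForm.sat_congr {x : UVar} (E : Env) :
    ∀ (φ : BForm) (st : State Val) {β β' : Asg UVar}, Asg.EqOff x β β' → ¬ φ.Occ x →
      (φ.Sat E st β ↔ φ.Sat E st β')
  | .pred p ts, st, β, β', h, hx => by
    simp only [BForm.Occ, not_exists] at hx
    simp only [BForm.Sat, fun i => BTm.eval_congr E.int h (ts i) st (hx i)]
  | .eq t t', st, β, β', h, hx => by
    simp only [BForm.Occ, not_or] at hx
    simp only [BForm.Sat, BTm.eval_congr E.int h t st hx.1, BTm.eval_congr E.int h t' st hx.2]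
  | .or φ ψ, st, β, β', h, hx => by
    simp only [BForm.Occ, not_or] at hx
    simp only [BForm.Sat, sat_congr E φ st h hx.1, sat_congr E ψ st h hx.2]
  | .not φ, st, β, β', h, hx => by
    simp only [BForm.Occ] at hx
    simp only [BForm.Sat, sat_congr E φ st h hx]
  | .ex S y φ, st, β, β', h, hx => by
    simp only [BForm.Occ, not_or] at hx
    simp only [BForm.Sat, fun a => sat_congr E φ st (h.set .val y a) hx.2]
  | .exHeap y φ, st, β, β', h, hx => by
    simp only [BForm.Occ, not_or] at hx
    simp only [BForm.Sat, fun a => sat_congr E φ st (h.set .heap y a) hx.2]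
  | .mod s T τ, st, β, β', h, hx => by
    simp only [BForm.Occ] at hx
    simp only [BForm.Sat]
    exact forall₂_congr fun θ _ => MForm.sat_congr E.prog E.int θ (T.α τ) h.toM rfl hx
  | .upd U φ, st, β, β', h, hx => by
    simp only [BForm.Occ, not_or] at hx
    simp only [BForm.Sat, Upd.eval_congr E.int h U st st hx.1, fun st => sat_congr E φ st h hx.2]

/-! ### Substitution and embedding of state formulas -/

theorem FTm.eval_toB (I : Interp) (β : Asg UVar) (st : State Val) :
    ∀ {k : Kind} (t : FTm UVar k), t.toB.eval I β st = t.eval I st β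
  | _, .lvar _ => rfl
  | _, .pvar _ => rfl
  | _, .heap => rfl
  | _, .field _ => rfl
  | _, .const _ => rfl
  | _, .un _ t => by simp only [FTm.toB, BTm.eval, FTm.eval, eval_toB I β st t]
  | _, .bin _ t t' => by
    simp only [FTm.toB, BTm.eval, FTm.eval, eval_toB I β st t, eval_toB I β st t']
  | _, .idx t t' => by
    simp only [FTm.toB, BTm.eval, FTm.eval, eval_toB I β st t, eval_toB I β st t']
  | _, .select t t' => by
    simp only [FTm.toB, BTm.eval, FTm.eval, eval_toB I β st t, eval_toB I β st t']
  | _, .store t t' t'' => by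
    simp only [FTm.toB, BTm.eval, FTm.eval, eval_toB I β st t, eval_toB I β st t',
      eval_toB I β st t'']
  | _, .anon t => by simp only [FTm.toB, BTm.eval, FTm.eval, eval_toB I β st t]
  | _, .app _ ts => by simp only [FTm.toB, BTm.eval, FTm.eval, fun i => eval_toB I β st (ts i)]

theorem FForm.sat_toB (E : Env) (st : State Val) : ∀ (φ : FForm UVar) (β : Asg UVar),
    φ.toB.Sat E st β ↔ φ.Sat E.prog E.int st β
  | .pred p ts, β => by simp only [FForm.toB, BForm.Sat, FForm.Sat, FTm.eval_toB]
  | .eq t t', β => by simp only [FForm.toB, BForm.Sat, FForm.Sat, FTm.eval_toB]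
  | .or φ ψ, β => by
    simp only [FForm.toB, BForm.Sat, FForm.Sat, sat_toB E st φ, sat_toB E st ψ]
  | .not φ, β => by simp only [FForm.toB, BForm.Sat, FForm.Sat, sat_toB E st φ]
  | .ex S x φ, β => by simp only [FForm.toB, BForm.Sat, FForm.Sat, sat_toB E st φ]
  | .exHeap x φ, β => by simp only [FForm.toB, BForm.Sat, FForm.Sat, sat_toB E st φ]

/-- Terms: substituting the program variables, and the logical variables of kind `val`, amounts to
evaluating in another state, and under another assignment. -/
theorem FTm.eval_subst {V W : Type} (I : Interp) (r : V → W) (sv : V → FTm W .val)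
    (sp : Var → FTm W .val) {st st' : State Val} {β : Asg V} {β' : Asg W}
    (hh : st'.heap = st.heap) (hp : ∀ v, (sp v).eval I st β' = st'.loc v)
    (hv : ∀ x, (sv x).eval I st β' = β .val x) (hr : ∀ k x, k ≠ .val → β' k (r x) = β k x) :
    ∀ {k : Kind} (t : FTm V k), (t.subst r sv sp).eval I st β' = t.eval I st' β
  | .val, .lvar x => hv x
  | .heap, .lvar x => hr _ x (by simp)
  | .fld, .lvar x => hr _ x (by simp)
  | .pos, .lvar x => hr _ x (by simp)
  | .meth, .lvar x => hr _ x (by simp)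
  | .expr, .lvar x => hr _ x (by simp)
  | .nat, .lvar x => hr _ x (by simp)
  | _, .pvar v => hp v
  | _, .heap => hh.symm
  | _, .field _ => rfl
  | _, .const _ => rfl
  | _, .un _ t => by
    simp only [FTm.subst, FTm.eval, eval_subst I r sv sp hh hp hv hr t]
  | _, .bin _ t t' => by
    simp only [FTm.subst, FTm.eval, eval_subst I r sv sp hh hp hv hr t,
      eval_subst I r sv sp hh hp hv hr t']
  | _, .idx t t' => by
    simp only [FTm.subst, FTm.eval, eval_subst I r sv sp hh hp hv hr t,
      eval_subst I r sv sp hh hp hv hr t']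
  | _, .select t t' => by
    simp only [FTm.subst, FTm.eval, eval_subst I r sv sp hh hp hv hr t,
      eval_subst I r sv sp hh hp hv hr t']
  | _, .store t t' t'' => by
    simp only [FTm.subst, FTm.eval, eval_subst I r sv sp hh hp hv hr t,
      eval_subst I r sv sp hh hp hv hr t', eval_subst I r sv sp hh hp hv hr t'']
  | _, .anon t => by
    simp only [FTm.subst, FTm.eval, eval_subst I r sv sp hh hp hv hr t]
  | _, .app _ ts => by
    simp only [FTm.subst, FTm.eval, fun i => eval_subst I r sv sp hh hp hv hr (ts i)]

/-- The substitution lemma. The hypotheses `hps` and `hvs` exclude variable capture: assigning to a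
variable that a quantifier of `φ` may bind does not affect the substituted terms. -/
theorem FForm.sat_subst {V W : Type} (P : Program) (I : Interp) (r : V → W)
    (hrinj : Function.Injective r) (sp : Var → FTm W .val) {st st' : State Val}
    (hh : st'.heap = st.heap) :
    ∀ (φ : FForm V) (sv : V → FTm W .val) (β : Asg V) (β' : Asg W),
      (∀ v, (sp v).eval I st β' = st'.loc v) →
      (∀ x, (sv x).eval I st β' = β .val x) → (∀ k x, k ≠ .val → β' k (r x) = β k x) →
      (∀ y, φ.Occ y → ∀ v k a γ, (sp v).eval I st (γ.set k (r y) a) = (sp v).eval I st γ) →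
      (∀ y x k, (x ≠ y ∨ k ≠ .val) → ∀ a γ,
        (sv x).eval I st (γ.set k (r y) a) = (sv x).eval I st γ) →
      ((φ.subst r sp sv).Sat P I st β' ↔ φ.Sat P I st' β)
  | .pred p ts, sv, β, β', hp, hv, hr, _, _ => by
    simp only [FForm.subst, FForm.Sat, FTm.eval_subst I r sv sp hh hp hv hr]
  | .eq t t', sv, β, β', hp, hv, hr, _, _ => by
    simp only [FForm.subst, FForm.Sat, FTm.eval_subst I r sv sp hh hp hv hr]
  | .or φ ψ, sv, β, β', hp, hv, hr, hps, hvs => by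
    simp only [FForm.subst, FForm.Sat]
    exact or_congr (sat_subst P I r hrinj sp hh φ sv β β' hp hv hr (fun y hy => hps y (.inl hy))
      hvs)
      (sat_subst P I r hrinj sp hh ψ sv β β' hp hv hr (fun y hy => hps y (.inr hy)) hvs)
  | .not φ, sv, β, β', hp, hv, hr, hps, hvs => by
    simp only [FForm.subst, FForm.Sat]
    exact not_congr (sat_subst P I r hrinj sp hh φ sv β β' hp hv hr hps hvs)
  | .ex S y φ, sv, β, β', hp, hv, hr, hps, hvs => by
    simp only [FForm.subst, FForm.Sat]
    refine exists_congr fun a => and_congr_right fun _ =>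
      sat_subst P I r hrinj sp hh φ _ _ _ ?_ ?_ ?_ (fun z hz => hps z (.inr hz)) ?_
    · intro v
      rw [hps y (.inl rfl), hp]
    · intro x
      by_cases hxy : x = y
      · subst hxy
        simp [FTm.eval]
      · rw [Function.update_of_ne hxy, hvs y x _ (.inl hxy), hv, Asg.set_ne _ _ _ _ _ _ hxy]
    · intro k x hk
      rw [Asg.set_ne_kind _ _ _ _ _ _ hk.symm, Asg.set_ne_kind _ _ _ _ _ _ hk.symm, hr k x hk]
    · intro z x k hxz b γ
      by_cases hxy : x = y
      · subst hxy
        simp only [Function.update_self, FTm.eval]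
        rcases hxz with hxz | hk
        · exact Asg.set_ne _ _ _ _ _ _ fun h => hxz (hrinj h)
        · exact Asg.set_ne_kind _ _ _ _ _ _ hk
      · rw [Function.update_of_ne hxy, hvs z x k hxz]
  | .exHeap y φ, sv, β, β', hp, hv, hr, hps, hvs => by
    simp only [FForm.subst, FForm.Sat]
    refine exists_congr fun a =>
      sat_subst P I r hrinj sp hh φ _ _ _ ?_ ?_ ?_ (fun z hz => hps z (.inr hz)) hvs
    · intro v
      rw [hps y (.inl rfl), hp]
    · intro x
      rw [hvs y x _ (.inr (by simp)), hv, Asg.set_ne_kind _ _ _ _ _ _ (by simp)]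
    · intro k x hk
      by_cases hxy : x = y
      · subst hxy
        by_cases hk' : k = .heap
        · subst hk'; simp
        · rw [Asg.set_ne_kind _ _ _ _ _ _ (Ne.symm hk'), Asg.set_ne_kind _ _ _ _ _ _ (Ne.symm hk'),
            hr k x hk]
      · rw [Asg.set_ne _ _ _ _ _ _ hxy, Asg.set_ne _ _ _ _ _ _ fun h => hxy (hrinj h), hr k x hk]

/-- The part of an assignment of the trace logic that concerns the variables of the state logic. -/
def Asg.user (β : Asg MVar) : Asg UVar := fun k x => β k (.u x)

theorem MVar.u_injective : Function.Injective MVar.u := fun _ _ h => by simpa using h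

/-- Lifted formulas only depend on the variables of the state logic. -/
theorem FForm.sat_lift (P : Program) (I : Interp) (st : State Val) (β : Asg MVar)
    (φ : FForm UVar) : φ.lift.Sat P I st β ↔ φ.Sat P I st β.user := by
  refine FForm.sat_subst P I MVar.u MVar.u_injective .pvar rfl φ _ _ _ (fun _ => rfl) (fun _ => rfl)
    (fun _ _ _ => rfl) (fun _ _ _ _ _ _ => rfl) ?_
  rintro y x k (h | h) a γ
  · exact Asg.set_ne _ _ _ _ _ _ fun h' => h (MVar.u_injective h')
  · exact Asg.set_ne_kind _ _ _ _ _ _ h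

theorem FForm.sat_liftResult (P : Program) (I : Interp) (st : State Val) (β : Asg MVar)
    (φ : FForm UVar) (d j : ℕ) : (φ.liftResult (.aux d j)).Sat P I st β ↔
      φ.Sat P I (st.setVar .result (β .val (.aux d j))) β.user := by
  refine FForm.sat_subst P I MVar.u MVar.u_injective _ ?_ φ _ _ _ ?_ (fun _ => rfl)
    (fun _ _ _ => rfl) ?_ ?_
  · rfl
  · intro v
    cases v <;> simp [FTm.eval, State.setVar]
  · intro y _ v k a γ
    cases v
    · rfl
    · exact Asg.set_ne _ _ _ _ _ _ (by simp)
  · rintro y x k (h | h) a γ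
    · exact Asg.set_ne _ _ _ _ _ _ fun h' => h (MVar.u_injective h')
    · exact Asg.set_ne_kind _ _ _ _ _ _ h

theorem FForm.sat_substResult (P : Program) (I : Interp) (st : State Val) (β : Asg UVar)
    (φ : FForm UVar) (x : UVar) (hx : ¬ φ.Occ x) : (φ.substResult x).Sat P I st β ↔
      φ.Sat P I (st.setVar .result (β .val x)) β := by
  refine FForm.sat_subst P I id Function.injective_id _ ?_ φ _ _ _ ?_ (fun _ => rfl)
    (fun _ _ _ => rfl) ?_ ?_
  · rfl
  · intro v
    cases v <;> simp [FTm.eval, State.setVar]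
  · intro y hy v k a γ
    cases v
    · rfl
    · exact Asg.set_ne _ _ _ _ _ _ fun h => hx (h ▸ hy)
  · rintro y z k (h | h) a γ
    · exact Asg.set_ne _ _ _ _ _ _ h
    · exact Asg.set_ne_kind _ _ _ _ _ _ h

/-- The assignment that binds the parameter variables `par 0, par 1, …` to the values `as`;
parameters beyond the length of `as` are left unchanged. -/
def Asg.setPars (β : Asg UVar) (as : List Val) : Asg UVar := fun k x =>
  match k, x with
  | .val, .par j => (as[j]?).getD (β .val (.par j))
  | k, x => β k x

theorem Expr.eval_toTm_congr {V : Type} (I : Interp) (st : State Val) (β : Asg V) {W : Type}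
    (β' : Asg W) : ∀ e : Expr, e.toTm.eval I st β = e.toTm.eval I st β'
  | .var _ => rfl
  | .field _ => rfl
  | .lit _ => rfl
  | .never => rfl
  | .nil => rfl
  | .tru => rfl
  | .fls => rfl
  | .un _ e => congrArg (I.un _) (eval_toTm_congr I st β β' e)
  | .bin _ e e' =>
    congrArg₂ (I.bin _) (eval_toTm_congr I st β β' e) (eval_toTm_congr I st β β' e')

/-- The value of an expression in a concrete state. The assignment is arbitrary, since expressions
contain no logical variables. -/
def Expr.value (I : Interp) (st : State Val) (e : Expr) : Val :=
  (e.toTm : FTm UVar .val).eval I st fun k _ => match k with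
    | .val => Val.unit
    | .heap => fun _ => Val.unit
    | .fld => (0 : ℕ)
    | .pos => (0 : ℤ)
    | .meth => ⟨0, 0⟩
    | .expr => Expr.never
    | .nat => (0 : ℕ)

theorem Expr.eval_toTm {V : Type} (I : Interp) (st : State Val) (β : Asg V) (e : Expr) :
    e.toTm.eval I st β = e.value I st := Expr.eval_toTm_congr I st _ _ e

theorem FForm.sat_substPars (P : Program) (I : Interp) (st : State Val) (β : Asg UVar)
    (φ : FForm UVar) (es : List Expr) : (φ.substPars es).Sat P I st β ↔
      φ.Sat P I st (β.setPars (es.map (Expr.value I st))) := by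
  refine FForm.sat_subst P I id Function.injective_id _ rfl φ _ _ _ (fun _ => rfl) ?_
    ?_ (fun _ _ _ _ _ _ => rfl) ?_
  · rintro (n | j)
    · rfl
    · simp only [Asg.setPars, List.getElem?_map]
      cases h : es[j]? with
      | none => rfl
      | some e => exact Expr.eval_toTm _ _ _ _
  · intro k x hk
    cases x with
    | user => cases k <;> rfl
    | par => cases k <;> first | rfl | exact absurd rfl hk
  · rintro y (n | j) k h a γ
    · rcases h with h | h
      · exact Asg.set_ne _ _ _ _ _ _ h
      · exact Asg.set_ne_kind _ _ _ _ _ _ h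
    · cases he : es[j]? with
      | none =>
        simp only [he]
        rcases h with h | h
        · exact Asg.set_ne _ _ _ _ _ _ h
        · exact Asg.set_ne_kind _ _ _ _ _ _ h
      | some e =>
        simp only [he]
        exact Expr.eval_toTm_congr _ _ _ _ e

theorem Expr.sat_toForm {V : Type} (P : Program) (I : Interp) (st : State Val) (β : Asg V)
    (e : Expr) : (e.toForm : FForm V).Sat P I st β ↔ e.value I st = .bool true := by
  simp only [Expr.toForm, FForm.Sat, FTm.eval, Expr.eval_toTm]

/-! ### Windows of positions -/

/-- Membership in a sort, where the positions range over the window `W`. -/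
def MSort.MemW (P : Program) (W : Set ℤ) : {k : Kind} → MSort k → Dom k → Prop
  | _, .val S, v => S.Mem P v
  | _, .pos, (i : ℤ) => i ∈ W
  | _, .meth, _ => True
  | _, .expr, _ => True
  | _, .nat, _ => True

/-- Satisfaction of a formula whose position quantifiers range over the window `W`: the semantic
counterpart of syntactic relativization. -/
def MForm.SatW (P : Program) (I : Interp) (θ : CHist) (W : Set ℤ) : MAsg → MForm → Prop
  | β, .or φ ψ => φ.SatW P I θ W β ∨ ψ.SatW P I θ W β
  | β, .not φ => ¬ φ.SatW P I θ W β
  | β, .ex (k := k) S x φ => ∃ a : Dom k, S.MemW P W a ∧ φ.SatW P I θ W (β.set k x a)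
  | β, .exSet (k := k) S X φ =>
      ∃ A : Set (Dom k), (∀ a ∈ A, S.MemW P W a) ∧ φ.SatW P I θ W (β.setSet k X A)
  | β, φ => φ.Sat P I θ β

theorem MForm.sat_iff_satW (P : Program) (I : Interp) (θ : CHist) : ∀ (φ : MForm) (β : MAsg),
    φ.Sat P I θ β ↔ φ.SatW P I θ (Set.Icc 1 θ.elems.length) β
  | .or φ ψ, β => by
    simp only [MForm.Sat, MForm.SatW, sat_iff_satW P I θ φ, sat_iff_satW P I θ ψ]
  | .not φ, β => by simp only [MForm.Sat, MForm.SatW, sat_iff_satW P I θ φ]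
  | .ex S x φ, β => by
    simp only [MForm.Sat, MForm.SatW, sat_iff_satW P I θ φ]
    cases S <;> rfl
  | .exSet S x φ, β => by
    simp only [MForm.Sat, MForm.SatW, sat_iff_satW P I θ φ]
    cases S <;> rfl
  | .pred _ _, β => Iff.rfl
  | .eq _ _, β => Iff.rfl
  | .le _ _, β => Iff.rfl
  | .isEvent _, β => Iff.rfl
  | .sub _ _, β => Iff.rfl
  | .isLab _ (.ev _), β => Iff.rfl
  | .isLab _ .gap, β => Iff.rfl
  | .isState _ _, β => Iff.rfl

namespace MForm

variable {P : Program} {I : Interp} {θ : CHist} {W : Set ℤ} {β : MAsg}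

theorem satW_and {φ ψ : MForm} :
    (φ.and ψ).SatW P I θ W β ↔ φ.SatW P I θ W β ∧ ψ.SatW P I θ W β := by
  simp only [MForm.and, SatW, not_or, not_not]

theorem satW_imp {φ ψ : MForm} :
    (φ.imp ψ).SatW P I θ W β ↔ (φ.SatW P I θ W β → ψ.SatW P I θ W β) := by
  simp only [imp, SatW, imp_iff_not_or]

theorem satW_all {k : Kind} {S : MSort k} {x : MVar} {φ : MForm} :
    (all S x φ).SatW P I θ W β ↔ ∀ a : Dom k, S.MemW P W a → φ.SatW P I θ W (β.set k x a) := by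
  simp only [all, SatW, not_exists, not_and, not_not]

theorem satW_mem {k : Kind} {t : MTm k} {X : MVar} :
    (mem t X).SatW P I θ W β ↔ t.eval I β.fo ∈ β.so k X := by
  simp only [mem, SatW, Sat, MSet.eval, Set.singleton_subset_iff]

theorem satW_lt {t t' : MTm .pos} :
    (lt t t').SatW P I θ W β ↔ (t.eval I β.fo : ℤ) < t'.eval I β.fo := by
  simp only [lt, SatW, Sat, not_le]

theorem satW_le {t t' : MTm .pos} :
    (le t t').SatW P I θ W β ↔ (t.eval I β.fo : ℤ) ≤ t'.eval I β.fo := Iff.rfl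

theorem satW_disj {l : List MForm} :
    (disj l).SatW P I θ W β ↔ ∃ φ ∈ l, φ.SatW P I θ W β := by
  induction l with
  | nil => simp [disj, fls, SatW, Sat, MTm.eval]
  | cons φ l ih =>
    have : disj (φ :: l) = .or φ (disj l) := rfl
    simp only [this, SatW, ih, List.mem_cons, exists_eq_or_imp]

theorem satW_conj {l : List MForm} :
    (conj l).SatW P I θ W β ↔ ∀ φ ∈ l, φ.SatW P I θ W β := by
  induction l with
  | nil => simp [conj, tru, SatW, Sat, MTm.eval]
  | cons φ l ih =>
    have : conj (φ :: l) = .and φ (conj l) := rfl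
    simp only [this, satW_and, ih, List.mem_cons, forall_eq_or_imp]

end MForm

/-- Simultaneous assignment of semantic values to a list of variables. -/
noncomputable def MAsg.setVals (β : MAsg) (xs : List MVar) (a : MVar → Val) : MAsg where
  fo k y := match k with
    | .val => if y ∈ xs then a y else β.fo .val y
    | k => β.fo k y
  so := β.so

theorem MAsg.ext' {β β' : MAsg} (h : ∀ k y, β.fo k y = β'.fo k y) (h' : β.so = β'.so) :
    β = β' := by
  cases β; cases β'
  simp only [MAsg.mk.injEq]
  exact ⟨funext fun k => funext fun y => h k y, h'⟩

theorem MForm.satW_exVals {P : Program} {I : Interp} {θ : CHist} {W : Set ℤ} {S : VSort}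
    {φ : MForm} : ∀ (xs : List MVar) (β : MAsg), (exVals S xs φ).SatW P I θ W β ↔
      ∃ a : MVar → Val, (∀ x ∈ xs, S.Mem P (a x)) ∧ φ.SatW P I θ W (β.setVals xs a)
  | [], β => by
    have : ∀ a, β.setVals [] a = β := fun a => MAsg.ext' (fun k y => by
      cases k <;> simp [MAsg.setVals]) rfl
    simp only [exVals, List.foldr_nil, List.not_mem_nil, false_imp_iff, implies_true, true_and,
      this]
    exact ⟨fun h => ⟨fun _ => .unit, h⟩, fun ⟨_, h⟩ => h⟩
  | x :: xs, β => by
    have hex : exVals S (x :: xs) φ = .ex (.val S) x (exVals S xs φ) := rfl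
    rw [hex]
    simp only [SatW, satW_exVals xs, MSort.MemW]
    constructor
    · rintro ⟨v, hv, a, ha, h⟩
      refine ⟨fun y => if y ∈ xs then a y else v, ?_, ?_⟩
      · intro y hy
        by_cases hyx : y ∈ xs
        · simpa [hyx] using ha y hyx
        · simpa [hyx] using hv
      · convert h using 1
        refine MAsg.ext' (fun k y => ?_) rfl
        cases k <;> simp only [MAsg.setVals, MAsg.set] <;>
          try exact (Asg.set_ne_kind _ _ _ _ _ _ (by simp)).symm
        by_cases hyx : y ∈ xs <;> by_cases hy : y = x <;>
          simp [hyx, hy, Asg.set_same_kind]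
    · rintro ⟨a, ha, h⟩
      refine ⟨a x, ha x (by simp), a, fun y hy => ha y (by simp [hy]), ?_⟩
      convert h using 1
      refine MAsg.ext' (fun k y => ?_) rfl
      cases k <;> simp only [MAsg.setVals, MAsg.set] <;>
        try exact Asg.set_ne_kind _ _ _ _ _ _ (by simp)
      by_cases hyx : y ∈ xs <;> by_cases hy : y = x <;>
        simp [hyx, hy, Asg.set_same_kind]

/-- No first-order quantifier of the formula binds a variable in `S`. Set quantifiers are
irrelevant, as the windows of relativizations are given by first-order variables. -/
def MForm.NoBind (S : Set MVar) : MForm → Prop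
  | .or φ ψ => φ.NoBind S ∧ ψ.NoBind S
  | .not φ => φ.NoBind S
  | .ex _ x φ => x ∉ S ∧ φ.NoBind S
  | .exSet _ _ φ => φ.NoBind S
  | _ => True

/-- Relativization to `R` restricts the window. The variables in `S` are those on which `R` depends;
they are not bound in `φ`, so that `R` has the same meaning under all binders. -/
theorem MForm.satW_rel {P : Program} {I : Interp} {θ : CHist} {R : MVar → MForm} {S : Set MVar}
    {T : Set ℤ} {β : MAsg} (hb : MVar.bound ∉ S)
    (hR : ∀ W (γ : MAsg), (∀ v ∈ S, γ.fo .pos v = β.fo .pos v) →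
      ∀ x, (R x).SatW P I θ W γ ↔ (γ.fo .pos x : ℤ) ∈ T) (W : Set ℤ) :
    ∀ (φ : MForm) (γ : MAsg), φ.NoBind S → (∀ v ∈ S, γ.fo .pos v = β.fo .pos v) →
      ((φ.rel R).SatW P I θ W γ ↔ φ.SatW P I θ (W ∩ T) γ)
  | .or φ ψ, γ, hn, hγ => by
    simp only [rel, SatW, satW_rel hb hR W φ γ hn.1 hγ, satW_rel hb hR W ψ γ hn.2 hγ]
  | .not φ, γ, hn, hγ => by
    have hn' : φ.NoBind S := hn
    simp only [rel, SatW, satW_rel hb hR W φ γ hn' hγ]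
  | .ex (k := k) s x φ, γ, hn, hγ => by
    have hset : ∀ a : Dom k, ∀ v ∈ S, (γ.set k x a).fo .pos v = β.fo .pos v := fun a v hv => by
      rw [← hγ v hv]
      exact Asg.set_ne _ _ _ _ _ _ fun h => hn.1 (h ▸ hv)
    have ih := fun a => satW_rel hb hR W φ (γ.set k x a) hn.2 (hset a)
    cases s
    case pos =>
      simp only [rel, SatW, satW_and, ih, MSort.MemW, Set.mem_inter_iff, and_assoc]
      refine exists_congr fun a => and_congr_right fun _ => and_congr_left fun _ => ?_
      rw [hR W _ (hset a)]
      simp [MAsg.set]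
    all_goals
      simp only [rel, SatW, ih]
      rfl
  | .exSet (k := k) s X φ, γ, hn, hγ => by
    have ih := fun A => satW_rel hb hR W φ (γ.setSet k X A) hn hγ
    cases s
    case pos =>
      simp only [rel, SatW, satW_and, ih, MSort.MemW, Set.mem_inter_iff, satW_all, satW_imp,
        satW_mem]
      refine exists_congr fun A => ?_
      rw [← and_assoc]
      refine and_congr_left fun _ => ?_
      have key : ∀ a : ℤ, (R .bound).SatW P I θ W ((γ.setSet .pos X A).set .pos .bound a) ↔
          a ∈ T := by
        intro a
        rw [hR W _ (fun v hv => ?_)]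
        · simp [MAsg.set]
        · rw [← hγ v hv]
          exact Asg.set_ne _ _ _ _ _ _ fun h => hb (h ▸ hv)
      constructor
      · rintro ⟨h₁, h₂⟩ a ha
        exact ⟨h₁ a ha, (key a).1 (h₂ a (h₁ a ha)
          (by simpa [MAsg.set, MAsg.setSet, MTm.eval] using ha))⟩
      · intro h
        refine ⟨fun a ha => (h a ha).1, fun a _ ha => (key a).2 (h a ?_).2⟩
        simpa [MAsg.set, MAsg.setSet, MTm.eval] using ha
    all_goals
      simp only [rel, SatW, ih]
      rfl
  | .pred _ _, _, _, _ => Iff.rfl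
  | .eq _ _, _, _, _ => Iff.rfl
  | .le _ _, _, _, _ => Iff.rfl
  | .isEvent _, _, _, _ => Iff.rfl
  | .sub _ _, _, _, _ => Iff.rfl
  | .isLab _ _, _, _, _ => Iff.rfl
  | .isState _ _, _, _, _ => Iff.rfl

/-! ### Positions of concrete histories -/

/-- The element at position `i` is a label other than `noEv`. -/
def Hist.Vis (θ : CHist) (i : ℤ) : Prop := ∃ l, θ.at i = some (.lab l) ∧ l ≠ .ev .noEv

theorem Hist.exists_at {α E : Type} {θ : Hist α E} {i : ℤ} (h₁ : 1 ≤ i) (h₂ : i ≤ θ.elems.length) :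
    ∃ x, θ.at i = some x := by
  unfold Hist.at
  rw [if_pos h₁]
  exact ⟨_, List.getElem?_eq_getElem (by omega)⟩

@[simp] theorem Hist.at_one {α E : Type} (θ : Hist α E) : θ.at 1 = some (.st θ.first) := by
  simp [Hist.at, Hist.elems]

theorem Hist.one_le_length {α E : Type} (θ : Hist α E) : (1 : ℤ) ≤ θ.elems.length := by
  simp [Hist.elems]

/-! ### The meaning of method types -/

/-- The meaning of a method type in the positions `lo, …, hi` of a trace: `MType.trans`, read
semantically, where relativization has become a change of the bounds. The values of the roles are
`ρ`. -/
def MType.Holds (P : Program) (I : Interp) (θ : CHist) {R : ℕ} (ρ : Fin R → Val) (β : Asg UVar) :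
    MType R → ℤ → ℤ → Prop
  | .call X m n φ, lo, hi => ∀ i, lo ≤ i → i ≤ hi → θ.Vis i →
      ∃ x g as, as.length = n ∧ θ.at i = some (.lab (.ev (.invEv x (ρ X) g m as))) ∧
        ∃ st, θ.at (i - 1) = some (.st st) ∧ φ.Sat P I st (β.setPars as)
  | .term φ, lo, hi => ∀ i, lo ≤ i → i ≤ hi → θ.Vis i →
      ∃ x g m e, θ.at i = some (.lab (.ev (.futEv x g m e))) ∧
        ∃ st, θ.at (i - 1) = some (.st st) ∧ φ.Sat P I (st.setVar .result e) β
  | .skip, lo, hi => ∀ i, lo ≤ i → i ≤ hi → ¬ θ.Vis i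
  | .seq L L', lo, hi => ∃ i, lo ≤ i ∧ i ≤ hi ∧ L.Holds P I θ ρ β lo i ∧ L'.Holds P I θ ρ β i hi
  | .star L, lo, hi => ∃ J : Set ℤ, ∃ a b, (∀ x ∈ J, lo ≤ x ∧ x ≤ hi) ∧ a ∈ J ∧ b ∈ J ∧ a ≤ b ∧
      (∀ k, lo ≤ k → k ≤ hi → (k < a ∧ ¬ θ.Vis k) ∨ (a ≤ k ∧ k ≤ b)) ∧
      ∀ i₁ ∈ J, ∀ i₂ ∈ J, i₁ < i₂ → (∀ l ∈ J, l ≤ i₁ ∨ i₂ ≤ l) → L.Holds P I θ ρ β i₁ i₂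
  | .active J L, lo, hi => ∃ j ∈ J, (L j).Holds P I θ ρ β lo hi
  | .passive ms φ L₁ L₂, lo, hi => ∃ i j k, lo ≤ i ∧ i < j ∧ j < k ∧ k ≤ hi ∧
      (∀ l, lo ≤ l → l ≤ hi → l = j ∨ k ≤ l ∨ (l ≤ i ∧ ¬ θ.Vis l)) ∧
      ∃ x g m e p, θ.at j = some (.lab (.ev (.futREv x g m e p))) ∧ m ∈ ms ∧
        ((∃ st, θ.at k = some (.st st) ∧ φ.Sat P I (st.setVar .result e) β) →
          L₁.Holds P I θ ρ β k hi) ∧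
        (¬ (∃ st, θ.at k = some (.st st) ∧ φ.Sat P I (st.setVar .result e) β) →
          L₂.Holds P I θ ρ β k hi)

/-- The variables that `MType.trans d` treats as being in use. -/
def usedAux (d : ℕ) : Set MVar := {x | ∃ d' j, x = .aux d' j ∧ d' < d}

theorem MForm.noBind_rel {R : MVar → MForm} {S : Set MVar} (hb : MVar.bound ∉ S)
    (hR : ∀ x, (R x).NoBind S) : ∀ φ : MForm, φ.NoBind S → (φ.rel R).NoBind S
  | .or φ ψ, h => ⟨noBind_rel hb hR φ h.1, noBind_rel hb hR ψ h.2⟩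
  | .not φ, h => noBind_rel (S := S) hb hR φ h
  | .ex s x φ, h => by
    have := noBind_rel hb hR φ h.2
    cases s <;> simp [rel, MForm.and, NoBind, h.1, hR, this]
  | .exSet s x φ, h => by
    have := noBind_rel (S := S) hb hR φ h
    cases s <;> simp [rel, MForm.and, all, imp, mem, NoBind, hR, this, hb]
  | .pred _ _, _ => trivial
  | .eq _ _, _ => trivial
  | .le _ _, _ => trivial
  | .isEvent _, _ => trivial
  | .sub _ _, _ => trivial
  | .isLab _ _, _ => trivial
  | .isState _ _, _ => trivial

theorem MForm.noBind_disj {S : Set MVar} {l : List MForm} (h : ∀ φ ∈ l, φ.NoBind S) :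
    (disj l).NoBind S := by
  induction l with
  | nil => trivial
  | cons φ l ih => exact ⟨h _ (by simp), ih fun ψ hψ => h ψ (by simp [hψ])⟩

theorem MForm.noBind_exVals {S : Set MVar} {s : VSort} {xs : List MVar} {φ : MForm}
    (h : ∀ x ∈ xs, x ∉ S) (hφ : φ.NoBind S) : (exVals s xs φ).NoBind S := by
  induction xs with
  | nil => exact hφ
  | cons x xs ih => exact ⟨h _ (by simp), ih fun y hy => h y (by simp [hy])⟩

theorem MForm.NoBind.mono {S S' : Set MVar} (h : S ⊆ S') :
    ∀ φ : MForm, φ.NoBind S' → φ.NoBind S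
  | .or φ ψ, hφ => ⟨mono h φ hφ.1, mono h ψ hφ.2⟩
  | .not φ, hφ => mono (S := S) (S' := S') h φ hφ
  | .ex _ _ φ, hφ => ⟨fun hx => hφ.1 (h hx), mono h φ hφ.2⟩
  | .exSet _ _ φ, hφ => mono (S := S) (S' := S') h φ hφ
  | .pred _ _, _ => trivial
  | .eq _ _, _ => trivial
  | .le _ _, _ => trivial
  | .isEvent _, _ => trivial
  | .sub _ _, _ => trivial
  | .isLab _ _, _ => trivial
  | .isState _ _, _ => trivial

theorem usedAux_mono (d : ℕ) : usedAux d ⊆ usedAux (d + 1) := by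
  rintro x ⟨d', j, h, h'⟩
  exact ⟨d', j, h, by omega⟩

theorem bound_not_mem_usedAux (d : ℕ) : MVar.bound ∉ usedAux d := by simp [usedAux]

/-- The translation at nesting depth `d` binds no variable of a smaller depth, which is what makes
its relativizations capture-free. -/
theorem MType.noBind_trans {R : ℕ} : ∀ (L : MType R) (d : ℕ), (L.trans d).NoBind (usedAux d)
  | .call X m n φ, d => by
    simp only [trans, MForm.all, MForm.imp, MForm.and, MForm.NoBind]
    exact ⟨by simp [usedAux], ⟨trivial, trivial⟩, MForm.noBind_exVals (by simp [usedAux])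
      (MForm.noBind_exVals (by simp [usedAux]) ⟨trivial, trivial⟩)⟩
  | .term φ, d => by
    simp only [trans, MForm.all, MForm.imp, MForm.and, MForm.NoBind]
    exact ⟨by simp [usedAux], ⟨trivial, trivial⟩, MForm.noBind_exVals (by simp [usedAux])
      ⟨by simp [usedAux], trivial, trivial⟩⟩
  | .skip, d => ⟨by simp [usedAux], trivial, trivial⟩
  | .seq L L', d => by
    have h := (noBind_trans L (d + 1)).mono (usedAux_mono d)
    have h' := (noBind_trans L' (d + 1)).mono (usedAux_mono d)
    exact ⟨by simp [usedAux], MForm.noBind_rel (R := fun n => .le (.var n) (.var (.aux d 0)))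
        (bound_not_mem_usedAux d) (fun _ => trivial) _ h,
      MForm.noBind_rel (R := fun n => .le (.var (.aux d 0)) (.var n))
        (bound_not_mem_usedAux d) (fun _ => trivial) _ h'⟩
  | .star L, d => by
    have h := MForm.noBind_rel (R := fun n => .and (.le (.var (.aux d 4)) (.var n))
        (.le (.var n) (.var (.aux d 5)))) (bound_not_mem_usedAux d) (fun _ => ⟨trivial, trivial⟩) _
        ((noBind_trans L (d + 1)).mono (usedAux_mono d))
    simp only [trans, MForm.NoBind, MForm.conj, MForm.and, MForm.imp, MForm.all, MForm.mem,
      MForm.lt, MForm.tru, List.foldr] at h ⊢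
    simp [usedAux] at h ⊢
    exact h
  | .active J L, d => by
    refine MForm.noBind_disj fun φ hφ => ?_
    obtain ⟨j, -, rfl⟩ := List.mem_map.1 hφ
    exact noBind_trans (L j) d
  | .passive ms φ L₁ L₂, d => by
    have h₁ := MForm.noBind_rel (R := fun n => .le (.var (.aux d 2)) (.var n))
      (bound_not_mem_usedAux d) (fun _ => trivial) _
      ((noBind_trans L₁ (d + 1)).mono (usedAux_mono d))
    have h₂ := MForm.noBind_rel (R := fun n => .le (.var (.aux d 2)) (.var n))
      (bound_not_mem_usedAux d) (fun _ => trivial) _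
      ((noBind_trans L₂ (d + 1)).mono (usedAux_mono d))
    have h₃ : (MForm.disj (ms.map fun m =>
        .eq (k := .meth) (.var (.aux d 7)) (.meth m))).NoBind (usedAux d) := by
      refine MForm.noBind_disj fun φ hφ => ?_
      obtain ⟨j, -, rfl⟩ := List.mem_map.1 hφ
      trivial
    simp only [trans, MForm.NoBind, MForm.conj, MForm.and, MForm.imp, MForm.all, MForm.exVals,
      MForm.lt, MForm.tru, MForm.quiet, List.foldr, h₁, h₂, h₃]
    simp [usedAux]

/-! ### The translation expresses the meaning of method types -/

theorem Asg.user_set_aux (β : Asg MVar) (k : Kind) (d j : ℕ) (a : Dom k) :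
    (β.set k (.aux d j) a).user = β.user := by
  funext k' x
  exact Asg.set_ne _ _ _ _ _ _ (by simp)

theorem mapM_some {α γ : Type} (f : α → γ) : ∀ l : List α,
    l.mapM (fun a => some (f a)) = some (l.map f)
  | [] => rfl
  | a :: l => by simp [List.mapM_cons, mapM_some f l]

theorem MForm.satW_visible {P : Program} {I : Interp} {θ : CHist} {W : Set ℤ} {β : MAsg}
    (t : MTm .pos) :
    (MForm.and (.isEvent t) (.not (.isLab t (.ev .noEv)))).SatW P I θ W β ↔
      θ.Vis (t.eval I β.fo) := by
  simp only [MForm.satW_and, SatW, Sat, MEvt.eval, Event.mapM, Hist.Vis]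
  constructor
  · rintro ⟨⟨l, hl⟩, h⟩
    exact ⟨l, hl, fun h' => h ⟨_, rfl, h' ▸ hl⟩⟩
  · rintro ⟨l, hl, h⟩
    refine ⟨⟨l, hl⟩, ?_⟩
    rintro ⟨c, hc, h'⟩
    rw [hl] at h'
    cases hc
    simp only [Option.some.injEq, Elem.lab.injEq] at h'
    exact h h'

theorem MForm.satW_noEv_of_event {P : Program} {I : Interp} {θ : CHist} {W : Set ℤ} {β : MAsg}
    (t : MTm .pos) :
    ((MForm.isEvent t).SatW P I θ W β → (MForm.isLab t (.ev .noEv)).SatW P I θ W β) ↔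
      ¬ θ.Vis (t.eval I β.fo) := by
  rw [← MForm.satW_visible (P := P) (I := I) (W := W), MForm.satW_and]
  simp only [SatW, not_and, not_not]

/-- The bounds on the position are needed: outside the trace, a position is neither visible nor
quiet. -/
theorem MForm.satW_quiet {P : Program} {I : Interp} {θ : CHist} {W : Set ℤ} {β : MAsg}
    (t : MTm .pos) (h₁ : 1 ≤ (t.eval I β.fo : ℤ)) (h₂ : (t.eval I β.fo : ℤ) ≤ θ.elems.length) :
    (MForm.quiet t).SatW P I θ W β ↔ ¬ θ.Vis (t.eval I β.fo) := by
  obtain ⟨x, hx⟩ := Hist.exists_at h₁ h₂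
  simp only [MForm.quiet, SatW, Sat, MEvt.eval, Event.mapM, Hist.Vis, hx, FForm.tru, FForm.Sat,
    FTm.eval]
  cases x with
  | st s => simp
  | lab l => simp

theorem MForm.satW_isState_lift {P : Program} {I : Interp} {θ : CHist} {W : Set ℤ} {β : MAsg}
    (t : MTm .pos) (φ : FForm UVar) : (MForm.isState t φ.lift).SatW P I θ W β ↔
      ∃ st, θ.at (t.eval I β.fo) = some (.st st) ∧ φ.Sat P I st β.fo.user := by
  simp only [SatW, Sat, FForm.sat_lift]

theorem MForm.satW_isState_liftResult {P : Program} {I : Interp} {θ : CHist} {W : Set ℤ}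
    {β : MAsg} (t : MTm .pos) (φ : FForm UVar) (d j : ℕ) :
    (MForm.isState t (φ.liftResult (.aux d j))).SatW P I θ W β ↔
      ∃ st, θ.at (t.eval I β.fo) = some (.st st) ∧
        φ.Sat P I (st.setVar .result (β.fo .val (.aux d j))) β.fo.user := by
  simp only [SatW, Sat, FForm.sat_liftResult]

theorem MForm.satW_ex {P : Program} {I : Interp} {θ : CHist} {W : Set ℤ} {β : MAsg} {k : Kind}
    {S : MSort k} {x : MVar} {φ : MForm} : (MForm.ex S x φ).SatW P I θ W β ↔
      ∃ a : Dom k, S.MemW P W a ∧ φ.SatW P I θ W (β.set k x a) := Iff.rfl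

theorem MForm.satW_or {P : Program} {I : Interp} {θ : CHist} {W : Set ℤ} {β : MAsg}
    {φ ψ : MForm} : (MForm.or φ ψ).SatW P I θ W β ↔ φ.SatW P I θ W β ∨ ψ.SatW P I θ W β := Iff.rfl

theorem MForm.satW_not {P : Program} {I : Interp} {θ : CHist} {W : Set ℤ} {β : MAsg}
    {φ : MForm} : (MForm.not φ).SatW P I θ W β ↔ ¬ φ.SatW P I θ W β := Iff.rfl

theorem MForm.satW_exSet {P : Program} {I : Interp} {θ : CHist} {W : Set ℤ} {β : MAsg} {k : Kind}
    {S : MSort k} {X : MVar} {φ : MForm} : (MForm.exSet S X φ).SatW P I θ W β ↔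
      ∃ A : Set (Dom k), (∀ a ∈ A, S.MemW P W a) ∧ φ.SatW P I θ W (β.setSet k X A) := Iff.rfl

theorem MForm.satW_eq {P : Program} {I : Interp} {θ : CHist} {W : Set ℤ} {β : MAsg} {k : Kind}
    {t t' : MTm k} : (MForm.eq t t').SatW P I θ W β ↔ t.eval I β.fo = t'.eval I β.fo := Iff.rfl

theorem MForm.satW_isLab_invEv {P : Program} {I : Interp} {θ : CHist} {W : Set ℤ} {β : MAsg}
    (t : MTm .pos) (a b c : MTm .val) (m : MTm .meth) (es : List (MTm .val)) :
    (MForm.isLab t (.ev (.invEv a b c m es))).SatW P I θ W β ↔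
      θ.at (t.eval I β.fo) = some (.lab (.ev (.invEv (a.eval I β.fo) (b.eval I β.fo)
        (c.eval I β.fo) (m.eval I β.fo) (es.map fun e => (e.eval I β.fo : Val))))) := by
  simp only [SatW, Sat, MEvt.eval, Event.mapM, mapM_some]
  simp

theorem MForm.satW_isLab_futEv {P : Program} {I : Interp} {θ : CHist} {W : Set ℤ} {β : MAsg}
    (t : MTm .pos) (a b : MTm .val) (m : MTm .meth) (e : MTm .val) :
    (MForm.isLab t (.ev (.futEv a b m e))).SatW P I θ W β ↔
      θ.at (t.eval I β.fo) = some (.lab (.ev (.futEv (a.eval I β.fo) (b.eval I β.fo)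
        (m.eval I β.fo) (e.eval I β.fo)))) := by
  simp [SatW, Sat, MEvt.eval, Event.mapM]

theorem MForm.satW_isLab_futREv {P : Program} {I : Interp} {θ : CHist} {W : Set ℤ} {β : MAsg}
    (t : MTm .pos) (a b : MTm .val) (m : MTm .meth) (e : MTm .val) (i : MTm .nat) :
    (MForm.isLab t (.ev (.futREv a b m e i))).SatW P I θ W β ↔
      θ.at (t.eval I β.fo) = some (.lab (.ev (.futREv (a.eval I β.fo) (b.eval I β.fo)
        (m.eval I β.fo) (e.eval I β.fo) (i.eval I β.fo)))) := by
  simp [SatW, Sat, MEvt.eval, Event.mapM]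

theorem MForm.satW_meth_mem {P : Program} {I : Interp} {θ : CHist} {W : Set ℤ} {β : MAsg}
    (ms : List MName) (x : MVar) :
    (MForm.disj (ms.map fun m => .eq (k := .meth) (.var x) (.meth m))).SatW P I θ W β ↔
      (β.fo .meth x : MName) ∈ ms := by
  simp [MForm.satW_disj, SatW, Sat, MTm.eval]

theorem MAsg.fo_set (β : MAsg) (k : Kind) (x : MVar) (a : Dom k) :
    (β.set k x a).fo = β.fo.set k x a := rfl

theorem MAsg.so_set (β : MAsg) (k : Kind) (x : MVar) (a : Dom k) :
    (β.set k x a).so = β.so := rfl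

theorem MAsg.fo_setSet (β : MAsg) (k : Kind) (x : MVar) (a : Set (Dom k)) :
    (β.setSet k x a).fo = β.fo := rfl

theorem MAsg.so_setSet (β : MAsg) (k : Kind) (x : MVar) (a : Set (Dom k)) :
    (β.setSet k x a).so k x = a := by simp [MAsg.setSet]

theorem icc_inter_le {lo hi i : ℤ} (h : i ≤ hi) : Set.Icc lo hi ∩ {n | n ≤ i} = Set.Icc lo i := by
  ext n; simp only [Set.mem_inter_iff, Set.mem_Icc, Set.mem_ofPred_eq]; omega

theorem icc_inter_ge {lo hi i : ℤ} (h : lo ≤ i) : Set.Icc lo hi ∩ {n | i ≤ n} = Set.Icc i hi := by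
  ext n; simp only [Set.mem_inter_iff, Set.mem_Icc, Set.mem_ofPred_eq]; omega

theorem icc_inter_icc {lo hi i j : ℤ} (h : lo ≤ i) (h' : j ≤ hi) :
    Set.Icc lo hi ∩ Set.Icc i j = Set.Icc i j := by
  ext n; simp only [Set.mem_inter_iff, Set.mem_Icc]; omega

/-- Relativization of the translation of a method type to a window that is given by
the variables of the enclosing construct. -/
theorem MType.satW_rel_trans {P : Program} {I : Interp} {θ : CHist} {R : ℕ} (L : MType R) {d : ℕ}
    {Q : MVar → MForm} {T W : Set ℤ} {β : MAsg}
    (hQ : ∀ W (γ : MAsg), (∀ v ∈ usedAux (d + 1), γ.fo .pos v = β.fo .pos v) →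
      ∀ x, (Q x).SatW P I θ W γ ↔ (γ.fo .pos x : ℤ) ∈ T) :
    (((L.trans (d + 1)).rel Q).SatW P I θ W β ↔ (L.trans (d + 1)).SatW P I θ (W ∩ T) β) :=
  MForm.satW_rel (bound_not_mem_usedAux _) hQ W _ β (L.noBind_trans _) fun _ _ => rfl

theorem aux_mem_usedAux (d j : ℕ) : MVar.aux d j ∈ usedAux (d + 1) := ⟨d, j, rfl, by omega⟩

/-- The translation of a type, with position quantifiers that range over a window inside the trace,
holds iff the type holds in this window. -/
theorem MType.satW_trans (P : Program) (I : Interp) (θ : CHist) {R : ℕ} (ρ : Fin R → Val) :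
    ∀ (L : MType R) (d : ℕ) (lo hi : ℤ) (β : MAsg), 1 ≤ lo → hi ≤ θ.elems.length →
      (∀ r : Fin R, β.fo .val (.role r) = ρ r) →
      ((L.trans d).SatW P I θ (Set.Icc lo hi) β ↔ L.Holds P I θ ρ β.fo.user lo hi)
  | .call X m n φ, d, lo, hi, β, _, _, hρ => by
    simp only [trans, MForm.satW_all, MForm.satW_imp, MForm.satW_visible, Holds, MSort.MemW,
      Set.mem_Icc, and_imp]
    refine forall_congr' fun i => imp_congr_right fun _ => imp_congr_right fun _ => ?_
    simp only [MTm.eval, MAsg.fo_set, Asg.set_self]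
    refine imp_congr_right fun _ => ?_
    rw [show ∀ ψ, MForm.exVals .any [.aux d 1, .aux d 2] ψ =
      .ex (.val .any) (.aux d 1) (.ex (.val .any) (.aux d 2) ψ) from fun _ => rfl]
    simp only [MForm.satW_ex, MForm.satW_exVals, MForm.satW_and,
      MForm.satW_isState_lift, MForm.satW_isLab_invEv, MSort.MemW, VSort.Mem, true_and,
      MTm.eval, implies_true, List.map_map]
    -- The user variables `par j` are rebound to the arguments, all other variables keep their
    -- values.
    have huser : ∀ (γ : MAsg) (a : MVar → Val),
        (γ.setVals ((List.range n).map fun j => .u (.par j)) a).fo.user =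
          γ.fo.user.setPars ((List.range n).map fun j => a (.u (.par j))) := by
      intro γ a
      funext k x
      cases k <;> cases x <;> simp [Asg.user, MAsg.setVals, Asg.setPars]
      rename_i j
      by_cases hj : j < n <;> simp [hj]
    have hvals : ∀ (γ : MAsg) (a : MVar → Val),
        (List.range n).map ((fun e => MTm.eval I
            (γ.setVals ((List.range n).map fun j => .u (.par j)) a).fo e) ∘
          fun j => (MTm.var (.u (.par j)) : MTm .val)) =
        (List.range n).map fun j => a (.u (.par j)) := by
      intro γ a
      refine List.map_congr_left fun j hj => ?_
      simp [MTm.eval, MAsg.setVals, List.mem_range.1 hj]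
    have hlab : ∀ (γ : MAsg) (a : MVar → Val) (y : MVar),
        y ∉ (List.range n).map (fun j => MVar.u (.par j)) →
        ∀ k, (γ.setVals ((List.range n).map fun j => .u (.par j)) a).fo k y = γ.fo k y := by
      intro γ a y hy k
      cases k <;> simp only [MAsg.setVals]
      rw [if_neg hy]
    have hnot : ∀ d j, MVar.aux d j ∉ (List.range n).map (fun j => MVar.u (.par j)) := by simp
    have hnot' : ∀ r, MVar.role r ∉ (List.range n).map (fun j => MVar.u (.par j)) := by simp
    simp only [huser, hvals, hlab _ _ _ (hnot _ _), hlab _ _ _ (hnot' _), MAsg.fo_set,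
      Asg.user_set_aux]
    simp only [Asg.set_same_kind, MVar.aux.injEq, true_and, reduceCtorEq, Nat.reduceEqDiff,
      if_true, if_false, ne_eq, not_false_eq_true, Asg.set_ne_kind, hρ]
    constructor
    · rintro ⟨x, g, a, h⟩
      exact ⟨x, g, _, by simp, h⟩
    · rintro ⟨x, g, as, hn, h⟩
      refine ⟨x, g, fun y => match y with
        | .u (.par j) => (as[j]?).getD .unit
        | _ => .unit, ?_⟩
      rw [show (List.range n).map (fun j => (as[j]?).getD .unit) = as from ?_]
      · exact h
      · refine List.ext_getElem (by simp [hn]) fun j h₁ h₂ => ?_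
        simp [h₂]
  | .term φ, d, lo, hi, β, _, _, hρ => by
    simp only [trans, MForm.satW_all, MForm.satW_imp, MForm.satW_visible, Holds, MSort.MemW,
      Set.mem_Icc, and_imp]
    refine forall_congr' fun i => imp_congr_right fun _ => imp_congr_right fun _ => ?_
    simp only [MTm.eval, MAsg.fo_set, Asg.set_self]
    refine imp_congr_right fun _ => ?_
    simp only [MForm.exVals, List.foldr, MForm.satW_ex, MForm.satW_and,
      MForm.satW_isState_liftResult, MForm.satW_isLab_futEv, MSort.MemW, VSort.Mem, true_and,
      MTm.eval, MAsg.fo_set, Asg.user_set_aux]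
    simp only [Asg.set_same_kind, MVar.aux.injEq, true_and, reduceCtorEq, Nat.reduceEqDiff,
      if_true, if_false, ne_eq, not_false_eq_true, Asg.set_ne_kind]
    constructor
    · rintro ⟨x, g, e, m, h⟩
      exact ⟨x, g, m, e, h⟩
    · rintro ⟨x, g, m, e, h⟩
      exact ⟨x, g, e, m, h⟩
  | .skip, d, lo, hi, β, h₁, h₂, _ => by
    simp only [trans, MForm.satW_all, Holds, MSort.MemW, Set.mem_Icc, and_imp]
    refine forall_congr' fun i => imp_congr_right fun hi₁ => imp_congr_right fun hi₂ => ?_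
    have : (MTm.var (.aux d 0) : MTm .pos).eval I (β.set .pos (.aux d 0) i).fo = i := by
      simp [MTm.eval, MAsg.fo_set]
    rw [MForm.satW_quiet _ (by rw [this]; exact h₁.trans hi₁) (by rw [this]; exact hi₂.trans h₂),
      this]
  | .seq L L', d, lo, hi, β, h₁, h₂, hρ => by
    simp only [trans, MForm.SatW, MForm.satW_and, Holds, MSort.MemW, Set.mem_Icc]
    refine exists_congr fun i => ?_
    rw [and_assoc]
    refine and_congr_right fun hi₁ => and_congr_right fun hi₂ => ?_
    rw [satW_rel_trans L (T := {n | n ≤ i}), satW_rel_trans L' (T := {n | i ≤ n}),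
      icc_inter_le hi₂, icc_inter_ge hi₁, satW_trans P I θ ρ L _ _ _ _ h₁ (hi₂.trans h₂),
      satW_trans P I θ ρ L' _ _ _ _ (h₁.trans hi₁) h₂, MAsg.fo_set, Asg.user_set_aux]
    · intro r; rw [MAsg.fo_set, Asg.set_ne _ _ _ _ _ _ (by simp), hρ]
    · intro r; rw [MAsg.fo_set, Asg.set_ne _ _ _ _ _ _ (by simp), hρ]
    · intro W γ hγ x
      simp [MForm.satW_le, MTm.eval, hγ _ (aux_mem_usedAux _ _), MAsg.fo_set]
    · intro W γ hγ x
      simp [MForm.satW_le, MTm.eval, hγ _ (aux_mem_usedAux _ _), MAsg.fo_set]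
  | .star L, d, lo, hi, β, h₁, h₂, hρ => by
    simp only [trans, MForm.satW_ex, MForm.satW_exSet, MForm.satW_and, Holds, MSort.MemW,
      Set.mem_Icc, MForm.satW_or,
      MForm.satW_conj, MForm.satW_all, MForm.satW_imp, MForm.satW_mem, MForm.satW_noEv_of_event,
      MForm.satW_lt, MForm.satW_le, List.mem_cons, List.not_mem_nil, or_false, forall_eq_or_imp,
      forall_eq, MTm.eval, MAsg.fo_set, MAsg.so_set, MAsg.so_setSet]
    simp only [Asg.set_same_kind, MVar.aux.injEq, true_and, Nat.reduceEqDiff,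
      if_true, if_false]
    have key : ∀ (γ : MAsg), γ.fo.user = β.fo.user →
        (∀ r : Fin R, γ.fo .val (.role r) = ρ r) →
        ∀ i₁ i₂ : ℤ, γ.fo .pos (.aux d 4) = i₁ → γ.fo .pos (.aux d 5) = i₂ →
          lo ≤ i₁ → i₂ ≤ hi →
        (((L.trans (d + 1)).rel fun n => (MForm.le (.var (.aux d 4)) (.var n)).and
            (.le (.var n) (.var (.aux d 5)))).SatW P I θ (Set.Icc lo hi) γ ↔
          L.Holds P I θ ρ β.fo.user i₁ i₂) := by
      intro γ hu hr i₁ i₂ h4 h5 hi₁ hi₂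
      rw [satW_rel_trans L (T := Set.Icc i₁ i₂), icc_inter_icc hi₁ hi₂,
        satW_trans P I θ ρ L _ _ _ _ (h₁.trans hi₁) (hi₂.trans h₂) hr, hu]
      intro W δ hδ x
      simp [MForm.satW_and, MForm.satW_le, MTm.eval, hδ _ (aux_mem_usedAux _ _), h4, h5]
    refine exists_congr fun J => ?_
    constructor
    · rintro ⟨hJ, a, ha, b, hb, haJ, hbJ, hab, hk, hL⟩
      refine ⟨a, b, hJ, haJ, hbJ, hab, fun k hk₁ hk₂ => hk k ⟨hk₁, hk₂⟩,
        fun i₁ hi₁ i₂ hi₂ hlt hc => ?_⟩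
      refine (key _ ?_ ?_ i₁ i₂ ?_ ?_ (hJ _ hi₁).1 (hJ _ hi₂).2).1
        (hL i₁ (hJ _ hi₁) i₂ (hJ _ hi₂) ⟨hi₁, hi₂, hlt, fun l _ hl => hc l hl⟩)
      · simp only [MAsg.fo_set, MAsg.fo_setSet, Asg.user_set_aux]
      · intro r
        simp only [MAsg.fo_set, MAsg.fo_setSet]
        simp [Asg.set_ne_kind, hρ]
      · simp [MAsg.fo_set, Asg.set_same_kind]
      · simp [MAsg.fo_set]
    · rintro ⟨a, b, hJ, haJ, hbJ, hab, hk, hL⟩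
      refine ⟨hJ, a, hJ _ haJ, b, hJ _ hbJ, haJ, hbJ, hab, fun k hk' => hk k hk'.1 hk'.2, ?_⟩
      rintro i₁ hi₁ i₂ hi₂ ⟨hi₁J, hi₂J, hlt, hc⟩
      refine (key _ ?_ ?_ i₁ i₂ ?_ ?_ hi₁.1 hi₂.2).2
        (hL i₁ hi₁J i₂ hi₂J hlt fun l hl => hc l (hJ _ hl) hl)
      · simp only [MAsg.fo_set, MAsg.fo_setSet, Asg.user_set_aux]
      · intro r
        simp only [MAsg.fo_set, MAsg.fo_setSet]
        simp [Asg.set_ne_kind, hρ]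
      · simp [MAsg.fo_set, Asg.set_same_kind]
      · simp [MAsg.fo_set]
  | .active J L, d, lo, hi, β, h₁, h₂, hρ => by
    simp only [trans, MForm.satW_disj, Holds, List.mem_map, exists_exists_and_eq_and]
    exact exists_congr fun j => and_congr_right fun _ => satW_trans P I θ ρ (L j) d lo hi β h₁ h₂ hρ
  | .passive ms φ L₁ L₂, d, lo, hi, β, h₁, h₂, hρ => by
    have key : ∀ (L : MType R), (∀ (d : ℕ) (lo hi : ℤ) (β : MAsg), 1 ≤ lo →
          hi ≤ θ.elems.length → (∀ r : Fin R, β.fo .val (.role r) = ρ r) →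
          ((L.trans d).SatW P I θ (Set.Icc lo hi) β ↔ L.Holds P I θ ρ β.fo.user lo hi)) →
        ∀ (γ : MAsg), γ.fo.user = β.fo.user → (∀ r : Fin R, γ.fo .val (.role r) = ρ r) →
        ∀ k : ℤ, γ.fo .pos (.aux d 2) = k → lo ≤ k →
        (((L.trans (d + 1)).rel fun n => MForm.le (.var (.aux d 2)) (.var n)).SatW P I θ
          (Set.Icc lo hi) γ ↔ L.Holds P I θ ρ β.fo.user k hi) := by
      intro L ih γ hu hr k hk hlo
      rw [satW_rel_trans L (T := {n | k ≤ n}), icc_inter_ge hlo, ih _ _ _ _ (h₁.trans hlo) h₂ hr,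
        hu]
      intro W δ hδ x
      simp [MForm.satW_le, MTm.eval, hδ _ (aux_mem_usedAux _ _), hk]
    have key₁ := key L₁ (satW_trans P I θ ρ L₁)
    have key₂ := key L₂ (satW_trans P I θ ρ L₂)
    clear key
    have hquiet : ∀ (γ : MAsg) (i : ℤ), γ.fo .pos (.aux d 3) = i → lo ≤ i → i ≤ hi →
        ((MForm.quiet (.var (.aux d 3))).SatW P I θ (Set.Icc lo hi) γ ↔ ¬ θ.Vis i) := by
      intro γ i hi₀ hi₁ hi₂
      have : (MTm.var (.aux d 3) : MTm .pos).eval I γ.fo = i := hi₀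
      rw [MForm.satW_quiet _ (by rw [this]; exact h₁.trans hi₁) (by rw [this]; exact hi₂.trans h₂),
        this]
    simp only [trans, MForm.exVals, List.foldr, MForm.satW_ex, MForm.satW_and, Holds, MSort.MemW,
      Set.mem_Icc, MForm.satW_conj, MForm.satW_all, MForm.satW_imp, MForm.satW_meth_mem,
      MForm.satW_not, MForm.satW_or, MForm.satW_eq, MForm.satW_le,
      MForm.satW_isState_liftResult, MForm.satW_isLab_futREv,
      MForm.satW_lt, List.mem_cons, List.not_mem_nil, or_false, forall_eq_or_imp,
      forall_eq, MTm.eval, MAsg.fo_set, VSort.Mem, true_and, Asg.user_set_aux]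
    simp only [Asg.set_same_kind, MVar.aux.injEq, true_and, reduceCtorEq, Nat.reduceEqDiff,
      if_true, if_false, ne_eq, not_false_eq_true, Asg.set_ne_kind]
    refine exists_congr fun i => ?_
    constructor
    · rintro ⟨hi, j, hj, k, hk, x, g, e, m, p, hij, hjk, hl, hlab, hm, hL₁, hL₂⟩
      refine ⟨j, k, hi.1, hij, hjk, hk.2, fun l hl₁ hl₂ => ?_, x, g, m, e, p, hlab, hm,
        fun h => (key₁ _ ?_ ?_ k ?_ hk.1).1 (hL₁ h), fun h => (key₂ _ ?_ ?_ k ?_ hk.1).1 (hL₂ h)⟩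
      · have := hl l ⟨hl₁, hl₂⟩
        rwa [hquiet _ l (by simp [MAsg.fo_set]) hl₁ hl₂] at this
      all_goals simp only [MAsg.fo_set, Asg.user_set_aux]
      all_goals simp [Asg.set_ne_kind, Asg.set_same_kind, hρ]
    · rintro ⟨j, k, hi, hij, hjk, hk, hl, x, g, m, e, p, hlab, hm, hL₁, hL₂⟩
      refine ⟨⟨hi, by omega⟩, j, ⟨by omega, by omega⟩, k, ⟨by omega, hk⟩, x, g, e, m, p, hij, hjk,
        fun l hl' => ?_, hlab, hm, fun h => (key₁ _ ?_ ?_ k ?_ (by omega)).2 (hL₁ h),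
        fun h => (key₂ _ ?_ ?_ k ?_ (by omega)).2 (hL₂ h)⟩
      · rw [hquiet _ l (by simp [MAsg.fo_set]) hl'.1 hl'.2]
        exact hl l hl'.1 hl'.2
      all_goals simp only [MAsg.fo_set, Asg.user_set_aux]
      all_goals simp [Asg.set_ne_kind, Asg.set_same_kind, hρ]

/-- The roles denote the objects that the reference fields hold in the first state. -/
theorem sat_metSpec (P : Program) (I : Interp) (θ : CHist) {R : ℕ} (role : Fin R → Field)
    (L : MType R) (β : MAsg) : ((metSpec role).α L).Sat P I θ β ↔
      (∀ r, VSort.obj.Mem P (θ.first.heap (role r))) ∧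
        L.Holds P I θ (fun r => θ.first.heap (role r)) β.fo.user 1 θ.elems.length := by
  have hmem : ∀ r : Fin R, MVar.role r.val ∈ (List.finRange R).map fun r : Fin R => .role r.val :=
    fun r => List.mem_map.2 ⟨r, List.mem_finRange r, rfl⟩
  have huser : ∀ a, (β.setVals ((List.finRange R).map fun r : Fin R => .role r.val) a).fo.user =
      β.fo.user := by
    intro a
    funext k x
    cases k <;> simp [Asg.user, MAsg.setVals]
  rw [MForm.sat_iff_satW]
  simp only [metSpec, MForm.satW_exVals, MForm.satW_and, MForm.satW_conj, List.mem_map,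
    List.mem_finRange, true_and, forall_exists_index, forall_apply_eq_imp_iff]
  have hrole : ∀ a (r : Fin R),
      ((MForm.isState (.num 1) (.eq (k := .val) (.lvar (.role r.val))
        (.select .heap (.field (role r))))).SatW P I θ (Set.Icc 1 θ.elems.length)
        (β.setVals ((List.finRange R).map fun r : Fin R => .role r.val) a) ↔
      a (.role r.val) = θ.first.heap (role r)) := by
    intro a r
    simp [MForm.SatW, MForm.Sat, MTm.eval, FForm.Sat, FTm.eval, MAsg.setVals]
  simp only [hrole]
  have htrans : ∀ a, (∀ r : Fin R, a (.role r.val) = θ.first.heap (role r)) →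
      ((L.trans 0).SatW P I θ (Set.Icc 1 θ.elems.length)
        (β.setVals ((List.finRange R).map fun r : Fin R => .role r.val) a) ↔
      L.Holds P I θ (fun r => θ.first.heap (role r)) β.fo.user 1 θ.elems.length) := by
    intro a ha
    rw [MType.satW_trans P I θ _ L 0 _ _ _ le_rfl le_rfl, huser]
    intro r
    simp [MAsg.setVals, ha]
  constructor
  · rintro ⟨a, ha, hr, h⟩
    exact ⟨fun r => hr r ▸ ha r, (htrans a hr).1 h⟩
  · rintro ⟨hr, h⟩
    refine ⟨fun x => match x with
      | .role n => if hn : n < R then θ.first.heap (role ⟨n, hn⟩) else .unit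
      | _ => .unit, ?_, ?_, ?_⟩
    · intro r; simpa using hr r
    · intro r; simp
    · exact (htrans _ (by simp)).2 h

theorem Asg.user_toM (β : Asg UVar) : β.toM.fo.user = β := rfl

/-! ### Elements of composed histories -/

theorem Hist.elems_cons {α E : Type} (s s' : State α) (l : Lab E) (r : List (Lab E × State α)) :
    Hist.elems ⟨s, (l, s') :: r⟩ = .st s :: .lab l :: Hist.elems ⟨s', r⟩ := rfl

theorem Hist.length_elems {α E : Type} (h : Hist α E) :
    h.elems.length = 1 + 2 * h.rest.length := by
  obtain ⟨s, r⟩ := h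
  induction r generalizing s with
  | nil => rfl
  | cons x r ih =>
    obtain ⟨l, s'⟩ := x
    rw [Hist.elems_cons]
    simp only [List.length_cons, ih]
    omega

theorem Hist.last_cons {α E : Type} (s s' : State α) (l : Lab E) (r : List (Lab E × State α)) :
    Hist.last ⟨s, (l, s') :: r⟩ = Hist.last ⟨s', r⟩ := by
  cases r with
  | nil => rfl
  | cons x r =>
    simp only [Hist.last, List.getLast?_cons_cons]
    rw [List.getLast?_eq_some_getLast (by simp)]
    rfl

/-- The last state of the first part is the first state of the second one, and is counted once. -/
theorem Hist.elems_append {α E : Type} (s : State α) (r r' : List (Lab E × State α)) :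
    Hist.elems ⟨s, r ++ r'⟩ =
      (Hist.elems ⟨s, r⟩).dropLast ++ Hist.elems ⟨Hist.last ⟨s, r⟩, r'⟩ := by
  induction r generalizing s with
  | nil => rfl
  | cons x r ih =>
    obtain ⟨l, s'⟩ := x
    rw [List.cons_append, Hist.elems_cons, ih, Hist.last_cons, Hist.elems_cons,
      List.dropLast_cons_of_ne_nil (by simp), List.dropLast_cons_of_ne_nil (by simp [Hist.elems])]
    rfl

theorem Hist.at_append_right {α E : Type} (s : State α) (r r' : List (Lab E × State α)) (i : ℤ)
    (hi : 1 ≤ i) :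
    Hist.at ⟨s, r ++ r'⟩ (i + 2 * r.length) = Hist.at ⟨Hist.last ⟨s, r⟩, r'⟩ i := by
  have hl : (Hist.elems ⟨s, r⟩).dropLast.length = 2 * r.length := by
    rw [List.length_dropLast, Hist.length_elems]
    simp
  unfold Hist.at
  rw [if_pos hi, if_pos (by omega), Hist.elems_append, List.getElem?_append_right (by omega), hl]
  congr 1
  omega

theorem Hist.elems_append' {α E : Type} (s : State α) (r r' : List (Lab E × State α)) :
    Hist.elems ⟨s, r ++ r'⟩ =
      Hist.elems ⟨s, r⟩ ++ r'.flatMap (fun p => [.lab p.1, .st p.2]) := by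
  simp [Hist.elems]

theorem Hist.at_append_left {α E : Type} (s : State α) (r r' : List (Lab E × State α)) (i : ℤ)
    (hi : i ≤ (Hist.elems ⟨s, r⟩ : List (Elem α E)).length) :
    Hist.at ⟨s, r ++ r'⟩ i = Hist.at ⟨s, r⟩ i := by
  unfold Hist.at
  split
  · rw [Hist.elems_append', List.getElem?_append_left (by omega)]
  · rfl

theorem Hist.at_length {α E : Type} (h : Hist α E) :
    h.at h.elems.length = some (.st h.last) := by
  obtain ⟨s, r⟩ := h
  have := Hist.at_append_right s r [] 1 le_rfl
  rw [List.append_nil, Hist.at_one] at this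
  rw [← this, Hist.length_elems]
  congr 1

theorem Hist.at_two {α E : Type} (s s' : State α) (l : Lab E) (r : List (Lab E × State α)) :
    Hist.at ⟨s, (l, s') :: r⟩ 2 = some (.lab l) := by simp [Hist.at, Hist.elems_cons]

theorem Hist.at_three {α E : Type} (s s' : State α) (l : Lab E) (r : List (Lab E × State α)) :
    Hist.at ⟨s, (l, s') :: r⟩ 3 = some (.st s') := by simp [Hist.at, Hist.elems]

theorem Hist.mem_of_at_lab {α E : Type} {h : Hist α E} {i : ℤ} {l : Lab E}
    (hl : h.at i = some (.lab l)) : ∃ s, (l, s) ∈ h.rest := by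
  unfold Hist.at at hl
  split at hl
  · have := List.mem_of_getElem? hl
    simpa [Hist.elems] using this
  · simp at hl

theorem Hist.not_vis_of_state {θ : CHist} {i : ℤ} {s : State Val} (h : θ.at i = some (.st s)) :
    ¬ θ.Vis i := by
  rintro ⟨l, hl, -⟩
  simp [h] at hl

/-! ### Transport of method types between windows -/

namespace MType

variable {P : Program} {I : Interp} {R : ℕ} {ρ : Fin R → Val} {β : Asg UVar}

/-- The meaning of a method type depends only on the elements of the window: it is preserved if a
history is embedded into another one as a segment. -/
theorem Holds.shift {θ θ' : CHist} {c : ℤ}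
    (h : ∀ i : ℤ, 1 ≤ i → i ≤ θ.elems.length → θ'.at (i + c) = θ.at i) :
    ∀ (L : MType R) (lo hi : ℤ), 1 ≤ lo → hi ≤ θ.elems.length → L.Holds P I θ ρ β lo hi →
      L.Holds P I θ' ρ β (lo + c) (hi + c) := by
  have hv : ∀ i : ℤ, 1 ≤ i → i ≤ θ.elems.length → (θ'.Vis (i + c) ↔ θ.Vis i) := fun i h₁ h₂ => by
    simp only [Hist.Vis, h i h₁ h₂]
  -- A visible position is not the first one, so that its predecessor is in the segment as well.
  have hpred : ∀ i : ℤ, 1 ≤ i → i ≤ θ.elems.length → θ.Vis i →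
      θ'.at (i + c - 1) = θ.at (i - 1) := fun i h₁ h₂ hi => by
    have : i ≠ 1 := by
      rintro rfl
      exact Hist.not_vis_of_state (Hist.at_one θ) hi
    rw [← h (i - 1) (by omega) (by omega)]
    congr 1
    omega
  intro L
  induction L with
  | call X m n φ =>
    intro lo hi h₁ h₂ H i hi₁ hi₂ hvis
    obtain ⟨i, rfl⟩ : ∃ j, i = j + c := ⟨i - c, by omega⟩
    rw [hv i (by omega) (by omega)] at hvis
    rw [h i (by omega) (by omega), hpred i (by omega) (by omega) hvis]
    exact H i (by omega) (by omega) hvis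
  | term φ =>
    intro lo hi h₁ h₂ H i hi₁ hi₂ hvis
    obtain ⟨i, rfl⟩ : ∃ j, i = j + c := ⟨i - c, by omega⟩
    rw [hv i (by omega) (by omega)] at hvis
    rw [h i (by omega) (by omega), hpred i (by omega) (by omega) hvis]
    exact H i (by omega) (by omega) hvis
  | skip =>
    intro lo hi h₁ h₂ H i hi₁ hi₂ hvis
    obtain ⟨i, rfl⟩ : ∃ j, i = j + c := ⟨i - c, by omega⟩
    rw [hv i (by omega) (by omega)] at hvis
    exact H i (by omega) (by omega) hvis
  | seq L L' ih ih' =>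
    rintro lo hi h₁ h₂ ⟨i, hi₁, hi₂, H, H'⟩
    exact ⟨i + c, by omega, by omega, ih lo i h₁ (by omega) H, ih' i hi (by omega) h₂ H'⟩
  | star L ih =>
    rintro lo hi h₁ h₂ ⟨J, a, b, hJ, ha, hb, hab, hk, H⟩
    refine ⟨{x | x - c ∈ J}, a + c, b + c, fun x hx => ?_, by simpa using ha, by simpa using hb,
      by omega, fun k hk₁ hk₂ => ?_, fun i₁ hi₁ i₂ hi₂ hlt hc => ?_⟩
    · have := hJ _ hx
      omega
    · obtain ⟨k, rfl⟩ : ∃ j, k = j + c := ⟨k - c, by omega⟩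
      rw [hv k (by omega) (by omega)]
      have := hk k (by omega) (by omega)
      exact this.imp (And.imp (by omega) id) (by omega)
    · have h₃ := hJ _ hi₁
      have h₄ := hJ _ hi₂
      have := ih (i₁ - c) (i₂ - c) (by omega) (by omega) (H _ hi₁ _ hi₂ (by omega) fun l hl => by
        have := hc (l + c) (by simpa using hl)
        omega)
      simpa using this
  | active J L ih =>
    rintro lo hi h₁ h₂ ⟨j, hj, H⟩
    exact ⟨j, hj, ih j lo hi h₁ h₂ H⟩
  | passive ms φ L₁ L₂ ih₁ ih₂ =>
    rintro lo hi h₁ h₂ ⟨i, j, k, hi₁, hij, hjk, hk, hl, x, g, m, e, p, hlab, hm, H₁, H₂⟩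
    refine ⟨i + c, j + c, k + c, by omega, by omega, by omega, by omega, fun l hl₁ hl₂ => ?_,
      x, g, m, e, p, by rw [h j (by omega) (by omega), hlab], hm, ?_, ?_⟩
    · obtain ⟨l, rfl⟩ : ∃ j, l = j + c := ⟨l - c, by omega⟩
      rw [hv l (by omega) (by omega)]
      have := hl l (by omega) (by omega)
      exact this.imp (by omega) (Or.imp (by omega) (And.imp (by omega) id))
    · rw [h k (by omega) (by omega)]
      exact fun ht => ih₁ k hi (by omega) h₂ (H₁ ht)
    · rw [h k (by omega) (by omega)]
      exact fun ht => ih₂ k hi (by omega) h₂ (H₂ ht)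

/-- A window can be extended downwards by invisible positions. -/
theorem Holds.extend_left {θ : CHist} {lo' : ℤ} :
    ∀ (L : MType R) (lo hi : ℤ), lo' ≤ lo → lo ≤ hi → (∀ k, lo' ≤ k → k < lo → ¬ θ.Vis k) →
      L.Holds P I θ ρ β lo hi → L.Holds P I θ ρ β lo' hi := by
  intro L
  induction L with
  | call X m n φ =>
    intro lo hi _ _ hq H i hi₁ hi₂ hvis
    exact H i (by by_contra hlt; exact hq i hi₁ (by omega) hvis) hi₂ hvis
  | term φ =>
    intro lo hi _ _ hq H i hi₁ hi₂ hvis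
    exact H i (by by_contra hlt; exact hq i hi₁ (by omega) hvis) hi₂ hvis
  | skip =>
    intro lo hi _ _ hq H i hi₁ hi₂ hvis
    exact H i (by by_contra hlt; exact hq i hi₁ (by omega) hvis) hi₂ hvis
  | seq L L' ih ih' =>
    rintro lo hi h₁ h₂ hq ⟨i, hi₁, hi₂, H, H'⟩
    exact ⟨i, by omega, hi₂, ih lo i h₁ hi₁ hq H, H'⟩
  | star L ih =>
    rintro lo hi h₁ h₂ hq ⟨J, a, b, hJ, ha, hb, hab, hk, H⟩
    have := hJ a ha
    refine ⟨J, a, b, fun x hx => ?_, ha, hb, hab, fun k hk₁ hk₂ => ?_, H⟩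
    · have := hJ x hx
      omega
    · by_cases hlt : k < lo
      · exact .inl ⟨by omega, hq k hk₁ hlt⟩
      · exact hk k (by omega) hk₂
  | active J L ih =>
    rintro lo hi h₁ h₂ hq ⟨j, hj, H⟩
    exact ⟨j, hj, ih j lo hi h₁ h₂ hq H⟩
  | passive ms φ L₁ L₂ ih₁ ih₂ =>
    rintro lo hi h₁ h₂ hq ⟨i, j, k, hi₁, hij, hjk, hk, hl, H⟩
    refine ⟨i, j, k, by omega, hij, hjk, hk, fun l hl₁ hl₂ => ?_, H⟩
    by_cases hlt : l < lo
    · exact .inr (.inr ⟨by omega, hq l hl₁ hlt⟩)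
    · exact hl l (by omega) hl₂

/-- A window whose last position is invisible can be extended upwards by invisible positions. -/
theorem Holds.extend_right {θ : CHist} {hi' : ℤ} :
    ∀ (L : MType R) (lo hi : ℤ), hi ≤ hi' → lo ≤ hi → (∀ k, hi ≤ k → k ≤ hi' → ¬ θ.Vis k) →
      L.Holds P I θ ρ β lo hi → L.Holds P I θ ρ β lo hi' := by
  intro L
  induction L with
  | call X m n φ =>
    intro lo hi _ _ hq H i hi₁ hi₂ hvis
    exact H i hi₁ (by by_contra hlt; exact hq i (by omega) hi₂ hvis) hvis
  | term φ =>
    intro lo hi _ _ hq H i hi₁ hi₂ hvis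
    exact H i hi₁ (by by_contra hlt; exact hq i (by omega) hi₂ hvis) hvis
  | skip =>
    intro lo hi _ _ hq H i hi₁ hi₂ hvis
    exact H i hi₁ (by by_contra hlt; exact hq i (by omega) hi₂ hvis) hvis
  | seq L L' ih ih' =>
    rintro lo hi h₁ h₂ hq ⟨i, hi₁, hi₂, H, H'⟩
    exact ⟨i, hi₁, by omega, H, ih' i hi h₁ hi₂ hq H'⟩
  | star L ih =>
    rintro lo hi h₁ h₂ hq ⟨J, a, b, hJ, ha, hb, hab, hk, H⟩
    -- The last repetition absorbs the new positions: the greatest element of `J` is moved to `hi'`.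
    have hbhi : b = hi := by
      have h₃ := hk hi h₂ le_rfl
      have h₄ := hJ b hb
      omega
    subst hbhi
    rcases hab.lt_or_eq with hab | rfl
    · refine ⟨insert hi' (J \ {b}), a, hi', ?_, .inr ⟨ha, by simpa using hab.ne⟩, .inl rfl,
        by omega, fun k hk₁ hk₂ => ?_, ?_⟩
      · rintro x (rfl | ⟨hx, -⟩)
        · exact ⟨by omega, le_rfl⟩
        · have := hJ x hx
          omega
      · by_cases hkb : k ≤ b
        · have := hk k hk₁ hkb
          exact this.imp id (by omega)
        · exact .inr (by omega)
      · rintro i₁ (rfl | ⟨hi₁, hi₁b⟩) i₂ (rfl | ⟨hi₂, hi₂b⟩) hlt hc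
        · omega
        · have := hJ _ hi₂
          omega
        · have h₃ := hJ _ hi₁
          have h₄ : i₁ ≠ b := hi₁b
          refine ih i₁ b h₁ (by omega) hq (H _ hi₁ _ hb (by omega) fun l hl => ?_)
          by_cases hlb : l = b
          · omega
          · have h₅ := hc l (.inr ⟨hl, hlb⟩)
            have h₆ := hJ l hl
            omega
        · refine H _ hi₁ _ hi₂ hlt fun l hl => ?_
          by_cases hlb : l = b
          · have := hJ _ hi₂
            omega
          · exact hc l (.inr ⟨hl, hlb⟩)
    · refine ⟨{hi'}, hi', hi', ?_, rfl, rfl, le_rfl, fun k hk₁ hk₂ => ?_, ?_⟩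
      · rintro x rfl
        omega
      · rcases hk₂.lt_or_eq with hlt | rfl
        · refine .inl ⟨hlt, ?_⟩
          by_cases hka : a ≤ k
          · exact hq k hka hk₂
          · have := hk k hk₁ (by omega)
            exact this.elim And.right (by omega)
        · exact .inr ⟨le_rfl, le_rfl⟩
      · rintro i₁ rfl i₂ rfl hlt
        omega
  | active J L ih =>
    rintro lo hi h₁ h₂ hq ⟨j, hj, H⟩
    exact ⟨j, hj, ih j lo hi h₁ h₂ hq H⟩
  | passive ms φ L₁ L₂ ih₁ ih₂ =>
    rintro lo hi h₁ h₂ hq ⟨i, j, k, hi₁, hij, hjk, hk, hl, x, g, m, e, p, hlab, hm, H₁, H₂⟩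
    refine ⟨i, j, k, hi₁, hij, hjk, by omega, fun l hl₁ hl₂ => ?_, x, g, m, e, p, hlab, hm,
      fun ht => ih₁ k hi h₁ hk hq (H₁ ht), fun ht => ih₂ k hi h₁ hk hq (H₂ ht)⟩
    by_cases hlt : l ≤ hi
    · exact hl l hl₁ hlt
    · exact .inr (.inl (by omega))

/-- The repetition of `L` in a window, where the repetitions start at its first position. -/
def Iterates (P : Program) (I : Interp) (θ : CHist) (ρ : Fin R → Val) (β : Asg UVar)
    (L : MType R) (lo hi : ℤ) : Prop :=
  ∃ J : Set ℤ, (∀ x ∈ J, lo ≤ x ∧ x ≤ hi) ∧ lo ∈ J ∧ hi ∈ J ∧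
    ∀ i₁ ∈ J, ∀ i₂ ∈ J, i₁ < i₂ → (∀ l ∈ J, l ≤ i₁ ∨ i₂ ≤ l) → L.Holds P I θ ρ β i₁ i₂

theorem Iterates.refl (θ : CHist) (L : MType R) (i : ℤ) : Iterates P I θ ρ β L i i := by
  refine ⟨{i}, ?_, rfl, rfl, ?_⟩
  · rintro x rfl
    omega
  · rintro i₁ rfl i₂ rfl h
    omega

theorem Iterates.cons {θ : CHist} {L : MType R} {lo mid hi : ℤ} (hlo : lo ≤ mid)
    (H : L.Holds P I θ ρ β lo mid) (H' : Iterates P I θ ρ β L mid hi) :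
    Iterates P I θ ρ β L lo hi := by
  obtain ⟨J, hJ, hm, hh, H'⟩ := H'
  refine ⟨insert lo J, ?_, .inl rfl, .inr hh, ?_⟩
  · rintro x (rfl | hx)
    · have := hJ _ hm
      omega
    · have := hJ x hx
      omega
  · intro i₁ hi₁ i₂ hi₂ hlt hc
    have hi₂J : i₂ ∈ J := by
      rcases hi₂ with rfl | hi₂
      · rcases hi₁ with rfl | hi₁
        · omega
        · have := hJ _ hi₁
          omega
      · exact hi₂
    by_cases hi₁J : i₁ ∈ J
    · exact H' _ hi₁J _ hi₂J hlt fun l hl => hc l (.inr hl)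
    · rcases hi₁ with rfl | hi₁
      · have h₁ := hc mid (.inr hm)
        have h₂ := hJ _ hi₂J
        have h₃ : mid ≠ i₁ := fun h => hi₁J (h ▸ hm)
        obtain rfl : i₂ = mid := by omega
        exact H
      · exact absurd hi₁ hi₁J

theorem Iterates.holds_star {θ : CHist} {L : MType R} {lo hi : ℤ} (hle : lo ≤ hi)
    (H : Iterates P I θ ρ β L lo hi) : (MType.star L).Holds P I θ ρ β lo hi := by
  obtain ⟨J, hJ, hl, hh, H⟩ := H
  exact ⟨J, lo, hi, hJ, hl, hh, hle, fun k h₁ h₂ => .inr ⟨h₁, h₂⟩, H⟩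

theorem Iterates.shift {θ θ' : CHist} {c : ℤ}
    (h : ∀ i : ℤ, 1 ≤ i → i ≤ θ.elems.length → θ'.at (i + c) = θ.at i) {L : MType R} {lo hi : ℤ}
    (h₁ : 1 ≤ lo) (h₂ : hi ≤ θ.elems.length) (H : Iterates P I θ ρ β L lo hi) :
    Iterates P I θ' ρ β L (lo + c) (hi + c) := by
  obtain ⟨J, hJ, hl, hh, H⟩ := H
  refine ⟨{x | x - c ∈ J}, fun x hx => ?_, by simpa using hl, by simpa using hh,
    fun i₁ hi₁ i₂ hi₂ hlt hc => ?_⟩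
  · have := hJ _ hx
    omega
  · have h₃ := hJ _ hi₁
    have h₄ := hJ _ hi₂
    have := Holds.shift h L (i₁ - c) (i₂ - c) (by omega) (by omega)
      (H _ hi₁ _ hi₂ (by omega) fun l hl => by
        have := hc (l + c) (by simpa using hl)
        omega)
    simpa using this

end MType

/-! ### The rewrite rules -/

/-- A history starts and ends with a state, so that `skip` holds in its first and in its last
position. -/
theorem MetRewrite.equiv {P : Program} {I : Interp} {R : ℕ} {role : Fin R → Field}
    {L L' : MType R} (h : MetRewrite L L') :
    ((metSpec role).α L).Equiv P I ((metSpec role).α L') := by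
  intro θ β
  rw [sat_metSpec, sat_metSpec]
  refine and_congr_right fun _ => ?_
  have hlen := θ.one_le_length
  cases h with
  | active L j L' hj =>
    subst hj
    simp [MType.Holds]
  | skipSeq L =>
    constructor
    · rintro ⟨i, hi₁, hi₂, hq, H⟩
      exact H.extend_left _ i _ hi₁ hi₂ fun k hk₁ hk₂ => hq k hk₁ (by omega)
    · intro H
      refine ⟨1, le_rfl, hlen, fun k hk₁ hk₂ => ?_, H⟩
      obtain rfl : k = 1 := by omega
      exact Hist.not_vis_of_state (Hist.at_one θ)
  | seqSkip L =>
    constructor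
    · rintro ⟨i, hi₁, hi₂, H, hq⟩
      exact H.extend_right _ 1 i hi₂ hi₁ hq
    · intro H
      refine ⟨_, hlen, le_rfl, H, fun k hk₁ hk₂ => ?_⟩
      obtain rfl : k = θ.elems.length := by omega
      exact Hist.not_vis_of_state (Hist.at_length θ)

/-! ### Runs of the locally abstract semantics -/

theorem LRun.trans {c : LCtx} {g g' g'' : LCfg} {sc sc' : Set SE}
    {p p' : List (Lab SEvent × State SE)} (h : LRun c g sc p g') (h' : LRun c g' sc' p' g'') :
    LRun c g (sc ∪ sc') (p ++ p') g'' := by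
  induction h with
  | refl g => simpa using h'
  | step g sc₁ p₁ g₁ sc₂ p₂ g₂ hs _ ih =>
    rw [Set.union_assoc, List.append_assoc]
    exact .step _ _ _ _ _ _ _ hs (ih h')

theorem LStep.run {c : LCtx} {g g' : LCfg} {sc : Set SE} {p : List (Lab SEvent × State SE)}
    (h : LStep c g sc p g') : LRun c g sc p g' := by
  simpa using LRun.step g sc p g' ∅ [] g' h (.refl g')

theorem LStep.append {c : LCtx} {L L' : List Stmt} {st st' : State SE} {n n' : ℕ} {sc : Set SE}
    {p : List (Lab SEvent × State SE)} (h : LStep c ⟨L, st, n⟩ sc p ⟨L', st', n'⟩)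
    (k : List Stmt) : LStep c ⟨L ++ k, st, n⟩ sc p ⟨L' ++ k, st', n'⟩ := by
  cases h
  all_goals simp only [List.cons_append, List.append_assoc]
  all_goals constructor
  all_goals assumption

/-- Statements that follow do not affect a run. -/
theorem LRun.append {c : LCtx} {g g' : LCfg} {sc : Set SE} {p : List (Lab SEvent × State SE)}
    (h : LRun c g sc p g') (k : List Stmt) :
    LRun c ⟨g.todo ++ k, g.st, g.next⟩ sc p ⟨g'.todo ++ k, g'.st, g'.next⟩ := by
  induction h with
  | refl g => exact .refl _
  | step g sc₁ p₁ g₁ sc₂ p₂ g₂ hs _ ih => exact .step _ _ _ _ _ _ _ (hs.append k) ih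

/-- A step concerns only the first statement of a list, whatever follows. -/
theorem LStep.of_append {c : LCtx} {a : Stmt} {L k : List Stmt} {st : State SE} {n : ℕ}
    {sc : Set SE} {p : List (Lab SEvent × State SE)} {g : LCfg}
    (h : LStep c ⟨a :: L ++ k, st, n⟩ sc p g) :
    ∃ L', g.todo = L' ++ k ∧ LStep c ⟨a :: L, st, n⟩ sc p ⟨L', g.st, g.next⟩ := by
  simp only [List.cons_append] at h
  cases h
  case iteT h => exact ⟨_, (List.append_assoc _ _ _).symm, .iteT _ _ _ _ _ _ _ h⟩
  case iteF h => exact ⟨_, (List.append_assoc _ _ _).symm, .iteF _ _ _ _ _ _ _ h⟩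
  case whlT e s _ h => exact ⟨s.flat ++ .whl e s :: L, by simp, .whlT _ _ _ _ _ _ h⟩
  all_goals
    refine ⟨L, rfl, ?_⟩
    constructor
    try assumption

theorem LRun.eq_of_nil {c : LCtx} {g g' : LCfg} {sc : Set SE} {p : List (Lab SEvent × State SE)}
    (h : LRun c g sc p g') (hg : g.todo = []) : sc = ∅ ∧ p = [] ∧ g' = g := by
  cases h with
  | refl => exact ⟨rfl, rfl, rfl⟩
  | step _ _ _ _ _ _ _ hs => cases hs <;> simp at hg

theorem LStep.last {c : LCtx} {g g' : LCfg} {sc : Set SE} {p : List (Lab SEvent × State SE)}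
    (h : LStep c g sc p g') : Hist.last ⟨g.st, p⟩ = g'.st := by
  cases h <;> rfl

theorem Hist.last_append {α E : Type} (s : State α) (r r' : List (Lab E × State α)) :
    Hist.last ⟨s, r ++ r'⟩ = Hist.last ⟨Hist.last ⟨s, r⟩, r'⟩ := by
  induction r generalizing s with
  | nil => rfl
  | cons x r ih =>
    obtain ⟨l, s'⟩ := x
    rw [List.cons_append, Hist.last_cons, Hist.last_cons, ih]

theorem LRun.last {c : LCtx} {g g' : LCfg} {sc : Set SE} {p : List (Lab SEvent × State SE)}
    (h : LRun c g sc p g') : Hist.last ⟨g.st, p⟩ = g'.st := by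
  induction h with
  | refl g => rfl
  | step g sc₁ p₁ g₁ sc₂ p₂ g₂ hs _ ih => rw [Hist.last_append, hs.last, ih]

/-- The executions of `while (e) {s}; k`, as finitely many iterations of `s` followed by `k`. -/
inductive LLoop (c : LCtx) (e : Expr) (s : Stmt) (k : List Stmt) :
    State SE → ℕ → Set SE → List (Lab SEvent × State SE) → State SE → ℕ → Prop where
  | exit (st n a sc p st' n') : Expr.eval st (.un .not e) = some a →
      LRun c ⟨k, st, n⟩ sc p ⟨[], st', n'⟩ → LLoop c e s k st n ({a} ∪ sc) p st' n'
  | iter (st n a sc p st₁ n₁ sc' p' st' n') : Expr.eval st e = some a →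
      LRun c ⟨s.flat, st, n⟩ sc p ⟨[], st₁, n₁⟩ →
      LRun c ⟨.whl e s :: k, st₁, n₁⟩ sc' p' ⟨[], st', n'⟩ →
      LLoop c e s k st₁ n₁ sc' p' st' n' →
      LLoop c e s k st n ({a} ∪ (sc ∪ sc')) (p ++ p') st' n'

/-- The statements `M` that precede the loop make the induction go through: they are what remains
of an iteration that has begun. -/
theorem LRun.loop_aux {c : LCtx} {e : Expr} {s : Stmt} {k : List Stmt} {g g' : LCfg} {sc : Set SE}
    {p : List (Lab SEvent × State SE)} (h : LRun c g sc p g') (hg' : g'.todo = []) :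
    ∀ M, g.todo = M ++ .whl e s :: k →
    ∃ sc₁ p₁ st₁ n₁ sc₂ p₂, LRun c ⟨M, g.st, g.next⟩ sc₁ p₁ ⟨[], st₁, n₁⟩ ∧
      LRun c ⟨.whl e s :: k, st₁, n₁⟩ sc₂ p₂ g' ∧
      LLoop c e s k st₁ n₁ sc₂ p₂ g'.st g'.next ∧ sc = sc₁ ∪ sc₂ ∧ p = p₁ ++ p₂ := by
  induction h with
  | refl g =>
    intro M hM
    simp [hg'] at hM
  | step g sc₁ p₁ g₁ sc₂ p₂ g₂ hs hr ih =>
    intro M hM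
    obtain ⟨t, st, n⟩ := g
    obtain ⟨t₂, st₂, n₂⟩ := g₂
    cases hg'
    cases M with
    | nil =>
      cases hM
      refine ⟨∅, [], st, n, _, _, .refl _, .step _ _ _ _ _ _ _ hs hr, ?_, by simp, rfl⟩
      cases hs with
      | whlF _ _ _ _ _ a ha => exact .exit _ _ _ _ _ _ _ ha hr
      | whlT _ _ _ _ _ a ha =>
        obtain ⟨sc₃, p₃, st₃, n₃, sc₄, p₄, h₃, h₄, h₅, rfl, rfl⟩ := ih rfl s.flat rfl
        exact LLoop.iter _ _ _ _ p₃ _ _ _ _ _ _ ha h₃ h₄ h₅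
    | cons a M =>
      cases hM
      obtain ⟨M', hM', hs'⟩ := hs.of_append
      obtain ⟨sc₃, p₃, st₃, n₃, sc₄, p₄, h₃, h₄, h₅, rfl, rfl⟩ := ih rfl M' hM'
      exact ⟨_, _, st₃, n₃, sc₄, p₄, .step _ _ _ _ _ _ _ hs' h₃, h₄, h₅,
        (Set.union_assoc _ _ _).symm, (List.append_assoc _ _ _).symm⟩

/-- Every complete run of a loop and its continuation consists of finitely many iterations. -/
theorem LRun.loop {c : LCtx} {e : Expr} {s : Stmt} {k : List Stmt} {st st' : State SE} {n n' : ℕ}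
    {sc : Set SE} {p : List (Lab SEvent × State SE)}
    (h : LRun c ⟨.whl e s :: k, st, n⟩ sc p ⟨[], st', n'⟩) : LLoop c e s k st n sc p st' n' := by
  obtain ⟨sc₁, p₁, st₁, n₁, sc₂, p₂, h₁, -, h₂, rfl, rfl⟩ := h.loop_aux rfl [] rfl
  obtain ⟨rfl, rfl, h₃⟩ := h₁.eq_of_nil rfl
  cases h₃
  simpa using h₂

/-! ### Invariants of runs -/

theorem Stmt.noRet_flat : ∀ s : Stmt, s.NoRet → ∀ t ∈ s.flat, t.NoRet
  | .seq s s', h => by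
    intro t ht
    rcases List.mem_append.1 ht with ht | ht
    · exact noRet_flat s h.1 t ht
    · exact noRet_flat s' h.2 t ht
  | .asg _ _ _, h | .get _ _ _ _, h | .await _ _, h | .call _ _ _ _ _, h | .skip, h | .ret _, h
  | .whl _ _, h | .ite _ _ _, h => by
    intro t ht
    cases List.mem_singleton.1 ht
    exact h

theorem Stmt.assignsField_flat (f : Field) : ∀ s : Stmt, ¬ s.AssignsField f →
    ∀ t ∈ s.flat, ¬ t.AssignsField f
  | .seq s s', h => by
    intro t ht
    simp only [AssignsField, not_or] at h
    rcases List.mem_append.1 ht with ht | ht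
    · exact assignsField_flat f s h.1 t ht
    · exact assignsField_flat f s' h.2 t ht
  | .asg _ _ _, h | .get _ _ _ _, h | .await _ _, h | .call _ _ _ _ _, h | .skip, h | .ret _, h
  | .whl _ _, h | .ite _ _ _, h => by
    intro t ht
    cases List.mem_singleton.1 ht
    exact h

/-- A step leaves a reference unchanged that is not assigned; suspensions, which overwrite the
heap, spare references. -/
theorem LStep.ref_const {c : LCtx} {g g' : LCfg} {sc : Set SE} {p : List (Lab SEvent × State SE)}
    {f : Field} (h : LStep c g sc p g') (hf : c.isRef f) (hg : ∀ t ∈ g.todo, ¬ t.AssignsField f) :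
    g'.st.heap f = g.st.heap f ∧ ∀ t ∈ g'.todo, ¬ t.AssignsField f := by
  cases h <;> simp only [List.mem_cons, forall_eq_or_imp] at hg
  case asgField d f' e k st n a he =>
    refine ⟨?_, hg.2⟩
    have : f ≠ f' := fun h => hg.1 h.symm
    simp [State.setField, this]
  case iteT e s s' k st n a he =>
    refine ⟨rfl, fun t ht => ?_⟩
    have hh := hg.1
    simp only [Stmt.AssignsField, not_or] at hh
    rcases List.mem_append.1 ht with ht | ht
    · exact Stmt.assignsField_flat f s hh.1 t ht
    · exact hg.2 t ht
  case iteF e s s' k st n a he =>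
    refine ⟨rfl, fun t ht => ?_⟩
    have hh := hg.1
    simp only [Stmt.AssignsField, not_or] at hh
    rcases List.mem_append.1 ht with ht | ht
    · exact Stmt.assignsField_flat f s' hh.2 t ht
    · exact hg.2 t ht
  case whlT e s k st n a he =>
    refine ⟨rfl, fun t ht => ?_⟩
    rcases List.mem_append.1 ht with ht | ht
    · exact Stmt.assignsField_flat f s hg.1 t ht
    · rcases List.mem_cons.1 ht with rfl | ht
      · exact hg.1
      · exact hg.2 t ht
  all_goals
    refine ⟨?_, hg.2⟩
    first
    | rfl
    | simp [LCtx.freshHeap, hf]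

/-- References are never reassigned. -/
theorem LRun.ref_const {c : LCtx} {g g' : LCfg} {sc : Set SE} {p : List (Lab SEvent × State SE)}
    {f : Field} (h : LRun c g sc p g') (hf : c.isRef f) (hg : ∀ t ∈ g.todo, ¬ t.AssignsField f) :
    g'.st.heap f = g.st.heap f := by
  induction h with
  | refl g => rfl
  | step g sc₁ p₁ g₁ sc₂ p₂ g₂ hs _ ih =>
    obtain ⟨h₁, h₂⟩ := hs.ref_const hf hg
    rw [ih h₂, h₁]

/-- The list is empty or has a single `return`, as its very last part. -/
def RetLast (L : List Stmt) : Prop :=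
  L = [] ∨ ∃ l e, L = l ++ [Stmt.ret e] ∧ ∀ s ∈ l, Stmt.NoRet s

theorem RetLast.tail {t : Stmt} {k : List Stmt} (h : RetLast (t :: k)) : RetLast k := by
  rcases h with h | ⟨l, e, h, hl⟩
  · cases h
  · cases l with
    | nil => cases h; exact .inl rfl
    | cons a l =>
      cases h
      exact .inr ⟨l, e, rfl, fun s hs => hl s (by simp [hs])⟩

theorem RetLast.head {t : Stmt} {k : List Stmt} (h : RetLast (t :: k)) (ht : ∀ e, t ≠ .ret e) :
    t.NoRet := by
  rcases h with h | ⟨l, e, h, hl⟩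
  · cases h
  · cases l with
    | nil => cases h; exact absurd rfl (ht e)
    | cons a l =>
      cases h
      exact hl _ (by simp)

/-- Statements without `return` may be put in front of a list that has one at its end. -/
theorem RetLast.append {k M : List Stmt} (h : RetLast k) (hk : k ≠ [])
    (hM : ∀ s ∈ M, Stmt.NoRet s) :
    RetLast (M ++ k) := by
  rcases h with h | ⟨l, e, rfl, hl⟩
  · exact absurd h hk
  · refine .inr ⟨M ++ l, e, by simp, fun s hs => ?_⟩
    rcases List.mem_append.1 hs with hs | hs
    · exact hM s hs
    · exact hl s hs

theorem RetLast.tail_ne_nil {t : Stmt} {k : List Stmt} (h : RetLast (t :: k))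
    (ht : ∀ e, t ≠ .ret e) : k ≠ [] := by
  rintro rfl
  rcases h with h | ⟨l, e, h, hl⟩
  · cases h
  · cases l with
    | nil => cases h; exact ht e rfl
    | cons a l => simp at h

theorem LStep.retLast {c : LCtx} {g g' : LCfg} {sc : Set SE} {p : List (Lab SEvent × State SE)}
    (h : LStep c g sc p g') (hg : RetLast g.todo) : RetLast g'.todo := by
  cases h
  case iteT e s s' k st n a he =>
    exact hg.tail.append (hg.tail_ne_nil (by simp)) (Stmt.noRet_flat _ (hg.head (by simp)).1)
  case iteF e s s' k st n a he =>
    exact hg.tail.append (hg.tail_ne_nil (by simp)) (Stmt.noRet_flat _ (hg.head (by simp)).2)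
  case whlT e s k st n a he =>
    exact hg.append (by simp) (Stmt.noRet_flat s (hg.head (by simp)))
  all_goals exact hg.tail

theorem LRun.retLast {c : LCtx} {g g' : LCfg} {sc : Set SE} {p : List (Lab SEvent × State SE)}
    (h : LRun c g sc p g') (hg : RetLast g.todo) : RetLast g'.todo := by
  induction h with
  | refl g => exact hg
  | step g sc₁ p₁ g₁ sc₂ p₂ g₂ hs _ ih => exact ih (hs.retLast hg)

theorem LStep.noRet {c : LCtx} {g g' : LCfg} {sc : Set SE} {p : List (Lab SEvent × State SE)}
    (h : LStep c g sc p g') (hg : ∀ t ∈ g.todo, t.NoRet) :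
    (∀ x ∈ p, ∀ a b m e, x.1 ≠ .ev (.futEv a b m e)) ∧ ∀ t ∈ g'.todo, t.NoRet := by
  cases h <;> simp only [List.mem_cons, forall_eq_or_imp] at hg
  case ret => exact hg.1.elim
  case iteT e s s' k st n a he =>
    refine ⟨by simp, fun t ht => ?_⟩
    rcases List.mem_append.1 ht with ht | ht
    · exact Stmt.noRet_flat s hg.1.1 t ht
    · exact hg.2 t ht
  case iteF e s s' k st n a he =>
    refine ⟨by simp, fun t ht => ?_⟩
    rcases List.mem_append.1 ht with ht | ht
    · exact Stmt.noRet_flat s' hg.1.2 t ht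
    · exact hg.2 t ht
  case whlT e s k st n a he =>
    refine ⟨by simp, fun t ht => ?_⟩
    rcases List.mem_append.1 ht with ht | ht
    · exact Stmt.noRet_flat s hg.1 t ht
    · rcases List.mem_cons.1 ht with rfl | ht
      · exact hg.1
      · exact hg.2 t ht
  all_goals exact ⟨by simp, hg.2⟩

/-- Without `return`, no future is resolved. -/
theorem LRun.noRet {c : LCtx} {g g' : LCfg} {sc : Set SE} {p : List (Lab SEvent × State SE)}
    (h : LRun c g sc p g') (hg : ∀ t ∈ g.todo, t.NoRet) :
    ∀ x ∈ p, ∀ a b m e, x.1 ≠ .ev (.futEv a b m e) := by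
  induction h with
  | refl g => simp
  | step g sc₁ p₁ g₁ sc₂ p₂ g₂ hs _ ih =>
    obtain ⟨h₁, h₂⟩ := hs.noRet hg
    intro x hx
    rcases List.mem_append.1 hx with hx | hx
    · exact h₁ x hx
    · exact ih h₂ x hx

theorem LRun.no_invREv {c : LCtx} {g g' : LCfg} {sc : Set SE} {p : List (Lab SEvent × State SE)}
    (h : LRun c g sc p g') : ∀ x ∈ p, ∀ a b m as, x.1 ≠ .ev (.invREv a b m as) := by
  induction h with
  | refl g => simp
  | step g sc₁ p₁ g₁ sc₂ p₂ g₂ hs _ ih =>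
    intro x hx
    rcases List.mem_append.1 hx with hx | hx
    · cases hs <;> simp at hx <;> (try rcases hx with rfl | rfl | rfl) <;> simp
    · exact ih x hx

/-! ### Concretization -/

/-- Operators on semantic values are evaluated at once, both before and after a substitution; hence
substitution commutes with the application of an operator. -/
theorem SE.app_mkUn {χ : Concretizer} {op : UnOp} {a b c : SE} (h : SE.mkUn op a = some b)
    (h' : b.app χ = some c) : ∃ a', a.app χ = some a' ∧ SE.mkUn op a' = some c := by
  cases a
  case val v =>
    refine ⟨.val v, rfl, ?_⟩
    simp only [mkUn, Option.map_eq_some_iff] at h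
    obtain ⟨w, hw, rfl⟩ := h
    simpa [mkUn, hw, app] using h'
  all_goals
    simp only [mkUn, Option.some.injEq] at h
    subst h
    rw [app, Option.bind_eq_some_iff] at h'
    exact h'

theorem SE.app_mkBin {χ : Concretizer} {op : BinOp} {a₁ a₂ b c : SE}
    (h : SE.mkBin op a₁ a₂ = some b) (h' : b.app χ = some c) :
    ∃ a₁' a₂', a₁.app χ = some a₁' ∧ a₂.app χ = some a₂' ∧ SE.mkBin op a₁' a₂' = some c := by
  have key : b = .bin op a₁ a₂ →
      ∃ a₁' a₂', a₁.app χ = some a₁' ∧ a₂.app χ = some a₂' ∧ SE.mkBin op a₁' a₂' = some c := by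
    rintro rfl
    rw [app, Option.bind_eq_some_iff] at h'
    obtain ⟨a₁', h₁, h'⟩ := h'
    rw [Option.bind_eq_some_iff] at h'
    obtain ⟨a₂', h₂, h'⟩ := h'
    exact ⟨a₁', a₂', h₁, h₂, h'⟩
  cases a₁ <;> cases a₂
  case val.val v w =>
    refine ⟨.val v, .val w, rfl, rfl, ?_⟩
    simp only [mkBin, Option.map_eq_some_iff] at h
    obtain ⟨w, hw, rfl⟩ := h
    simpa [mkBin, hw, app] using h'
  all_goals
    simp only [mkBin, Option.some.injEq] at h
    exact key h.symm

/-- Symbolic evaluation followed by substitution yields the value in the concretized state. -/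
theorem Expr.eval_app {χ : Concretizer} (I : Interp) {st : State SE} {σ : State Val}
    (hσ : χ.AppState st σ.emb) : ∀ (e : Expr) {a b : SE}, e.eval st = some a →
      a.app χ = some b → b = .val (e.value I σ)
  | .var v, a, b, h, h' => by
    cases h
    exact Option.some.inj (h'.symm.trans (hσ.1 _))
  | .field f, a, b, h, h' => by
    cases h
    exact Option.some.inj (h'.symm.trans (hσ.2 _))
  | .lit n, a, b, h, h' => by cases h; cases h'; rfl
  | .never, a, b, h, h' => by cases h; cases h'; rfl
  | .nil, a, b, h, h' => by cases h; cases h'; rfl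
  | .tru, a, b, h, h' => by cases h; cases h'; rfl
  | .fls, a, b, h, h' => by cases h; cases h'; rfl
  | .un op e, a, b, h, h' => by
    simp only [eval, Option.bind_eq_some_iff] at h
    obtain ⟨a₀, h₀, h⟩ := h
    obtain ⟨b₀, h₁, h₂⟩ := SE.app_mkUn h h'
    cases eval_app I hσ e h₀ h₁
    simp only [SE.mkUn, Option.map_eq_some_iff] at h₂
    obtain ⟨w, hw, rfl⟩ := h₂
    have : (Expr.un op e).value I σ = I.un op (e.value I σ) := rfl
    rw [this, I.un_spec _ _ _ hw]
  | .bin op e e', a, b, h, h' => by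
    simp only [eval, Option.bind_eq_some_iff] at h
    obtain ⟨a₀, h₀, a₁, h₁, h⟩ := h
    obtain ⟨b₀, b₁, h₂, h₃, h₄⟩ := SE.app_mkBin h h'
    cases eval_app I hσ e h₀ h₂
    cases eval_app I hσ e' h₁ h₃
    simp only [SE.mkBin, Option.map_eq_some_iff] at h₄
    obtain ⟨w, hw, rfl⟩ := h₄
    have : (Expr.bin op e e').value I σ = I.bin op (e.value I σ) (e'.value I σ) := rfl
    rw [this, I.bin_spec _ _ _ _ hw]

/-- If the negation of `e` is true under a substitution, then `e` is false in the concretized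
state. -/
theorem Expr.value_of_not {χ : Concretizer} (I : Interp) {st : State SE} {σ : State Val}
    (hσ : χ.AppState st σ.emb) {e : Expr} {a : SE} (h : Expr.eval st (.un .not e) = some a)
    (h' : a.app χ = some (.val (.bool true))) : e.value I σ = .bool false := by
  simp only [eval, Option.bind_eq_some_iff] at h
  obtain ⟨a₀, h₀, h⟩ := h
  obtain ⟨b₀, h₁, h₂⟩ := SE.app_mkUn h h'
  cases eval_app I hσ e h₀ h₁
  simp only [SE.mkUn, Option.map_eq_some_iff] at h₂
  obtain ⟨w, hw, h₃⟩ := h₂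
  cases h₃
  generalize e.value I σ = v at hw
  cases v <;> simp [UnOp.eval] at hw
  rw [hw]

/-- The concretization of an assignment to a variable is an assignment to this variable. -/
theorem Concretizer.AppState.setVar {χ : Concretizer} {st : State SE} {σ τ : State Val} {v : Var}
    {a : SE} (h : χ.AppState st σ.emb) (h' : χ.AppState (st.setVar v a) τ.emb) :
    ∃ w, a.app χ = some (.val w) ∧ τ = σ.setVar v w := by
  refine ⟨τ.loc v, ?_, ?_⟩
  · simpa [State.setVar, State.emb] using h'.1 v
  · ext x
    · by_cases hx : x = v
      · subst hx
        simp [State.setVar]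
      · have h₁ := h.1 x
        have h₂ := h'.1 x
        simp only [State.setVar, State.emb, Function.update_of_ne hx] at h₁ h₂ ⊢
        rw [h₁] at h₂
        simpa using h₂.symm
    · have h₁ := h.2 x
      have h₂ := h'.2 x
      simp only [State.setVar, State.emb] at h₁ h₂ ⊢
      rw [h₁] at h₂
      simpa using h₂.symm

theorem Concretizer.AppState.setField {χ : Concretizer} {st : State SE} {σ τ : State Val}
    {f : Field} {a : SE} (h : χ.AppState st σ.emb) (h' : χ.AppState (st.setField f a) τ.emb) :
    ∃ w, a.app χ = some (.val w) ∧ τ = σ.setField f w := by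
  refine ⟨τ.heap f, ?_, ?_⟩
  · simpa [State.setField, State.emb] using h'.2 f
  · ext x
    · have h₁ := h.1 x
      have h₂ := h'.1 x
      simp only [State.setField, State.emb] at h₁ h₂ ⊢
      rw [h₁] at h₂
      simpa using h₂.symm
    · by_cases hx : x = f
      · subst hx
        simp [State.setField]
      · have h₁ := h.2 x
        have h₂ := h'.2 x
        simp only [State.setField, State.emb, Function.update_of_ne hx] at h₁ h₂ ⊢
        rw [h₁] at h₂
        simpa using h₂.symm

theorem forall₂_of_mapM {α γ : Type} {f : α → Option γ} : ∀ {l : List α} {l' : List γ},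
    l.mapM f = some l' → List.Forall₂ (fun a b => f a = some b) l l'
  | [], l', h => by
    simp only [List.mapM_nil, Option.pure_def, Option.some.injEq] at h
    subst h
    exact .nil
  | a :: l, l', h => by
    simp only [List.mapM_cons, Option.bind_eq_bind, Option.bind_eq_some_iff, Option.pure_def,
      Option.some.injEq] at h
    obtain ⟨b, hb, l'', h, rfl⟩ := h
    exact .cons hb (forall₂_of_mapM h)

/-- The embedding of a concrete event does not fail. -/
theorem Lab.emb_ev (c : CEvent) : ∃ e, c.mapM (fun v => some (SE.val v))
    (fun m => some (Sum.inl m)) some some = some e ∧ Lab.emb (.ev c) = .ev e := by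
  cases c <;> simp [Event.mapM, mapM_some, Lab.emb]

theorem Concretizer.AppLab.exists_ev {χ : Concretizer} {e : SEvent} {l : Lab CEvent}
    (h : χ.AppLab (.ev e) l.emb) : ∃ c, l = .ev c ∧
      e.mapM (SE.app χ) (fun m => some (χ.appMeth m)) some some =
        c.mapM (fun v => some (SE.val v)) (fun m => some (Sum.inl m)) some some := by
  cases l with
  | gap => exact h.elim
  | ev c =>
    obtain ⟨e', h₁, h₂⟩ := Lab.emb_ev c
    rw [h₂] at h
    exact ⟨c, rfl, h.trans h₁.symm⟩

theorem Concretizer.AppLab.noEv {χ : Concretizer} {l : Lab CEvent}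
    (h : χ.AppLab (.ev .noEv) l.emb) : l = .ev .noEv := by
  obtain ⟨c, rfl, hc⟩ := h.exists_ev
  cases c <;> simp [Event.mapM, mapM_some] at hc
  rfl

theorem Concretizer.AppLab.futEv {χ : Concretizer} {a b e : SE} {m : SMeth} {l : Lab CEvent}
    (h : χ.AppLab (.ev (.futEv a b m e)) l.emb) : ∃ x g m' w, l = .ev (.futEv x g m' w) ∧
      e.app χ = some (.val w) := by
  obtain ⟨c, rfl, hc⟩ := h.exists_ev
  cases c <;> simp [Event.mapM, mapM_some, Option.bind_eq_some_iff] at hc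
  exact ⟨_, _, _, _, rfl, hc.2.2.1⟩

theorem Concretizer.AppLab.futREv {χ : Concretizer} {a b e : SE} {m : SMeth} {i : ℕ}
    {l : Lab CEvent} (h : χ.AppLab (.ev (.futREv a b m e i)) l.emb) :
    ∃ x g m' w, l = .ev (.futREv x g m' w i) ∧ e.app χ = some (.val w) := by
  obtain ⟨c, rfl, hc⟩ := h.exists_ev
  cases c <;> simp [Event.mapM, mapM_some, Option.bind_eq_some_iff] at hc
  obtain ⟨-, -, he, -, rfl⟩ := hc
  exact ⟨_, _, _, _, rfl, he⟩

theorem Concretizer.AppLab.invEv {χ : Concretizer} {a b g : SE} {m : MName} {as : List SE}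
    {l : Lab CEvent} (h : χ.AppLab (.ev (.invEv a b g (.inl m) as)) l.emb) :
    ∃ x y g' vs, l = .ev (.invEv x y g' m vs) ∧ b.app χ = some (.val y) ∧
      List.Forall₂ (fun a v => a.app χ = some (.val v)) as vs := by
  obtain ⟨c, rfl, hc⟩ := h.exists_ev
  cases c <;> simp [Event.mapM, mapM_some, Option.bind_eq_some_iff] at hc
  obtain ⟨-, hb, -, has, hm⟩ := hc
  cases hm
  exact ⟨_, _, _, _, rfl, hb, by simpa only [List.forall₂_map_right_iff] using forall₂_of_mapM has⟩

/-! ### Objects and references in runs of a program -/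

/-- What every object of a reachable system satisfies: it is an object of the program, and the
processes that start with an invocation reaction are those of methods of its class. -/
def ObjInv (P : Program) (X : ℕ) (o : ObjSt) : Prop :=
  (∃ cr, P.objs[X]? = some cr ∧ cr.cls = o.cls) ∧
  ∀ f Θ, (o.pool f = some Θ ∨ o.active = some (f, Θ)) → ∀ θ ∈ Θ, ∀ x ∈ θ.hist.rest,
    ∀ a b m as, x.1 = .ev (.invREv a b m as) → ∃ m', m = .inl m' ∧ m'.cls = o.cls

theorem Concretizer.AppLab.of_invREv {χ : Concretizer} {l : Lab SEvent} {a b : SE} {m : SMeth}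
    {as : List SE} (h : χ.AppLab l (.ev (.invREv a b m as))) :
    ∃ a' b' m' as', l = .ev (.invREv a' b' m' as') ∧ χ.appMeth m' = m := by
  cases l with
  | gap => exact h.elim
  | ev e =>
    have h' : e.mapM (SE.app χ) (fun m => some (χ.appMeth m)) some some =
      some (.invREv a b m as) := h
    cases e <;> simp [Event.mapM, Option.bind_eq_some_iff] at h'
    exact ⟨_, _, _, _, rfl, h'.2.2.2⟩

theorem suffix_rest_subset (st : State SE) (r : List (Lab SEvent × State SE)) :
    ∀ x ∈ (suffix st r).rest, x ∈ r := by
  intro x hx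
  unfold suffix at hx
  split at hx
  · exact List.mem_cons_of_mem _ hx
  · exact hx

/-- The traces that continue after an execution step are substituted suffixes of former ones, hence
the method of an invocation reaction does not change. -/
theorem Selects.invREv {ρ : Field → Val} {v : Val} {m : MName} {θ θ' : STrace} {F : Cand}
    {χ : Concretizer} (h : Selects ρ v m θ F θ' χ) {C : ClassName}
    (hθ : ∀ x ∈ θ.hist.rest, ∀ a b m as, x.1 = .ev (.invREv a b m as) →
      ∃ m', m = .inl m' ∧ m'.cls = C) :
    ∀ x ∈ θ'.hist.rest, ∀ a b m as, x.1 = .ev (.invREv a b m as) →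
      ∃ m', m = .inl m' ∧ m'.cls = C := by
  obtain ⟨st, e, st', r, hr, -, -, -, -, -, -, happ⟩ := h
  intro x hx a b m as hxe
  obtain ⟨y, hy, hyx, -⟩ : ∃ y ∈ (suffix st' r).rest, χ.AppLab y.1 x.1 ∧ χ.AppState y.2 x.2 := by
    have := happ.2
    generalize (suffix st' r).rest = l at this
    generalize θ'.hist.rest = l' at this hx
    induction this with
    | nil => simp at hx
    | cons h₁ _ ih =>
      rcases List.mem_cons.1 hx with rfl | hx
      · exact ⟨_, by simp, h₁⟩
      · obtain ⟨y, hy, h⟩ := ih hx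
        exact ⟨y, by simp [hy], h⟩
  rw [hxe] at hyx
  obtain ⟨a', b', m', as', hy', hm'⟩ := hyx.of_invREv
  obtain ⟨m'', rfl, hm''⟩ := hθ y
    (by rw [hr]; exact List.mem_cons_of_mem _ (suffix_rest_subset _ _ _ hy))
    a' b' m' as' hy'
  exact ⟨m'', hm'.symm, hm''⟩

/-- Steps of an object replace a process by one with traces of the same method. -/
theorem OStep.objInv {P : Program} {X : ℕ} {o o' : ObjSt} {f : ℕ} {v : Val} {m : MName} {F : Cand}
    (h : OStep o f v m F o') (ho : ObjInv P X o) : ObjInv P X o' := by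
  have key : ∀ g (Θ Θ' : Set STrace), (o.pool g = some Θ ∨ o.active = some (g, Θ)) →
      Agrees o.hist.last.heap v m Θ F Θ' → ∀ θ ∈ Θ', ∀ x ∈ θ.hist.rest,
      ∀ a b m as, x.1 = .ev (.invREv a b m as) → ∃ m', m = .inl m' ∧ m'.cls = o.cls := by
    rintro g Θ Θ' hΘ ⟨-, -, rfl⟩ θ' ⟨-, θ, hθ, χ, hs⟩
    exact hs.invREv (ho.2 g Θ hΘ θ hθ)
  have hact : ∀ {f g : ℕ} {Θ Θ' : Set STrace}, mkActive f Θ' = some (g, Θ) → Θ = Θ' := by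
    intro f g Θ Θ' h
    unfold mkActive at h
    split at h
    · simp at h
    · simp only [Option.some.injEq, Prod.mk.injEq] at h
      exact h.2.symm
  refine ⟨by cases h <;> exact ho.1, ?_⟩
  cases h with
  | schedule Θ Θ' ha hp hag hn hh =>
    rintro g Θ₁ (hg | hg)
    · by_cases hgf : g = f
      · subst hgf
        simp at hg
      · exact ho.2 g Θ₁ (.inl (by simpa [hgf] using hg))
    · rw [hact hg]
      exact key f Θ Θ' (.inl hp) hag
  | step Θ Θ' ha hag hn hh =>
    rintro g Θ₁ (hg | hg)
    · exact ho.2 g Θ₁ (.inl hg)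
    · rw [hact hg]
      exact key f Θ Θ' (.inr ha) hag
  | deschedule Θ Θ' ha hag hn hh =>
    rintro g Θ₁ (hg | hg)
    · by_cases hgf : g = f
      · subst hgf
        simp only [Function.update_self, Option.some.injEq] at hg
        subst hg
        exact key g Θ Θ' (.inr ha) hag
      · exact ho.2 g Θ₁ (.inl (by simpa [hgf] using hg))
    · simp at hg

theorem Program.methSem_invREv {P : Program} {X f : ℕ} {m : MName} {args : List Val} {θ : STrace}
    (h : θ ∈ P.methSem X f m args) : ∀ x ∈ θ.hist.rest, ∀ a b n as,
      x.1 = .ev (.invREv a b n as) → n = .inl m := by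
  obtain ⟨d, hd, θ', ⟨st', n', hr, -⟩, rfl⟩ := h
  intro x hx a b n as hxe
  rcases List.mem_cons.1 hx with rfl | hx
  · simp only [Program.ctx, Lab.ev.injEq, Event.invREv.injEq] at hxe
    exact hxe.2.2.1.symm
  · exact absurd hxe (hr.no_invREv x hx a b n as)

/-- A call adds a process only to an object of the class of the called method. -/
theorem OAdd.objInv {P : Program} {Y g : ℕ} {m : MName} {args : List Val} {o o' : ObjSt}
    (h : OAdd P Y g m args o o') (ho : ObjInv P Y o) : ObjInv P Y o' := by
  obtain ⟨hc, -, rfl⟩ := h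
  refine ⟨ho.1, ?_⟩
  rintro f Θ (hf | hf)
  · by_cases hfg : f = g
    · subst hfg
      simp only [Function.update_self, Option.some.injEq] at hf
      subst hf
      intro θ hθ x hx a b n as hxe
      exact ⟨m, Program.methSem_invREv hθ x hx a b n as hxe, hc.symm⟩
    · exact ho.2 f Θ (.inl (by simpa [hfg] using hf))
  · exact ho.2 f Θ (.inr hf)

theorem SStep.objInv {P : Program} {S S' : Sys} {X f : ℕ} {v : Val} {m : MName} {F : Cand}
    (h : SStep P S X f v m F S') (hS : ∀ Y o, S.objs Y = some o → ObjInv P Y o) :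
    ∀ Y o, S'.objs Y = some o → ObjInv P Y o := by
  have key : ∀ {o o' : ObjSt}, S.objs X = some o → OStep o f v m F o' →
      ∀ Y p, Function.update S.objs X (some o') Y = some p → ObjInv P Y p := by
    intro o o' ho hs Y p hp
    by_cases hY : Y = X
    · subst hY
      simp only [Function.update_self, Option.some.injEq] at hp
      subst hp
      exact hs.objInv (hS _ _ ho)
    · exact hS Y p (by simpa [hY] using hp)
  cases h with
  | internal o o' ho hs => exact key ho hs
  | get o o' _ _ _ _ _ _ ho hs => exact key ho hs
  | invoc o o' x Y g n as p p' ho hs hF hfr hp hadd =>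
    intro Z q hq
    by_cases hZ : Z = Y
    · subst hZ
      simp only [Function.update_self, Option.some.injEq] at hq
      subst hq
      exact hadd.objInv (key ho hs _ _ hp)
    · exact key ho hs Z q (by simpa [hZ] using hq)

theorem Reach.objInv {P : Program} {S S' : Sys} (h : Reach P S S') :
    (∀ Y o, S.objs Y = some o → ObjInv P Y o) → ∀ Y o, S'.objs Y = some o → ObjInv P Y o := by
  induction h with
  | refl => exact id
  | step _ _ _ _ _ _ _ _ hs _ ih => exact fun h => ih (hs.objInv h)

theorem Program.IsInit.objInv {P : Program} {S : Sys} (h : P.IsInit S) :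
    ∀ Y o, S.objs Y = some o → ObjInv P Y o := by
  obtain ⟨T, d, as, -, -, -, hcls, -, -, hobjs⟩ := h
  intro Y o ho
  rw [hobjs] at ho
  simp only [Option.bind_eq_some_iff, Option.map_eq_some_iff] at ho
  obtain ⟨cr, hcr, c, hc, rfl⟩ := ho
  refine ⟨⟨cr, hcr, rfl⟩, ?_⟩
  rintro f Θ (hf | hf)
  · by_cases hY : Y = T ∧ f = 0
    · dsimp only at hf
      rw [if_pos hY] at hf
      obtain ⟨rfl, rfl⟩ := hY
      simp only [Option.some.injEq] at hf
      subst hf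
      intro θ hθ x hx a b n as hxe
      rw [hcr] at hcls
      exact ⟨_, Program.methSem_invREv hθ x hx a b n as hxe, (Option.some.inj hcls).symm⟩
    · simp [hY] at hf
  · simp at hf

/-- A method with a used trace belongs to the class of the object that executes it. -/
theorem Used.cls {P : Program} {X f : ℕ} {m : MName} {args : List Val} {θ : STrace}
    {χ : Concretizer} (h : Used P X f m args θ χ) :
    ∃ cr, P.objs[X]? = some cr ∧ cr.cls = m.cls := by
  obtain ⟨S₀, S, o, hinit, hreach, ho, hpool, hθ, -, -⟩ := h
  obtain ⟨⟨cr, hcr, hc⟩, hinv⟩ := hreach.objInv hinit.objInv X o ho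
  refine ⟨cr, hcr, hc.trans ?_⟩
  have hθ' := hθ
  obtain ⟨d, hd, θ', hθ'', rfl⟩ := hθ
  obtain ⟨m', hm', hc'⟩ := hinv f _ (.inl hpool) _ hθ' _ (List.mem_cons_self) _ _ _ _ rfl
  cases hm'
  exact hc'.symm

/-- References of a well-formed program denote objects. -/
theorem Program.WF.refVal {P : Program} (hP : P.WF) {X : ℕ} {cr : Creation} {f : Field}
    (hcr : P.objs[X]? = some cr) (hf : P.IsRef cr.cls f) :
    ∃ j, P.refVal X f = some (.obj j) ∧ j < P.objs.length := by
  obtain ⟨c, hc, r, hr, rfl⟩ := hf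
  obtain ⟨c', hc', hall⟩ := hP.main_typed cr (List.mem_of_getElem? hcr)
  cases Option.some.inj (hc.symm.trans hc')
  obtain ⟨k, hk⟩ : ∃ k, c.refs.findIdx? (fun r' => r'.2 == r.2) = some k := by
    cases h : c.refs.findIdx? (fun r' => r'.2 == r.2) with
    | some k => exact ⟨k, rfl⟩
    | none =>
      have := List.findIdx?_eq_none_iff.1 h r hr
      simp at this
  have hklt : k < c.refs.length := (List.findIdx?_eq_some_iff_getElem.1 hk).1
  have hka : k < cr.args.length := by rw [hall.length_eq]; exact hklt
  obtain ⟨j, cr', hj, hcr', -⟩ := hall.get hka hklt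
  refine ⟨j, ?_, ?_⟩
  · have hj' : P.objOf cr.args[k] = some j := hj
    simp [Program.refVal, hcr, hc, hk, List.getElem?_eq_getElem hka, hj']
  · exact (List.getElem?_eq_some_iff.1 hcr').1

/-! ### Segments of used traces -/

/-- `h` is the concretization of the states and events `p` of a trace that starts in `st`. -/
def Concretizer.Conc (χ : Concretizer) (st : State SE) (p : List (Lab SEvent × State SE))
    (h : CHist) : Prop :=
  χ.AppState st h.first.emb ∧
    List.Forall₂ (fun a b => χ.AppLab a.1 b.1.emb ∧ χ.AppState a.2 b.2.emb) p h.rest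

theorem Concretizer.appHist_emb {χ : Concretizer} {st : State SE}
    {p : List (Lab SEvent × State SE)} {h : CHist} :
    χ.AppHist ⟨st, p⟩ h.emb ↔ χ.Conc st p h := by
  simp only [AppHist, Conc, Hist.emb, List.forall₂_map_right_iff]

/-- The last state of the symbolic part is concretized by the last state of the history. -/
theorem Concretizer.Conc.last {χ : Concretizer} {st : State SE}
    {p : List (Lab SEvent × State SE)} {h : CHist} (hc : χ.Conc st p h) :
    χ.AppState (Hist.last ⟨st, p⟩) h.last.emb := by
  obtain ⟨s, r⟩ := h
  induction p generalizing st s r with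
  | nil =>
    obtain ⟨h₁, h₂⟩ := hc
    cases h₂
    exact h₁
  | cons x p ih =>
    obtain ⟨h₁, h₂⟩ := hc
    cases h₂ with
    | @cons a b l₁ l₂ h₃ h₄ =>
      obtain ⟨l, st'⟩ := x
      obtain ⟨l', s'⟩ := b
      rw [Hist.last_cons, Hist.last_cons]
      exact ih _ _ ⟨h₃.2, h₄⟩

theorem Concretizer.Conc.split {χ : Concretizer} {st : State SE}
    {p q : List (Lab SEvent × State SE)} {h : CHist} (hc : χ.Conc st (p ++ q) h) :
    ∃ r₁ r₂, h.rest = r₁ ++ r₂ ∧ χ.Conc st p ⟨h.first, r₁⟩ ∧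
      χ.Conc (Hist.last ⟨st, p⟩) q ⟨Hist.last ⟨h.first, r₁⟩, r₂⟩ := by
  refine ⟨h.rest.take p.length, h.rest.drop p.length, (List.take_append_drop _ _).symm, ?_⟩
  have h₁ : χ.Conc st p ⟨h.first, h.rest.take p.length⟩ :=
    ⟨hc.1, by simpa using List.forall₂_take p.length hc.2⟩
  exact ⟨h₁, h₁.last, by simpa using List.forall₂_drop p.length hc.2⟩

/-- A used trace of the method `m`, together with the run-time data that `selected` quantifies
over. -/
structure Exec (P : Program) (X f : Option ℕ) (m : MName) where
  obj : ℕ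
  fut : ℕ
  decl : Method
  args : List Val
  sc : Set SE
  path : List (Lab SEvent × State SE)
  conc : Concretizer
  obj_eq : X = none ∨ X = some obj
  fut_eq : f = none ∨ f = some fut
  decl_eq : P.meth? m = some decl
  used : Used P obj fut m args (methTrace (P.ctx obj fut m) (args.map .val)
    ⟨sc, ⟨P.startState obj decl args, path⟩⟩) conc

section Execution

variable {P : Program} {X f : Option ℕ} {m : MName}

/-- Name, future and references for which the execution evaluates statements. -/
def Exec.ctx (D : Exec P X f m) : LCtx := P.ctx D.obj D.fut m

/-- The execution passes from `g` to `g'` by the part `p` of its trace, with the conditions `sc`. -/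
def Exec.Run (D : Exec P X f m) (g : LCfg) (sc : Set SE) (p : List (Lab SEvent × State SE))
    (g' : LCfg) : Prop :=
  ∃ sc₁ p₁ sc₃ p₃ st₃ n₃,
    LRun D.ctx ⟨D.decl.body.flat, P.startState D.obj D.decl D.args, 1⟩ sc₁ p₁ g ∧
    LRun D.ctx g sc p g' ∧ LRun D.ctx g' sc₃ p₃ ⟨[], st₃, n₃⟩ ∧
    D.sc = sc₁ ∪ sc ∪ sc₃ ∧ D.path = p₁ ++ p ++ p₃

theorem Exec.Run.split {D : Exec P X f m} {g g' g'' : LCfg} {sc sc' : Set SE}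
    {p p' : List (Lab SEvent × State SE)} (h : D.Run g (sc ∪ sc') (p ++ p') g'')
    (h₁ : LRun D.ctx g sc p g') (h₂ : LRun D.ctx g' sc' p' g'') :
    D.Run g sc p g' ∧ D.Run g' sc' p' g'' := by
  obtain ⟨sc₁, p₁, sc₃, p₃, st₃, n₃, hs, -, he, hsc, hp⟩ := h
  refine ⟨⟨sc₁, p₁, _, _, st₃, n₃, hs, h₁, h₂.trans he, ?_, ?_⟩,
    ⟨_, _, sc₃, p₃, st₃, n₃, hs.trans h₁, h₂, he, ?_, ?_⟩⟩
  · rw [hsc]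
    simp only [Set.union_assoc]
  · rw [hp]
    simp only [List.append_assoc]
  · rw [hsc]
    simp only [Set.union_assoc]
  · rw [hp]
    simp only [List.append_assoc]

/-- The conditions that are collected by a part of a used trace are true in the run. -/
theorem Exec.Run.selectable {D : Exec P X f m} {g g' : LCfg} {sc : Set SE}
    {p : List (Lab SEvent × State SE)} (h : D.Run g sc p g') {a : SE} (ha : a ∈ sc) :
    a.app D.conc = some (.val (.bool true)) := by
  obtain ⟨sc₁, p₁, sc₃, p₃, st₃, n₃, -, -, -, hsc, -⟩ := h
  obtain ⟨-, -, -, -, -, -, -, -, -, hsel⟩ := D.used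
  exact hsel a (by simp [methTrace, hsc, ha])

theorem Exec.Run.retLast {D : Exec P X f m} (hP : P.WF) {g g' : LCfg} {sc : Set SE}
    {p : List (Lab SEvent × State SE)} (h : D.Run g sc p g') : RetLast g.todo := by
  obtain ⟨sc₁, p₁, sc₃, p₃, st₃, n₃, hs, -, -, -, -⟩ := h
  exact hs.retLast (.inr (hP.ret_last m D.decl D.decl_eq))

/-- During an execution, the references of the class hold objects, and always the same ones. -/
theorem Exec.exists_ref (D : Exec P X f m) (hP : P.WF) {r : Field} (hr : P.IsRef m.cls r) :
    ∃ j < P.objs.length, ∀ g sc p g', D.Run g sc p g' → g.st.heap r = .val (.obj j) := by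
  obtain ⟨cr, hcr, hc⟩ := D.used.cls
  obtain ⟨j, hj, hlt⟩ := hP.refVal hcr (hc ▸ hr)
  refine ⟨j, hlt, ?_⟩
  rintro g sc p g' ⟨sc₁, p₁, sc₃, p₃, st₃, n₃, hs, -, -, -, -⟩
  rw [hs.ref_const hr (Stmt.assignsField_flat r _ (hP.refs_const m D.decl r D.decl_eq hr))]
  simp [Program.startState, hj]

/-- The history `h` is the concretization of the part of the execution that is generated by the
statements `L`, which are followed by `k`. -/
def Exec.Seg (D : Exec P X f m) (L k : List Stmt) (st : State SE) (n : ℕ) (h : CHist)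
    (st' : State SE) (n' : ℕ) : Prop :=
  ∃ sc p, D.Run ⟨L ++ k, st, n⟩ sc p ⟨k, st', n'⟩ ∧ LRun D.ctx ⟨L, st, n⟩ sc p ⟨[], st', n'⟩ ∧
    D.conc.Conc st p h

/-- Selected traces are the segments of executions. -/
theorem mem_selected {s : Stmt} {σ : State Val} {h : CHist} : h ∈ selected P X f m s σ ↔
    ∃ (D : Exec P X f m) (k : List Stmt) (st : State SE) (n : ℕ) (st' : State SE) (n' : ℕ),
      D.Seg s.flat k st n h st' n' ∧ h.first = σ := by
  constructor
  · rintro ⟨X₀, f₀, d, args, k, sc₁, sc₂, sc₃, p₁, p₂, p₃, st₁, st₂, st₃, n₁, n₂, n₃, χ, hX, hf, hd,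
      hs, hm, he, hu, happ, hh⟩
    exact ⟨⟨X₀, f₀, d, args, _, _, χ, hX, hf, hd, hu⟩, k, st₁, n₁, st₂, n₂,
      ⟨sc₂, p₂, ⟨sc₁, p₁, sc₃, p₃, st₃, n₃, hs, hm.append k, he, rfl, rfl⟩, hm,
        Concretizer.appHist_emb.1 happ⟩, hh⟩
  · rintro ⟨⟨X₀, f₀, d, args, sc, p, χ, hX, hf, hd, hu⟩, k, st₁, n₁, st₂, n₂, ⟨sc₂, p₂,
      ⟨sc₁, p₁, sc₃, p₃, st₃, n₃, hs, -, he, hsc, hp⟩, hm, hc⟩, hh⟩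
    dsimp only at hsc hp
    subst hsc hp
    exact ⟨X₀, f₀, d, args, k, sc₁, sc₂, sc₃, p₁, p₂, p₃, st₁, st₂, st₃, n₁, n₂, n₃, χ, hX, hf, hd,
      hs, hm, he, hu, Concretizer.appHist_emb.2 hc, hh⟩

namespace Exec.Seg

variable {D : Exec P X f m} {L L₁ L₂ k : List Stmt} {st st' : State SE} {n n' : ℕ} {h : CHist}

theorem appState (hs : D.Seg L k st n h st' n') : D.conc.AppState st h.first.emb := by
  obtain ⟨sc, p, -, -, hc⟩ := hs
  exact hc.1

/-- In a segment, references hold objects of the program. -/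
theorem ref_mem (hs : D.Seg L k st n h st' n') (hP : P.WF) {r : Field} (hr : P.IsRef m.cls r) :
    VSort.obj.Mem P (h.first.heap r) := by
  obtain ⟨j, hlt, hj⟩ := D.exists_ref hP hr
  obtain ⟨sc, p, hrun, -, hc⟩ := hs
  have := hc.1.2 r
  rw [hj _ _ _ _ hrun] at this
  simp only [SE.app, State.emb, Option.some.injEq, SE.val.injEq] at this
  exact ⟨j, this.symm, hlt⟩

/-- The references hold the same objects in all segments of an execution. -/
theorem ref_eq (hs : D.Seg L k st n h st' n') (hP : P.WF) {r : Field} (hr : P.IsRef m.cls r)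
    {L' k' : List Stmt} {st₁ st₁' : State SE} {n₁ n₁' : ℕ} {h' : CHist}
    (hs' : D.Seg L' k' st₁ n₁ h' st₁' n₁') : h'.first.heap r = h.first.heap r := by
  obtain ⟨j, hlt, hj⟩ := D.exists_ref hP hr
  obtain ⟨sc, p, hrun, -, hc⟩ := hs
  obtain ⟨sc', p', hrun', -, hc'⟩ := hs'
  have h₁ := hc.1.2 r
  have h₂ := hc'.1.2 r
  rw [hj _ _ _ _ hrun] at h₁
  rw [hj _ _ _ _ hrun'] at h₂
  rw [h₁] at h₂
  simpa [State.emb] using h₂.symm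

/-- The first step of a segment. -/
theorem step {a : Stmt} (hs : D.Seg (a :: L) k st n h st' n') :
    ∃ sc p L' st₁ n₁ r₁ r₂, LStep D.ctx ⟨a :: L, st, n⟩ sc p ⟨L', st₁, n₁⟩ ∧
      (∀ b ∈ sc, b.app D.conc = some (.val (.bool true))) ∧ h = ⟨h.first, r₁ ++ r₂⟩ ∧
      D.conc.Conc st p ⟨h.first, r₁⟩ ∧ D.Seg L' k st₁ n₁ ⟨Hist.last ⟨h.first, r₁⟩, r₂⟩ st' n' := by
  obtain ⟨sc, p, hrun, hl, hc⟩ := hs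
  cases hl with
  | step _ sc₁ p₁ g₁ sc₂ p₂ _ h₁ h₂ =>
    obtain ⟨L', st₁, n₁⟩ := g₁
    obtain ⟨r₁, r₂, hr, hc₁, hc₂⟩ := hc.split
    obtain ⟨hr₁, hr₂⟩ := hrun.split (h₁.append k).run (h₂.append k)
    refine ⟨sc₁, p₁, L', st₁, n₁, r₁, r₂, h₁, fun b hb => hr₁.selectable hb, ?_, hc₁, sc₂, p₂, hr₂,
      h₂, ?_⟩
    · rw [← hr]
    · rwa [h₁.last] at hc₂

theorem nil (hs : D.Seg [] k st n h st' n') : h = ⟨h.first, []⟩ := by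
  obtain ⟨sc, p, -, hl, hc⟩ := hs
  obtain ⟨-, rfl, -⟩ := hl.eq_of_nil rfl
  obtain ⟨s, r⟩ := h
  have := hc.2
  cases this
  rfl

end Exec.Seg

end Execution

/-! ### Composing the meaning of method types along segments -/

section Compose

variable {P : Program} {I : Interp} {R : ℕ} {ρ : Fin R → Val} {β : Asg UVar} {L : MType R}

theorem Hist.length_elems_append {α E : Type} (s : State α) (r r' : List (Lab E × State α)) :
    ((Hist.elems ⟨s, r ++ r'⟩).length : ℤ) =
      (Hist.elems ⟨Hist.last ⟨s, r⟩, r'⟩).length + 2 * r.length := by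
  rw [Hist.length_elems, Hist.length_elems]
  simp only [List.length_append]
  push_cast
  omega

theorem MType.Holds.append_left {s : State Val} {r r' : List (Lab CEvent × State Val)} {lo hi : ℤ}
    (hlo : 1 ≤ lo) (hhi : hi ≤ (Hist.elems ⟨s, r⟩).length)
    (H : L.Holds P I ⟨s, r⟩ ρ β lo hi) : L.Holds P I ⟨s, r ++ r'⟩ ρ β lo hi := by
  have := Holds.shift (θ' := ⟨s, r ++ r'⟩) (c := 0)
    (fun i _ h₂ => by rw [add_zero]; exact Hist.at_append_left s r r' i h₂) L lo hi hlo hhi H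
  simpa using this

theorem MType.Holds.append_right {s : State Val} {r r' : List (Lab CEvent × State Val)} {lo hi : ℤ}
    (hlo : 1 ≤ lo) (hhi : hi ≤ (Hist.elems ⟨Hist.last ⟨s, r⟩, r'⟩).length)
    (H : L.Holds P I ⟨Hist.last ⟨s, r⟩, r'⟩ ρ β lo hi) :
    L.Holds P I ⟨s, r ++ r'⟩ ρ β (lo + 2 * r.length) (hi + 2 * r.length) :=
  Holds.shift (fun i h₁ _ => Hist.at_append_right s r r' i h₁) L lo hi hlo hhi H

theorem MType.Iterates.append_right {s : State Val} {r r' : List (Lab CEvent × State Val)}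
    {lo hi : ℤ} (hlo : 1 ≤ lo) (hhi : hi ≤ (Hist.elems ⟨Hist.last ⟨s, r⟩, r'⟩).length)
    (H : Iterates P I ⟨Hist.last ⟨s, r⟩, r'⟩ ρ β L lo hi) :
    Iterates P I ⟨s, r ++ r'⟩ ρ β L (lo + 2 * r.length) (hi + 2 * r.length) :=
  Iterates.shift (fun i h₁ _ => Hist.at_append_right s r r' i h₁) hlo hhi H

/-- The meaning of a type in a whole history is its meaning from position `3` on, after one more
step. -/
theorem MType.Holds.cons {s s' : State Val} {l : Lab CEvent} {r : List (Lab CEvent × State Val)}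
    (H : L.Holds P I ⟨s', r⟩ ρ β 1 (Hist.elems ⟨s', r⟩).length) :
    L.Holds P I ⟨s, (l, s') :: r⟩ ρ β 3 (Hist.elems ⟨s, (l, s') :: r⟩).length := by
  have h₁ := MType.Holds.append_right (s := s) (r := [(l, s')]) le_rfl le_rfl H
  have h₂ := Hist.length_elems_append s [(l, s')] r
  rw [← h₂] at h₁
  exact h₁

theorem Hist.three_le_length (s s' : State Val) (l : Lab CEvent)
    (r : List (Lab CEvent × State Val)) :
    (3 : ℤ) ≤ (Hist.elems ⟨s, (l, s') :: r⟩).length := by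
  rw [Hist.length_elems]
  simp only [List.length_cons]
  push_cast
  omega

end Compose

/-! ### The auxiliary modalities -/

/-- The second position of the trace is a read from a future of one of the given methods. -/
theorem sat_p2Spec {P : Program} {I : Interp} {θ : CHist} {β : MAsg} {ms : List MName}
    (h : (p2Spec.α ms).Sat P I θ β) : ∃ x g m w i,
      θ.at 2 = some (.lab (.ev (.futREv x g m w i))) ∧ m ∈ ms := by
  rw [MForm.sat_iff_satW] at h
  simp only [p2Spec, MForm.satW_ex, MForm.satW_and, MForm.satW_isLab_futREv, MForm.satW_meth_mem,
    MTm.eval, MAsg.fo_set] at h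
  obtain ⟨a, -, b, -, m, -, w, -, i, -, h, hm⟩ := h
  refine ⟨_, _, _, _, _, h, ?_⟩
  exact hm

/-- A postcondition holds in the last state, if no future is resolved. -/
theorem sat_pstSpec {P : Program} {I : Interp} {θ : CHist} {β : Asg UVar} {D : DType}
    {φ : FForm UVar} (h : ((pstSpec D).α φ).Sat P I θ β.toM)
    (hθ : ∀ x ∈ θ.rest, ∀ a b m e, x.1 ≠ .ev (.futEv a b m e)) : φ.Sat P I θ.last β := by
  rw [MForm.sat_iff_satW] at h
  simp only [pstSpec, MForm.satW_ex, MForm.satW_and, MForm.satW_all, MSort.MemW, Set.mem_Icc] at h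
  obtain ⟨l, ⟨hl₁, hl₂⟩, hl, h⟩ := h
  have hlen : l = θ.elems.length := by
    refine le_antisymm hl₂ ?_
    have := hl (θ.elems.length : ℤ) ⟨θ.one_le_length, le_rfl⟩
    simpa [MForm.satW_le, MTm.eval, MAsg.fo_set, Asg.set_same_kind] using this
  subst hlen
  split at h
  · simp only [MForm.exVals, List.foldr, MForm.satW_ex, MForm.satW_and, MForm.satW_isLab_futEv,
      MTm.eval] at h
    obtain ⟨a, -, b, -, c, -, m, -, h, -⟩ := h
    obtain ⟨s, hs⟩ := Hist.mem_of_at_lab h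
    exact absurd rfl (hθ _ hs _ _ _ _)
  · rw [MForm.satW_isState_lift] at h
    obtain ⟨st, hst, h⟩ := h
    simp only [MTm.eval, MAsg.fo_set, Asg.set_self, Asg.user_set_aux, Asg.user_toM] at hst h
    have := (Hist.at_length θ).symm.trans hst
    simp only [Option.some.injEq, Elem.st.injEq] at this
    rwa [this]

/-- Concretization preserves the kind of an event. -/
theorem Concretizer.Conc.noFutEv {χ : Concretizer} {st : State SE}
    {p : List (Lab SEvent × State SE)} {h : CHist} (hc : χ.Conc st p h)
    (hp : ∀ x ∈ p, ∀ a b m e, x.1 ≠ .ev (.futEv a b m e)) :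
    ∀ x ∈ h.rest, ∀ a b m e, x.1 ≠ .ev (.futEv a b m e) := by
  obtain ⟨-, hc⟩ := hc
  generalize h.rest = r at hc
  induction hc with
  | nil => simp
  | @cons y z p r hyz _ ih =>
    intro x hx a b m e hxe
    rcases List.mem_cons.1 hx with rfl | hx
    · refine absurd hyz.1 ?_
      rw [hxe]
      intro hlab
      have hy := hp y (by simp)
      generalize y.1 = l at hlab hy
      cases l with
      | gap => exact hlab.elim
      | ev e' =>
        obtain ⟨c, hc, he⟩ := hlab.exists_ev
        cases hc
        cases e' with
        | futEv => exact hy _ _ _ _ rfl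
        | _ => simp [Event.mapM, Option.bind_eq_some_iff] at he
    · exact ih (fun y hy => hp y (by simp [hy])) x hx a b m e hxe

/-! ### Validity of sequents -/

section Valid

variable {E : Env} {Γ Δ : Set BForm} {U : Upd} {φ ψ χ : BForm}

theorem Sequent.valid_insert_upd : Sequent.Valid E ⟨Γ, insert (.upd U φ) Δ⟩ ↔
    ∀ st β, (∀ γ ∈ Γ, γ.Sat E st β) →
      φ.Sat E (U.eval E.int β st st) β ∨ ∃ δ ∈ Δ, δ.Sat E st β := by
  simp only [Sequent.Valid, Set.mem_insert_iff, exists_eq_or_imp, BForm.Sat]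

theorem Sequent.valid_singleton : Sequent.Valid E ⟨Γ, {φ}⟩ ↔
    ∀ st β, (∀ γ ∈ Γ, γ.Sat E st β) → φ.Sat E st β := by
  simp only [Sequent.Valid, Set.mem_singleton_iff, exists_eq_left]

theorem Sequent.Valid.upd_mono (h : Sequent.Valid E ⟨Γ, insert (.upd U φ) Δ⟩)
    (hφ : ∀ σ β, φ.Sat E σ β → ψ.Sat E σ β) : Sequent.Valid E ⟨Γ, insert (.upd U ψ) Δ⟩ := by
  rw [Sequent.valid_insert_upd] at h ⊢
  exact fun st β hΓ => (h st β hΓ).imp (hφ _ _) id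

theorem Sequent.Valid.upd_mono₂ (h : Sequent.Valid E ⟨Γ, insert (.upd U φ) Δ⟩)
    (h' : Sequent.Valid E ⟨Γ, insert (.upd U ψ) Δ⟩)
    (hφ : ∀ σ β, φ.Sat E σ β → ψ.Sat E σ β → χ.Sat E σ β) :
    Sequent.Valid E ⟨Γ, insert (.upd U χ) Δ⟩ := by
  rw [Sequent.valid_insert_upd] at h h' ⊢
  intro st β hΓ
  rcases h st β hΓ with h₁ | h₁
  · rcases h' st β hΓ with h₂ | h₂
    · exact .inl (hφ _ _ h₁ h₂)
    · exact .inr h₂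
  · exact .inr h₁

/-- A fresh variable is universally quantified. -/
theorem Sequent.Valid.upd_fresh {x : UVar} (hΓ : ∀ γ ∈ Γ, ¬ γ.Occ x) (hΔ : ∀ δ ∈ Δ, ¬ δ.Occ x)
    (hU : ¬ U.Occ x) (h : Sequent.Valid E ⟨Γ, insert (.upd U φ) Δ⟩) (st : State Val)
    (β : Asg UVar) (hst : ∀ γ ∈ Γ, γ.Sat E st β) :
    (∀ w : Val, φ.Sat E (U.eval E.int β st st) (β.set .val x w)) ∨ ∃ δ ∈ Δ, δ.Sat E st β := by
  rw [Sequent.valid_insert_upd] at h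
  by_cases hδ : ∃ δ ∈ Δ, δ.Sat E st β
  · exact .inr hδ
  · refine .inl fun w => ?_
    have hoff := Asg.eqOff_set x β .val w
    have := h st (β.set .val x w) fun γ hγ =>
      (BForm.sat_congr E γ st hoff (hΓ γ hγ)).2 (hst γ hγ)
    rcases this with h | ⟨δ, hδ', h⟩
    · rwa [Upd.eval_congr E.int hoff U st st hU] at h
    · exact absurd ⟨δ, hδ', (BForm.sat_congr E δ st hoff (hΔ δ hδ')).1 h⟩ hδ

end Valid

theorem BForm.sat_upd_asgE {E : Env} {v : Var} {e : Expr} {φ : BForm} {σ : State Val}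
    {β : Asg UVar} : (BForm.upd (.asgE v e) φ).Sat E σ β ↔
      φ.Sat E (σ.setVar v (e.value E.int σ)) β := by
  simp only [BForm.Sat, Upd.eval, FTm.eval_toB, Expr.eval_toTm]

theorem BForm.sat_upd_lvar {E : Env} {v : Var} {x : UVar} {φ : BForm} {σ : State Val}
    {β : Asg UVar} : (BForm.upd (.asg v (.lvar x)) φ).Sat E σ β ↔
      φ.Sat E (σ.setVar v (β .val x)) β := by
  simp only [BForm.Sat, Upd.eval, BTm.eval]

theorem BForm.sat_imp {E : Env} {φ ψ : BForm} {σ : State Val} {β : Asg UVar} :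
    (BForm.imp φ ψ).Sat E σ β ↔ (φ.Sat E σ β → ψ.Sat E σ β) := by
  simp only [BForm.imp, BForm.Sat, imp_iff_not_or]

theorem BForm.sat_not {E : Env} {φ : BForm} {σ : State Val} {β : Asg UVar} :
    (BForm.not φ).Sat E σ β ↔ ¬ φ.Sat E σ β := by
  simp only [BForm.Sat]

theorem Concretizer.Conc.single {χ : Concretizer} {st st' : State SE} {l : Lab SEvent}
    {s : State Val} {r : List (Lab CEvent × State Val)} (h : χ.Conc st [(l, st')] ⟨s, r⟩) :
    ∃ l' s', r = [(l', s')] ∧ χ.AppLab l l'.emb ∧ χ.AppState st' s'.emb := by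
  have h := h.2
  cases h with
  | cons h₁ h₂ =>
    cases h₂
    exact ⟨_, _, rfl, h₁⟩

theorem Concretizer.Conc.nil {χ : Concretizer} {st : State SE}
    {s : State Val} {r : List (Lab CEvent × State Val)} (h : χ.Conc st [] ⟨s, r⟩) : r = [] := by
  have h := h.2
  cases h
  rfl

theorem Expr.map_eval_app {χ : Concretizer} (I : Interp) {st : State SE} {σ : State Val}
    (hσ : χ.AppState st σ.emb) {es : List Expr} {as : List SE} {vs : List Val}
    (h : List.Forall₂ (fun e a => e.eval st = some a) es as)
    (h' : List.Forall₂ (fun a v => a.app χ = some (.val v)) as vs) :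
    vs = es.map (Expr.value I σ) := by
  induction h generalizing vs with
  | nil => cases h'; rfl
  | cons h₁ _ ih =>
    cases h' with
    | cons h₂ h₃ =>
      cases Expr.eval_app I hσ _ h₁ h₂
      rw [ih h₃, List.map_cons]

/-! ### Types of composed statements -/

section Rules

variable {P : Program} {I : Interp} {X f : Option ℕ} {m : MName} {R : ℕ} {role : Fin R → Field}

/-- The modality for method types, in terms of segments of executions. The roles cause no
obligation, since references of a well-formed program always hold objects. -/
theorem sat_met (hP : P.WF) (hr : ∀ d, P.meth? m = some d → ∀ r, P.IsRef m.cls (role r))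
    {s : Stmt} {L : MType R} {σ : State Val} {β : Asg UVar} :
    (met role s L).Sat ⟨P, I, X, f, m⟩ σ β ↔
      ∀ (D : Exec P X f m) k st n h st' n', D.Seg s.flat k st n h st' n' → h.first = σ →
        L.Holds P I h (fun r => σ.heap (role r)) β 1 h.elems.length := by
  simp only [BForm.Sat]
  constructor
  · intro h D k st n θ st' n' hs hθ
    have := h θ (mem_selected.2 ⟨D, k, st, n, st', n', hs, hθ⟩)
    rw [sat_metSpec] at this
    subst hθ
    exact this.2
  · intro h θ hθ
    obtain ⟨D, k, st, n, st', n', hs, rfl⟩ := mem_selected.1 hθ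
    rw [sat_metSpec]
    exact ⟨fun r => hs.ref_mem hP (hr _ D.decl_eq r), h D k st n θ st' n' hs rfl⟩

/-- A step that is labelled with `noEv` may precede every method type. -/
theorem holds_noEv_cons {L : MType R} {ρ : Fin R → Val} {β : Asg UVar} {s s' : State Val}
    {r : List (Lab CEvent × State Val)}
    (H : L.Holds P I ⟨s', r⟩ ρ β 1 (Hist.elems ⟨s', r⟩).length) :
    L.Holds P I ⟨s, (.ev .noEv, s') :: r⟩ ρ β 1
      (Hist.elems ⟨s, (.ev .noEv, s') :: r⟩).length := by
  refine H.cons.extend_left L 3 _ (by omega) (Hist.three_le_length _ _ _ _) fun k h₁ h₂ => ?_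
  obtain rfl | rfl : k = 1 ∨ k = 2 := by omega
  · exact Hist.not_vis_of_state (Hist.at_one _)
  · rintro ⟨l, hl, hne⟩
    rw [Hist.at_two] at hl
    cases hl
    exact hne rfl

variable (hP : P.WF) (hr : ∀ d, P.meth? m = some d → ∀ r, P.IsRef m.cls (role r))
include hP hr

theorem sat_met_asgVar {d : Option DType} {v : ℕ} {e : Expr} {s : Stmt} {L : MType R}
    {σ : State Val} {β : Asg UVar}
    (h : (met role s L).Sat ⟨P, I, X, f, m⟩ (σ.setVar (.name v) (e.value I σ)) β) :
    (met role (.seq (.asg d (.var v) e) s) L).Sat ⟨P, I, X, f, m⟩ σ β := by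
  rw [sat_met hP hr] at h ⊢
  rintro D k st n θ st' n' hs rfl
  obtain ⟨sc, p, L', st₁, n₁, r₁, r₂, hstep, -, hθ, hc, hs'⟩ := hs.step
  cases hstep with
  | asgVar _ _ _ _ _ _ a ha =>
    obtain ⟨l, τ, rfl, hl, hτ⟩ := hc.single
    obtain rfl := hl.noEv
    obtain ⟨w, hw, rfl⟩ := hs.appState.setVar hτ
    cases Expr.eval_app I hs.appState e ha hw
    rw [hθ]
    exact holds_noEv_cons (h D k _ _ _ _ _ hs' rfl)

theorem sat_met_asgField {d : Option DType} {g : Field} {e : Expr} {s : Stmt} {L : MType R}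
    {σ : State Val} {β : Asg UVar}
    (h : (met role s L).Sat ⟨P, I, X, f, m⟩ (σ.setField g (e.value I σ)) β) :
    (met role (.seq (.asg d (.field g) e) s) L).Sat ⟨P, I, X, f, m⟩ σ β := by
  rw [sat_met hP hr] at h ⊢
  rintro D k st n θ st' n' hs rfl
  obtain ⟨sc, p, L', st₁, n₁, r₁, r₂, hstep, -, hθ, hc, hs'⟩ := hs.step
  cases hstep with
  | asgField _ _ _ _ _ _ a ha =>
    obtain ⟨l, τ, rfl, hl, hτ⟩ := hc.single
    obtain rfl := hl.noEv
    obtain ⟨w, hw, rfl⟩ := hs.appState.setField hτ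
    cases Expr.eval_app I hs.appState e ha hw
    have hρ : ∀ r, (θ.first.setField g (e.value I θ.first)).heap (role r) =
      θ.first.heap (role r) := fun r => hs.ref_eq hP (hr _ D.decl_eq r) hs'
    have := h D k _ _ _ _ _ hs' rfl
    simp only [hρ] at this
    rw [hθ]
    exact holds_noEv_cons this

theorem sat_met_return {e : Expr} {φ : FForm UVar} {σ : State Val} {β : Asg UVar}
    (h : φ.Sat P I (σ.setVar .result (e.value I σ)) β) :
    (met role (.ret e) (.term φ)).Sat ⟨P, I, X, f, m⟩ σ β := by
  rw [sat_met hP hr]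
  rintro D k st n θ st' n' hs rfl
  obtain ⟨sc, p, L', st₁, n₁, r₁, r₂, hstep, -, hθ, hc, hs'⟩ := Exec.Seg.step hs
  cases hstep with
  | ret _ _ _ _ a ha =>
    obtain ⟨l, τ, rfl, hl, hτ⟩ := hc.single
    obtain ⟨x, g, m', w, rfl, hw⟩ := hl.futEv
    cases Expr.eval_app I hs.appState e ha hw
    have hnil := congrArg Hist.rest hs'.nil
    dsimp only at hnil
    subst hnil
    rw [hθ]
    intro i h₁ h₂ hvis
    have hlen : ((Hist.elems (⟨θ.first, [(.ev (.futEv x g m' (e.value I θ.first)), τ)]⟩ :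
      CHist)).length : ℤ) = 3 := by simp [Hist.elems]
    rw [List.append_nil, hlen] at h₂
    rw [List.append_nil] at hvis ⊢
    obtain rfl | rfl | rfl : i = 1 ∨ i = 2 ∨ i = 3 := by omega
    · exact absurd hvis (Hist.not_vis_of_state (Hist.at_one _))
    · exact ⟨x, g, m', _, Hist.at_two _ _ _ _, θ.first, Hist.at_one _, h⟩
    · exact absurd hvis (Hist.not_vis_of_state (Hist.at_three _ _ _ _))

theorem sat_met_skip {σ : State Val} {β : Asg UVar} :
    (met role .skip (.skip : MType R)).Sat ⟨P, I, X, f, m⟩ σ β := by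
  rw [sat_met hP hr]
  rintro D k st n θ st' n' hs rfl
  obtain ⟨sc, p, L', st₁, n₁, r₁, r₂, hstep, -, hθ, hc, hs'⟩ := Exec.Seg.step hs
  cases hstep with
  | skip =>
    cases hc.nil
    have hnil := congrArg Hist.rest hs'.nil
    dsimp only at hnil
    subst hnil
    rw [hθ]
    intro i h₁ h₂
    have hlen : ((Hist.elems ⟨θ.first, ([] : List (Lab CEvent × State Val))⟩).length : ℤ) = 1 := by
      simp [Hist.elems]
    rw [List.append_nil, hlen] at h₂
    obtain rfl : i = 1 := by omega
    exact Hist.not_vis_of_state (Hist.at_one _)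

theorem sat_met_ite {e : Expr} {s s' s'' : Stmt} {J J₁ J₂ : List ℕ} {L : ℕ → MType R}
    (hJ : J₁ ∪ J₂ ⊆ J) {σ : State Val} {β : Asg UVar}
    (h₁ : e.value I σ = .bool true →
      (met role (.seq s s'') (.active J₁ L)).Sat ⟨P, I, X, f, m⟩ σ β)
    (h₂ : ¬ e.value I σ = .bool true →
      (met role (.seq s' s'') (.active J₂ L)).Sat ⟨P, I, X, f, m⟩ σ β) :
    (met role (.seq (.ite e s s') s'') (.active J L)).Sat ⟨P, I, X, f, m⟩ σ β := by
  rw [sat_met hP hr] at h₁ h₂ ⊢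
  rintro D k st n θ st' n' hs rfl
  obtain ⟨sc, p, L', st₁, n₁, r₁, r₂, hstep, hsel, hθ, hc, hs'⟩ := Exec.Seg.step hs
  cases hstep with
  | iteT _ _ _ _ _ _ a ha =>
    cases hc.nil
    have hv := Expr.eval_app I hs.appState e ha (hsel a rfl)
    obtain ⟨j, hj, H⟩ := h₁ (SE.val.inj hv).symm D k _ _ _ _ _ hs' rfl
    rw [hθ]
    exact ⟨j, hJ (List.mem_union_iff.2 (.inl hj)), H⟩
  | iteF _ _ _ _ _ _ a ha =>
    cases hc.nil
    have := Expr.value_of_not I hs.appState ha (hsel a rfl)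
    obtain ⟨j, hj, H⟩ := h₂ (by simp [this]) D k _ _ _ _ _ hs' rfl
    rw [hθ]
    exact ⟨j, hJ (List.mem_union_iff.2 (.inr hj)), H⟩

theorem sat_met_call {d : Option DType} {v : ℕ} {O : Fin R} {m' : MName} {es : List Expr}
    {s : Stmt} {φ : FForm UVar} {L : MType R} {σ : State Val} {β : Asg UVar}
    (hφ : φ.Sat P I σ (β.setPars (es.map (Expr.value I σ))))
    (h : ∀ w, (met role s L).Sat ⟨P, I, X, f, m⟩ (σ.setVar (.name v) w) β) :
    (met role (.seq (.call d v (role O) m' es) s) (.seq (.call O m' es.length φ) L)).Sat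
      ⟨P, I, X, f, m⟩ σ β := by
  simp only [sat_met hP hr] at h ⊢
  rintro D k st n θ st' n' hs rfl
  obtain ⟨sc, p, L', st₁, n₁, r₁, r₂, hstep, -, hθ, hc, hs'⟩ := Exec.Seg.step hs
  cases hstep with
  | call _ _ _ _ _ _ _ _ as has =>
    obtain ⟨l, τ, rfl, hl, hτ⟩ := hc.single
    obtain ⟨x, y, g, vs, rfl, hy, hvs⟩ := hl.invEv
    obtain ⟨w, hw, rfl⟩ := hs.appState.setVar hτ
    have hy' : y = θ.first.heap (role O) := by
      have := hy.symm.trans (hs.appState.2 (role O))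
      simpa [State.emb] using this
    have hvs' := Expr.map_eval_app I hs.appState (forall₂_of_mapM has) hvs
    subst hy' hvs'
    have H := h w D k _ _ _ _ _ hs' rfl
    rw [hθ]
    -- The call is at position `2`; the continuation starts in the state at position `3`.
    refine ⟨3, by omega, Hist.three_le_length _ _ _ _, fun i h₁ h₂ hvis => ?_, H.cons⟩
    obtain rfl | rfl | rfl : i = 1 ∨ i = 2 ∨ i = 3 := by omega
    · exact absurd hvis (Hist.not_vis_of_state (Hist.at_one _))
    · exact ⟨x, g, _, by simp, Hist.at_two _ _ _ _, θ.first, Hist.at_one _, hφ⟩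
    · exact absurd hvis (Hist.not_vis_of_state (Hist.at_three _ _ _ _))

theorem sat_met_get {d : Option DType} {v : ℕ} {e : Expr} {i : ℕ} {s : Stmt} {ms : List MName}
    {φ : FForm UVar} {L₁ L₂ : MType R} {σ : State Val} {β : Asg UVar}
    (h₁ : ∀ w, φ.Sat P I ((σ.setVar (.name v) w).setVar .result w) β →
      (met role s L₁).Sat ⟨P, I, X, f, m⟩ (σ.setVar (.name v) w) β)
    (h₂ : ∀ w, ¬ φ.Sat P I ((σ.setVar (.name v) w).setVar .result w) β →
      (met role s L₂).Sat ⟨P, I, X, f, m⟩ (σ.setVar (.name v) w) β)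
    (hms : (BForm.mod (.seq (.get d v e i) s) p2Spec ms).Sat ⟨P, I, X, f, m⟩ σ β) :
    (met role (.seq (.get d v e i) s) (.passive ms φ L₁ L₂)).Sat ⟨P, I, X, f, m⟩ σ β := by
  simp only [sat_met hP hr] at h₁ h₂ ⊢
  rintro D k st n θ st' n' hs rfl
  have hp2 := sat_p2Spec (hms θ (mem_selected.2 ⟨D, k, st, n, st', n', hs, rfl⟩))
  obtain ⟨sc, p, L', st₁, n₁, r₁, r₂, hstep, -, hθ, hc, hs'⟩ := Exec.Seg.step hs
  cases hstep with
  | get _ _ _ _ _ _ _ a ha =>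
    obtain ⟨l, τ, rfl, hl, hτ⟩ := hc.single
    obtain ⟨x, g, m', w, rfl, hw⟩ := hl.futREv
    obtain ⟨w', hw', rfl⟩ := hs.appState.setVar hτ
    rw [hw'] at hw
    simp only [Option.some.injEq, SE.val.injEq] at hw
    subst hw
    have hm : m' ∈ ms := by
      obtain ⟨x', g', m'', w'', i', hat, hmem⟩ := hp2
      rw [hθ] at hat
      have := (Hist.at_two _ _ _ _).symm.trans hat
      simp only [Option.some.injEq, Elem.lab.injEq, Lab.ev.injEq, Event.futREv.injEq] at this
      rwa [this.2.2.1]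
    rw [hθ]
    -- The read is at position `2`; the condition on the result is evaluated in the state at
    -- position `3`.
    refine ⟨1, 2, 3, le_rfl, by omega, by omega, Hist.three_le_length _ _ _ _, fun l hl₁ hl₂ => ?_,
      x, g, m', w', i, Hist.at_two _ _ _ _, hm, ?_, ?_⟩
    · by_cases hl1 : l = 1
      · subst hl1
        exact .inr (.inr ⟨le_rfl, Hist.not_vis_of_state (Hist.at_one _)⟩)
      · omega
    · rintro ⟨τ, hτ, hφ⟩
      have := (Hist.at_three _ _ _ _).symm.trans hτ
      simp only [Option.some.injEq, Elem.st.injEq] at this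
      subst this
      exact (h₁ w' hφ D k _ _ _ _ _ hs' rfl).cons
    · intro hφ
      exact (h₂ w' (fun h => hφ ⟨_, Hist.at_three _ _ _ _, h⟩) D k _ _ _ _ _ hs' rfl).cons

end Rules

/-! ### The loop rule -/

section Loop

variable {P : Program} {I : Interp} {X f : Option ℕ} {m : MName} {R : ℕ} {role : Fin R → Field}

/-- The invariant `J` is handed on from iteration to iteration, and the type `L` of the iterations
is that of a segment of the body, in the state where the iteration starts. -/
theorem sat_met_while (hP : P.WF)
    (hr : ∀ d, P.meth? m = some d → ∀ r, P.IsRef m.cls (role r)) {T : DType} {e : Expr}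
    {s s' : Stmt} {J : FForm UVar} {L L' : MType R} {σ : State Val} {β : Asg UVar}
    (h : J.Sat P I σ β)
    (h₁ : ∀ τ, J.Sat P I τ β → e.value I τ = .bool true →
      (BForm.mod s (pstSpec T) J).Sat ⟨P, I, X, f, m⟩ τ β)
    (h₂ : ∀ τ, J.Sat P I τ β → e.value I τ = .bool true →
      (met role s L).Sat ⟨P, I, X, f, m⟩ τ β)
    (h₃ : ∀ τ, J.Sat P I τ β → ¬ e.value I τ = .bool true →
      (met role s' L').Sat ⟨P, I, X, f, m⟩ τ β) :
    (met role (.seq (.whl e s) s') (.seq (.star L) L')).Sat ⟨P, I, X, f, m⟩ σ β := by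
  simp only [sat_met hP hr] at h₂ h₃ ⊢
  rintro D k st n θ st' n' ⟨sc, p, hrun, hl, hc⟩ rfl
  -- Every iteration extends the set of positions at the front, and hands the invariant on.
  have key : ∀ {st n sc p st' n'}, LLoop D.ctx e s s'.flat st n sc p st' n' → ∀ θ : CHist,
      D.Run ⟨.whl e s :: s'.flat ++ k, st, n⟩ sc p ⟨k, st', n'⟩ → D.conc.Conc st p θ →
      J.Sat P I θ.first β → ∃ b : ℤ, 1 ≤ b ∧ b ≤ θ.elems.length ∧
        MType.Iterates P I θ (fun r => θ.first.heap (role r)) β L 1 b ∧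
        L'.Holds P I θ (fun r => θ.first.heap (role r)) β b θ.elems.length := by
    clear h hrun hl hc θ
    intro st n sc p st' n' hl
    induction hl with
    | exit st n a sc p st' n' ha hl =>
      intro θ hrun hc hJ
      have hstep := LStep.whlF (c := D.ctx) e s (s'.flat ++ k) st n a ha
      obtain ⟨hr₁, hr₂⟩ := Exec.Run.split (p := []) hrun hstep.run (hl.append k)
      have hv := Expr.value_of_not I hc.1 ha (hr₁.selectable rfl)
      exact ⟨1, le_rfl, θ.one_le_length, .refl _ _ _,
        h₃ _ hJ (by simp [hv]) D k st n θ st' n' ⟨sc, p, hr₂, hl, hc⟩ rfl⟩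
    | iter st n a sc p st₁ n₁ sc' p' st' n' ha hl hl' hloop ih =>
      intro θ hrun hc hJ
      have hstep := LStep.whlT (c := D.ctx) e s (s'.flat ++ k) st n a ha
      obtain ⟨hr₁, hr₂⟩ := Exec.Run.split (p := []) hrun hstep.run
        ((hl.append (.whl e s :: s'.flat ++ k)).trans (hl'.append k))
      obtain ⟨hr₃, hr₄⟩ := hr₂.split (hl.append (.whl e s :: s'.flat ++ k)) (hl'.append k)
      have hv := SE.val.inj (Expr.eval_app I hc.1 e ha (hr₁.selectable rfl))
      obtain ⟨r₁, r₂, hθ, hc₁, hc₂⟩ := hc.split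
      have hs : D.Seg s.flat (.whl e s :: s'.flat ++ k) st n ⟨θ.first, r₁⟩ st₁ n₁ :=
        ⟨sc, p, hr₃, hl, hc₁⟩
      have hlast := hl.last
      dsimp only at hlast
      rw [hlast] at hc₂
      have hs' : D.Seg (.whl e s :: s'.flat) k st₁ n₁ ⟨Hist.last ⟨θ.first, r₁⟩, r₂⟩ st' n' :=
        ⟨sc', p', hr₄, hl', hc₂⟩
      -- The loop is not the last statement of the method, hence its body contains no `return`.
      have hno : s.NoRet := (hrun.retLast hP).head (by simp)
      have hpst := sat_pstSpec (h₁ _ hJ hv.symm _ (mem_selected.2 ⟨D, _, _, _, _, _, hs, rfl⟩))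
        (hc₁.noFutEv (hl.noRet (Stmt.noRet_flat s hno)))
      have H := h₂ _ hJ hv.symm D _ _ _ _ _ _ hs rfl
      have hρ : ∀ r, (Hist.last ⟨θ.first, r₁⟩).heap (role r) = θ.first.heap (role r) :=
        fun r => hs.ref_eq hP (hr _ D.decl_eq r) hs'
      obtain ⟨b, hb₁, hb₂, hit, H'⟩ := ih _ hr₄ hc₂ hpst
      simp only [hρ] at hit H'
      obtain ⟨s₀, r₀⟩ := θ
      dsimp only at hθ hb₂ H hit H' ⊢
      subst hθ
      have hlen := Hist.length_elems_append s₀ r₁ r₂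
      -- The first iteration ends at position `1 + 2 * r₁.length`, where the window of the others
      -- starts.
      have hit' := hit.append_right le_rfl hb₂
      have H'' := H'.append_right hb₁ le_rfl
      have H₁ := H.append_left (r' := r₂) le_rfl le_rfl
      have hlen₁ : ((Hist.elems ⟨s₀, r₁⟩).length : ℤ) = 1 + 2 * r₁.length := by
        rw [Hist.length_elems]
        push_cast
        omega
      rw [hlen₁] at H₁
      rw [← hlen] at H''
      refine ⟨b + 2 * r₁.length, by omega, by omega, .cons (by omega) H₁ hit', H''⟩
  obtain ⟨b, hb₁, hb₂, hit, H⟩ := key hl.loop θ hrun hc h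
  exact ⟨b, hb₁, hb₂, hit.holds_star hb₁, H⟩

end Loop

/-! ### Soundness of the calculus -/

section Calculus

variable {P : Program} {I : Interp} {X f : Option ℕ} {m : MName} {R : ℕ} {role : Fin R → Field}

theorem sat_met_set {E : Env} {s : Stmt} {L : MType R} {σ : State Val} {β : Asg UVar} {x : UVar}
    (hx : ¬ ((metSpec role).α L).Occ (.u x)) (w : Val) :
    (met role s L).Sat E σ (β.set .val x w) ↔ (met role s L).Sat E σ β :=
  BForm.sat_congr E _ σ (Asg.eqOff_set x β .val w) hx

/-- All rules of the calculus preserve validity. -/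
theorem MetRule.sound (hP : P.WF) (hr : ∀ d, P.meth? m = some d → ∀ r, P.IsRef m.cls (role r))
    {prems : List Sequent} {concl : Sequent} (h : MetRule ⟨P, I, X, f, m⟩ role prems concl)
    (hprem : ∀ q ∈ prems, q.Valid ⟨P, I, X, f, m⟩) : concl.Valid ⟨P, I, X, f, m⟩ := by
  cases h <;> simp only [List.mem_cons, List.not_mem_nil, or_false, forall_eq_or_imp, forall_eq,
    IsEmpty.forall_iff, implies_true] at hprem
  case metV Γ Δ U d v e s L =>
    exact hprem.upd_mono fun σ β h => sat_met_asgVar hP hr (BForm.sat_upd_asgE.1 h)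
  case metF Γ Δ U d g e s L =>
    refine hprem.upd_mono fun σ β h => sat_met_asgField hP hr ?_
    simp only [BForm.Sat, Upd.eval, BTm.eval, FTm.eval_toB, Expr.eval_toTm] at h
    exact h
  case metGet Γ Δ U d v e i s ms φ L₁ L₂ x hΓ hΔ hU hφ hL₁ hL₂ =>
    obtain ⟨hp₁, hp₂, hp₃⟩ := hprem
    rw [Sequent.valid_insert_upd]
    intro st β hst
    rcases hp₁.upd_fresh hΓ hΔ hU st β hst with h₁ | h
    · rcases hp₂.upd_fresh hΓ hΔ hU st β hst with h₂ | h
      · have hφ' : ∀ (σ : State Val) w, ((φ.substResult x).toB).Sat ⟨P, I, X, f, m⟩ σ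
            (β.set .val x w) ↔ φ.Sat P I (σ.setVar .result w) β := by
          intro σ w
          rw [FForm.sat_toB, FForm.sat_substResult _ _ _ _ _ _ hφ, Asg.set_self]
          exact FForm.sat_congr P I _ φ (Asg.eqOff_set x β .val w) hφ
        simp only [BForm.sat_upd_lvar, BForm.sat_imp, sat_met_set hL₁, Asg.set_self, hφ'] at h₁
        simp only [BForm.sat_upd_lvar, BForm.sat_imp, sat_met_set hL₂, Asg.set_self,
          BForm.sat_not, hφ'] at h₂
        exact .inl (sat_met_get hP hr h₁ h₂ (Sequent.valid_singleton.1 hp₃ _ β (by simp)))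
      · exact .inr h
    · exact .inr h
  case metWhile Γ Δ U e s s' J L L' =>
    obtain ⟨hp, hp₁, hp₂, hp₃⟩ := hprem
    simp only [Sequent.valid_singleton, Set.mem_insert_iff, Set.mem_singleton_iff, forall_eq_or_imp,
      forall_eq, BForm.sat_not, FForm.sat_toB, Expr.sat_toForm] at hp₁ hp₂ hp₃
    exact hp.upd_mono fun σ β h => sat_met_while hP hr ((FForm.sat_toB _ _ _ _).1 h)
      (fun τ hJ he => hp₁ τ β ⟨hJ, he⟩) (fun τ hJ he => hp₂ τ β ⟨hJ, he⟩)
      fun τ hJ he => hp₃ τ β ⟨hJ, he⟩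
  case metIf Γ Δ U e s s' s'' J J₁ J₂ L _ _ hJ =>
    refine hprem.1.upd_mono₂ hprem.2 fun σ β h₁ h₂ => ?_
    simp only [BForm.sat_imp, BForm.sat_not, FForm.sat_toB, Expr.sat_toForm] at h₁ h₂
    exact sat_met_ite hP hr hJ h₁ h₂
  case metCall Γ Δ U d v O m' es s φ L x hΓ hΔ hU hφ hL =>
    obtain ⟨hp₁, hp₂⟩ := hprem
    rw [Sequent.valid_insert_upd] at hp₁ ⊢
    intro st β hst
    rcases hp₁ st β hst with h₁ | h
    · rcases hp₂.upd_fresh hΓ hΔ hU st β hst with h₂ | h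
      · simp only [BForm.sat_upd_lvar, sat_met_set hL, Asg.set_self] at h₂
        rw [FForm.sat_toB, FForm.sat_substPars] at h₁
        exact .inl (sat_met_call hP hr h₁ h₂)
      · exact .inr h
    · exact .inr h
  case metReturn Γ Δ U e φ =>
    refine hprem.upd_mono fun σ β h => sat_met_return hP hr ?_
    rwa [BForm.sat_upd_asgE, FForm.sat_toB] at h
  case metSkip Γ Δ U =>
    rw [Sequent.valid_insert_upd]
    exact fun st β _ => .inl (sat_met_skip hP hr)

end Calculus

end CAO

theorem mainTheorem1 (P : CAO.Program) (hP : P.WF) (I : CAO.Interp)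
    (ι : CAO.Scheme) (hroles : ι.RolesFit P) (hι : ι.Consistent P I)
    (m : CAO.MName) (X f : Option ℕ) :
    CAO.MetSound ⟨P, I, X, f, m⟩ (ι m).role :=
  ⟨fun _ _ h hp => h.sound hP (fun d hd r => hroles m d hd r) hp, fun _ _ h => h.equiv⟩
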